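/- **Setting.** Let $X$ be a right-continuous Markov chain (with left limits) on a probability space $(\Omega,\mathcal F,P)$ with state space $\{e_1,\dots,e_N\}\subset\mathbb R^N$ and bounded measurable rate matrices $A_t$ ($A_t^{ji}$ is the rate from $e_i$ to $e_j$, columns sum to $0$). Let $(\mathcal F_t)$ be its natural filtration augmented by the $P$-null events, $dM_t=dX_t-A_tX_t\,dt$, $\Psi_t=\mathrm{diag}(A_tX_t)-\mathrm{diag}(X_t)A_t'-A_t\,\mathrm{diag}(X_t)$ and $\|z\|_{X_t}^2=z'\Psi_tz$. Fix $T\in[0,\infty)$ and measurable deterministic functions $C_t\in\mathbb R^{N\times N}$, $D_t\in\mathbb R^N$, bounded on $[0,T]$. Put $$\pi_t=\exp\Big(-\int_0^tX_{u-}'C_u\,dX_u-\int_0^tD_u'X_u\,du\Big),\qquad \sigma_t^{ij}=e^{C_t^{ii}-C_t^{ij}}-1,\qquad r_t=D_t'X_t-X_t'\sigma_tA_tX_t,$$ $\Gamma_t^{ii}=A_t^{ii}-D_t^i$, and $\Gamma_t^{ij}=A_t^{ij}e^{C_t^{jj}-C_t^{ji}}$ for $i\ne j$. Let $$f(t,v,z)=-r_tv-X_t'(-r_t+A_t'-\Gamma_t')z,$$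 $$H_s(t,z)=s\,X_t'(-r_t+A_t'-\Gamma_t')z-\sum_{i,j}(X_t'e_i)A_t^{ji}\sigma_t^{ij}\,z'(e_j-e_i)\qquad(s\in\{1,-1\}),$$ $$I(t,z,v)=v\,X_{t-}'\sigma_t+\sum_{i,j}(e_i'X_{t-})\sigma_t^{ij}\,z'(e_j-e_i)\,e_j'+z'.$$ Let $G$ be a right-continuous adapted real process. Consider triples $(V,Z,K)$ such that $V$ is adapted, right-continuous with left limits and $E\int_0^TV_u^2du<\infty$; $Z$ is predictable with values in $\mathbb R^N$ and $E\int_0^T\|Z_u\|_{X_u}^2du<\infty$; $K$ is adapted, continuous and nondecreasing, $K_0=0$, $E[K_T^2]<\infty$; almost surely $V_t\ge G_t$ for all $t\in[0,T]$, and almost surely $\int_0^T(V_u-G_u)\,dK_u=0$. Put $\tilde V_t=\pi_tV_t$, $\tilde Z_t=\pi_{t-}Z_t$, $\tilde K_t=\int_0^t\pi_u\,dK_u$. Such a triple is a solution of the *reflected BSDE* if, almost surely, for all $t\in[0,T]$, $$V_t=G_T+\int_t^Tf(u,V_u,Z_u)\,du+K_T-K_t-\int_t^TZ_u'\,dM_u,$$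 and of the *discounted reflected BSDE with driver $H_s$* if, almost surely, for all $t\in[0,T]$, $$\tilde V_t=\pi_TG_T+\int_t^TH_s(u,\tilde Z_u)\,du+\tilde K_T-\tilde K_t-\int_t^TI(u,\tilde Z_u,\tilde V_{u-})\,dM_u .$$ **Proposition.** 1. Every solution $(V,Z,K)$ of the reflected BSDE is a solution of the discounted reflected BSDE with driver $H_{-1}$. 2. Let $s\in\{1,-1\}$ and let $(V,Z,K)$ be a solution of the discounted reflected BSDE with driver $H_s$. Then for every $t\in[0,T]$, almost surely, $$\tilde V_t=\operatorname*{ess\,sup}_{\tau\in\mathcal S_t^T}E\Big[\int_t^\tau H_s(u,\tilde Z_u)\,du+\pi_\tau G_\tau1_{\{\tau<T\}}+\pi_TG_T1_{\{\tau=T\}}\,\Big|\,\mathcal F_t\Big],$$ where $\mathcal S_t^T$ is the set of all stopping times $\tau$ with $t\le\tau\le T$, and the conditional expectation of $\xi$ is $E[\xi^+|\mathcal F_t]-E[\xi^-|\mathcal F_t]\in[-\infty,\infty]$. The essential supremum is attained at the first time $V$ hits $G$, $\tau_t=\inf\{u\in[t,T]:V_u=G_u\}$ (with $\tau_t=T$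 if there is no such $u$): $\tau_t$ agrees almost surely with a stopping time $\tau\in\mathcal S_t^T$ whose reward is integrable and whose conditional expectation given $\mathcal F_t$ equals $\tilde V_t$ almost surely. If $P$ is complete, then $\tau_t$ itself belongs to $\mathcal S_t^T$. -/

import Mathlib

open MeasureTheory Filter Set Topology
open scoped NNReal ENNReal Matrix

noncomputable section

namespace MarkovRBSDE

/-! ### Time, paths and filtrations -/

/-- Lebesgue measure on the time axis `[0, ∞)`. -/
def leb : Measure ℝ≥0 := Measure.comap ((↑) : ℝ≥0 → ℝ) volume

/-- Right-continuous paths with left limits. -/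
def IsRCLL {E : Type*} [TopologicalSpace E] (x : ℝ≥0 → E) : Prop :=
  (∀ t, ContinuousWithinAt x (Ici t) t) ∧ ∀ t, ∃ l, Tendsto x (𝓝[<] t) (𝓝 l)

/-- The measurable events that agree, up to a `P`-null set, with an event of the sub-σ-algebra
`m`. -/
@[reducible]
def augment {Ω : Type*} {m0 : MeasurableSpace Ω} (P : Measure[m0] Ω) (m : MeasurableSpace Ω) :
    MeasurableSpace Ω where
  MeasurableSet' s := MeasurableSet[m0] s ∧ ∃ s', MeasurableSet[m] s' ∧ s =ᵐ[P] s'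
  measurableSet_empty := ⟨@MeasurableSet.empty _ m0, ∅, @MeasurableSet.empty _ m, EventuallyEq.rfl⟩
  measurableSet_compl := by
    rintro s ⟨hs, s', hs', h⟩
    exact ⟨@MeasurableSet.compl _ _ m0 hs, s'ᶜ, @MeasurableSet.compl _ _ m hs', h.compl⟩
  measurableSet_iUnion := by
    intro f hf
    choose h1 g h2 h3 using hf
    exact ⟨@MeasurableSet.iUnion _ _ m0 _ _ h1, ⋃ i, g i, @MeasurableSet.iUnion _ _ m _ _ h2,
      Filter.EventuallyEq.countable_iUnion h3⟩

/-- The filtration generated by a process `X` with values in a finite set, augmented by the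
`P`-null sets. -/
def chainFiltration {Ω : Type*} {m0 : MeasurableSpace Ω} (P : Measure Ω) {N : ℕ}
    (X : ℝ≥0 → Ω → Fin N) : Filtration ℝ≥0 m0 where
  seq t := augment P (⨆ u : Iic t, MeasurableSpace.comap (X u) ⊤)
  mono' := by
    rintro s t hst a ⟨ha, a', ha', h⟩
    refine ⟨ha, a', ?_, h⟩
    have hle : (⨆ u : Iic s, MeasurableSpace.comap (X u) ⊤) ≤
        ⨆ u : Iic t, MeasurableSpace.comap (X u) ⊤ :=
      iSup_le fun u => le_iSup (fun u : Iic t => MeasurableSpace.comap (X u) ⊤)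
        ⟨u.1, le_trans u.2 hst⟩
    exact hle a' ha'
  le' _ _ h := h.1

/-! ### The Markov chain -/

/-- A bounded measurable family of rate matrices; `A t j i` is the rate of the jump from `i` to
`j` at time `t`, so that columns sum to zero. -/
structure IsRateMatrix {N : ℕ} (A : ℝ≥0 → Matrix (Fin N) (Fin N) ℝ) : Prop where
  measurable : ∀ i j, Measurable fun t => A t i j
  bounded : ∃ m : ℝ, ∀ t i j, |A t i j| ≤ m
  nonneg : ∀ t i j, j ≠ i → 0 ≤ A t j i
  sum_eq_zero : ∀ t i, ∑ j, A t j i = 0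

/-- `p s t j i` is the transition probability from `i` at time `s` to `j` at time `t`: the solution
of the Kolmogorov forward equation `∂p/∂t = A p`, `p s s = 1`, in integrated form. -/
structure IsTransitionMatrix {N : ℕ} (A : ℝ≥0 → Matrix (Fin N) (Fin N) ℝ)
    (p : ℝ≥0 → ℝ≥0 → Matrix (Fin N) (Fin N) ℝ) : Prop where
  continuousOn : ∀ s j i, ContinuousOn (fun t => p s t j i) (Ici s)
  forward : ∀ s t, s ≤ t → ∀ j i,
    p s t j i = (1 : Matrix (Fin N) (Fin N) ℝ) j i + ∫ u in Ioc s t, (A u * p s u) j i ∂leb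

/-- `X` (recorded through the index of its state: `X t = i` stands for the state `e_i`) is a
right-continuous Markov chain with rate matrices `A`. -/
structure IsMarkovChain {Ω : Type*} [MeasurableSpace Ω] (P : Measure Ω) {N : ℕ}
    (A : ℝ≥0 → Matrix (Fin N) (Fin N) ℝ) (X : ℝ≥0 → Ω → Fin N) : Prop where
  measurable : ∀ t, Measurable (X t)
  rcll : ∀ ω, IsRCLL fun t => X t ω
  rate : IsRateMatrix A
  markov : ∃ p, IsTransitionMatrix A p ∧ ∀ s t, s ≤ t → ∀ j,
    P[(X t ⁻¹' {j}).indicator (fun _ => (1 : ℝ)) | chainFiltration P X s]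
      =ᵐ[P] fun ω => p s t j (X s ω)

section Chain

variable {Ω : Type*} {N : ℕ}

/-- The chain as a process of unit vectors: `X_t ∈ {e_1, …, e_N}`. -/
def vec (X : ℝ≥0 → Ω → Fin N) (t : ℝ≥0) (ω : Ω) : Fin N → ℝ := Pi.single (X t ω) 1

/-- The left limit `X_{t-}` as a unit vector. -/
def vecL (X : ℝ≥0 → Ω → Fin N) (t : ℝ≥0) (ω : Ω) : Fin N → ℝ :=
  Pi.single (Function.leftLim (fun u => X u ω) t) 1

/-- `∫_{(0,t]} φ_u' dX_u`, the (finite) sum of `φ_u' ΔX_u` over the jump times. -/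
def intX (X : ℝ≥0 → Ω → Fin N) (φ : ℝ≥0 → Ω → Fin N → ℝ) (t : ℝ≥0) (ω : Ω) : ℝ :=
  ∑ᶠ u ∈ Ioc 0 t, φ u ω ⬝ᵥ (vec X u ω - vecL X u ω)

/-- `∫_{(0,t]} φ_u' dM_u` for the martingale `dM_u = dX_u - A_u X_u du`; since `M` has paths of
finite variation, this is a pathwise integral. -/
def intM (A : ℝ≥0 → Matrix (Fin N) (Fin N) ℝ) (X : ℝ≥0 → Ω → Fin N)
    (φ : ℝ≥0 → Ω → Fin N → ℝ) (t : ℝ≥0) (ω : Ω) : ℝ :=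
  intX X φ t ω - ∫ u in Ioc 0 t, φ u ω ⬝ᵥ (A u *ᵥ vec X u ω) ∂leb

/-- `Ψ_t = diag(A_t X_t) - diag(X_t) A_t' - A_t diag(X_t)`. -/
def Psi (A : ℝ≥0 → Matrix (Fin N) (Fin N) ℝ) (X : ℝ≥0 → Ω → Fin N) (t : ℝ≥0) (ω : Ω) :
    Matrix (Fin N) (Fin N) ℝ :=
  Matrix.diagonal (A t *ᵥ vec X t ω) - Matrix.diagonal (vec X t ω) * (A t)ᵀ
    - A t * Matrix.diagonal (vec X t ω)

/-- The squared seminorm `‖z‖²_{X_t} = z' Ψ_t z`. -/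
def seminormSq (A : ℝ≥0 → Matrix (Fin N) (Fin N) ℝ) (X : ℝ≥0 → Ω → Fin N) (t : ℝ≥0) (ω : Ω)
    (z : Fin N → ℝ) : ℝ :=
  z ⬝ᵥ (Psi A X t ω *ᵥ z)

/-! ### The stochastic discount function -/

/-- `π_t = exp(-∫_0^t X_{u-}' C_u dX_u - ∫_0^t D_u' X_u du)`. -/
def sdf (X : ℝ≥0 → Ω → Fin N) (C : ℝ≥0 → Matrix (Fin N) (Fin N) ℝ) (D : ℝ≥0 → Fin N → ℝ)
    (t : ℝ≥0) (ω : Ω) : ℝ :=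
  Real.exp (-intX X (fun u ω => vecL X u ω ᵥ* C u) t ω
    - ∫ u in Ioc 0 t, D u ⬝ᵥ vec X u ω ∂leb)

/-- The left limit `π_{t-}`. -/
def sdfL (X : ℝ≥0 → Ω → Fin N) (C : ℝ≥0 → Matrix (Fin N) (Fin N) ℝ) (D : ℝ≥0 → Fin N → ℝ)
    (t : ℝ≥0) (ω : Ω) : ℝ :=
  Function.leftLim (fun u => sdf X C D u ω) t

/-- `σ_t^{ij} = exp(C_t^{ii} - C_t^{ij}) - 1`. -/
def sig (C : ℝ≥0 → Matrix (Fin N) (Fin N) ℝ) (t : ℝ≥0) : Matrix (Fin N) (Fin N) ℝ :=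
  Matrix.of fun i j => Real.exp (C t i i - C t i j) - 1

/-- `Γ_t^{ii} = A_t^{ii} - D_t^i` and `Γ_t^{ij} = A_t^{ij} exp(C_t^{jj} - C_t^{ji})`, `i ≠ j`. -/
def Gam (A C : ℝ≥0 → Matrix (Fin N) (Fin N) ℝ) (D : ℝ≥0 → Fin N → ℝ) (t : ℝ≥0) :
    Matrix (Fin N) (Fin N) ℝ :=
  Matrix.of fun i j =>
    if i = j then A t i i - D t i else A t i j * Real.exp (C t j j - C t j i)

/-- The interest rate `r_t = D_t' X_t - X_t' σ_t A_t X_t`. -/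
def rate (A : ℝ≥0 → Matrix (Fin N) (Fin N) ℝ) (X : ℝ≥0 → Ω → Fin N)
    (C : ℝ≥0 → Matrix (Fin N) (Fin N) ℝ) (D : ℝ≥0 → Fin N → ℝ) (t : ℝ≥0) (ω : Ω) : ℝ :=
  D t ⬝ᵥ vec X t ω - vec X t ω ⬝ᵥ (sig C t *ᵥ (A t *ᵥ vec X t ω))

/-! ### The drivers -/

/-- `X_t' (-r_t + (A_t' - Γ_t')) z`. -/
def excess (A : ℝ≥0 → Matrix (Fin N) (Fin N) ℝ) (X : ℝ≥0 → Ω → Fin N)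
    (C : ℝ≥0 → Matrix (Fin N) (Fin N) ℝ) (D : ℝ≥0 → Fin N → ℝ) (t : ℝ≥0) (ω : Ω)
    (z : Fin N → ℝ) : ℝ :=
  vec X t ω ⬝ᵥ (-(rate A X C D t ω) • z + ((A t)ᵀ - (Gam A C D t)ᵀ) *ᵥ z)

/-- The driver `f(t, v, z) = -r_t v - X_t' (-r_t + (A_t' - Γ_t')) z` of the undiscounted equation. -/
def driver (A : ℝ≥0 → Matrix (Fin N) (Fin N) ℝ) (X : ℝ≥0 → Ω → Fin N)
    (C : ℝ≥0 → Matrix (Fin N) (Fin N) ℝ) (D : ℝ≥0 → Fin N → ℝ) (t : ℝ≥0) (ω : Ω)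
    (v : ℝ) (z : Fin N → ℝ) : ℝ :=
  -(rate A X C D t ω) * v - excess A X C D t ω z

/-- The driver of the discounted equation,
`H_s(t, z) = s X_t' (-r_t + (A_t' - Γ_t')) z - ∑_{i,j} (X_t' e_i) A_t^{ji} σ_t^{ij} z' (e_j - e_i)`,
with a sign `s = 1` or `s = -1`; the product rule for `π V` gives `s = -1`. -/
def discDriver (s : ℝ) (A : ℝ≥0 → Matrix (Fin N) (Fin N) ℝ) (X : ℝ≥0 → Ω → Fin N)
    (C : ℝ≥0 → Matrix (Fin N) (Fin N) ℝ) (D : ℝ≥0 → Fin N → ℝ) (t : ℝ≥0) (ω : Ω)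
    (z : Fin N → ℝ) : ℝ :=
  s * excess A X C D t ω z
    - ∑ i, ∑ j, vec X t ω i * A t j i * sig C t i j * (z ⬝ᵥ (Pi.single j 1 - Pi.single i 1))

/-- The martingale integrand of the discounted equation (as a column vector),
`I(t, z, v) = v X_{t-}' σ_t + ∑_{i,j} (e_i' X_{t-}) σ_t^{ij} z' (e_j - e_i) e_j' + z'`. -/
def discIntegrand (X : ℝ≥0 → Ω → Fin N) (C : ℝ≥0 → Matrix (Fin N) (Fin N) ℝ) (t : ℝ≥0) (ω : Ω)
    (z : Fin N → ℝ) (v : ℝ) : Fin N → ℝ :=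
  v • (vecL X t ω ᵥ* sig C t)
    + ∑ i, ∑ j, (vecL X t ω i * sig C t i j * (z ⬝ᵥ (Pi.single j 1 - Pi.single i 1)))
        • (Pi.single j 1 : Fin N → ℝ)
    + z

/-! ### Discounted processes -/

/-- `Ṽ_t = π_t V_t`. -/
def discV (X : ℝ≥0 → Ω → Fin N) (C : ℝ≥0 → Matrix (Fin N) (Fin N) ℝ) (D : ℝ≥0 → Fin N → ℝ)
    (V : ℝ≥0 → Ω → ℝ) (t : ℝ≥0) (ω : Ω) : ℝ :=
  sdf X C D t ω * V t ω

/-- `Z̃_t = π_{t-} Z_t`. -/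
def discZ (X : ℝ≥0 → Ω → Fin N) (C : ℝ≥0 → Matrix (Fin N) (Fin N) ℝ) (D : ℝ≥0 → Fin N → ℝ)
    (Z : ℝ≥0 → Ω → Fin N → ℝ) (t : ℝ≥0) (ω : Ω) : Fin N → ℝ :=
  sdfL X C D t ω • Z t ω

open Classical in
/-- The Lebesgue–Stieltjes measure `dk` of a monotone continuous function `k` on `[0, ∞)`. -/
def stieltjes (k : ℝ≥0 → ℝ) : Measure ℝ≥0 :=
  if hk : Monotone k then hk.stieltjesFunction.measure else 0

/-- `K̃_t = ∫_0^t π_u dK_u`. -/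
def discK (X : ℝ≥0 → Ω → Fin N) (C : ℝ≥0 → Matrix (Fin N) (Fin N) ℝ) (D : ℝ≥0 → Fin N → ℝ)
    (K : ℝ≥0 → Ω → ℝ) (t : ℝ≥0) (ω : Ω) : ℝ :=
  ∫ u in Ioc 0 t, sdf X C D u ω ∂(stieltjes fun u => K u ω)

/-! ### Reflected BSDEs -/

/-- What the undiscounted and the discounted equation have in common: the spaces in which
`(V, Z, K)` lives, the obstacle, and the minimality of `K`, on the horizon `[0, T]`. -/
structure IsReflected [MeasurableSpace Ω] (P : Measure Ω) (A : ℝ≥0 → Matrix (Fin N) (Fin N) ℝ)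
    (X : ℝ≥0 → Ω → Fin N) (T : ℝ≥0) (G V : ℝ≥0 → Ω → ℝ) (Z : ℝ≥0 → Ω → Fin N → ℝ)
    (K : ℝ≥0 → Ω → ℝ) : Prop where
  V_adapted : StronglyAdapted (chainFiltration P X) V
  V_rcll : ∀ ω, IsRCLL fun t => V t ω
  V_sq : ∫⁻ ω, ∫⁻ u in Ioc 0 T, ENNReal.ofReal (V u ω ^ 2) ∂leb ∂P < ∞
  Z_predictable : IsStronglyPredictable (chainFiltration P X) Z
  Z_sq : ∫⁻ ω, ∫⁻ u in Ioc 0 T, ENNReal.ofReal (seminormSq A X u ω (Z u ω)) ∂leb ∂P < ∞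
  K_adapted : StronglyAdapted (chainFiltration P X) K
  K_continuous : ∀ ω, Continuous fun t => K t ω
  K_monotone : ∀ ω, Monotone fun t => K t ω
  K_zero : ∀ ω, K 0 ω = 0
  K_sq : MemLp (K T) 2 P
  obstacle : ∀ᵐ ω ∂P, ∀ t ≤ T, G t ω ≤ V t ω
  minimal : ∀ᵐ ω ∂P,
    ∫⁻ u in Ioc 0 T, ENNReal.ofReal (V u ω - G u ω) ∂(stieltjes fun u => K u ω) = 0

/-- `(V, Z, K)` solves the reflected equation
`V_t = G_T + ∫_t^T f(u, V_u, Z_u) du + K_T - K_t - ∫_t^T Z_u' dM_u` with obstacle `G`. -/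
structure IsRBSDESolution [MeasurableSpace Ω] (P : Measure Ω)
    (A : ℝ≥0 → Matrix (Fin N) (Fin N) ℝ)
    (X : ℝ≥0 → Ω → Fin N) (C : ℝ≥0 → Matrix (Fin N) (Fin N) ℝ) (D : ℝ≥0 → Fin N → ℝ) (T : ℝ≥0)
    (G V : ℝ≥0 → Ω → ℝ) (Z : ℝ≥0 → Ω → Fin N → ℝ) (K : ℝ≥0 → Ω → ℝ) : Prop
    extends IsReflected P A X T G V Z K where
  equation : ∀ᵐ ω ∂P, ∀ t ≤ T,
    V t ω = G T ω + (∫ u in Ioc t T, driver A X C D u ω (V u ω) (Z u ω) ∂leb)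
      + (K T ω - K t ω) - (intM A X Z T ω - intM A X Z t ω)

/-- The discounted triple `(Ṽ, Z̃, K̃)` of `(V, Z, K)` solves the discounted equation
`Ṽ_t = π_T G_T + ∫_t^T H_s(u, Z̃_u) du + K̃_T - K̃_t - ∫_t^T I(u, Z̃_u, Ṽ_{u-}) dM_u`
with obstacle `π G` (as `π > 0`, the obstacle condition reads `V ≥ G`). -/
structure IsDiscountedSolution [MeasurableSpace Ω] (P : Measure Ω) (s : ℝ)
    (A : ℝ≥0 → Matrix (Fin N) (Fin N) ℝ)
    (X : ℝ≥0 → Ω → Fin N) (C : ℝ≥0 → Matrix (Fin N) (Fin N) ℝ) (D : ℝ≥0 → Fin N → ℝ) (T : ℝ≥0)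
    (G V : ℝ≥0 → Ω → ℝ) (Z : ℝ≥0 → Ω → Fin N → ℝ) (K : ℝ≥0 → Ω → ℝ) : Prop
    extends IsReflected P A X T G V Z K where
  equation : ∀ᵐ ω ∂P, ∀ t ≤ T,
    discV X C D V t ω = sdf X C D T ω * G T ω
      + (∫ u in Ioc t T, discDriver s A X C D u ω (discZ X C D Z u ω) ∂leb)
      + (discK X C D K T ω - discK X C D K t ω)
      - (intM A X (fun u ω => discIntegrand X C u ω (discZ X C D Z u ω)
            (Function.leftLim (fun v => discV X C D V v ω) u)) T ω
        - intM A X (fun u ω => discIntegrand X C u ω (discZ X C D Z u ω)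
            (Function.leftLim (fun v => discV X C D V v ω) u)) t ω)

/-! ### Optimal stopping -/

/-- The stopping times `τ` with `t ≤ τ ≤ T`. -/
def stoppingTimes {m0 : MeasurableSpace Ω} (F : Filtration ℝ≥0 m0) (t T : ℝ≥0) :
    Set (Ω → ℝ≥0) :=
  {τ | IsStoppingTime F (fun ω => (τ ω : WithTop ℝ≥0)) ∧ ∀ ω, t ≤ τ ω ∧ τ ω ≤ T}

/-- `∫_t^τ H_s(u, Z̃_u) du + π_τ G_τ 1_{τ < T} + π_T G_T 1_{τ = T}`. -/
def reward (s : ℝ) (A : ℝ≥0 → Matrix (Fin N) (Fin N) ℝ)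
    (X : ℝ≥0 → Ω → Fin N) (C : ℝ≥0 → Matrix (Fin N) (Fin N) ℝ) (D : ℝ≥0 → Fin N → ℝ) (T : ℝ≥0)
    (G : ℝ≥0 → Ω → ℝ) (Z : ℝ≥0 → Ω → Fin N → ℝ) (t : ℝ≥0) (τ : Ω → ℝ≥0) (ω : Ω) : ℝ :=
  (∫ u in Ioc t (τ ω), discDriver s A X C D u ω (discZ X C D Z u ω) ∂leb)
    + (if τ ω < T then sdf X C D (τ ω) ω * G (τ ω) ω else 0)
    + (if τ ω = T then sdf X C D T ω * G T ω else 0)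

/-- The first time in `[t, T]` at which `V` equals `G`, and `T` if there is none. -/
def firstHit (G V : ℝ≥0 → Ω → ℝ) (t T : ℝ≥0) (ω : Ω) : ℝ≥0 :=
  sInf {u | t ≤ u ∧ u ≤ T ∧ (V u ω = G u ω ∨ u = T)}

/-- The conditional expectation `E[ξ⁺ | m] - E[ξ⁻ | m]` with values in `[-∞, ∞]`, meaningful as
soon as `ξ⁺` is integrable, even if `ξ⁻` is not. -/
def condExpE {m0 : MeasurableSpace Ω} (m : MeasurableSpace Ω) (P : Measure[m0] Ω) (ξ : Ω → ℝ)
    (ω : Ω) : EReal :=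
  (condLExp m P (fun ω => ENNReal.ofReal (ξ ω)) ω : EReal)
    - (condLExp m P (fun ω => ENNReal.ofReal (-ξ ω)) ω : EReal)

/-- `Y` is the essential supremum of the family `S`: its least upper bound for the order
"`≤` almost surely". -/
def IsEssSup [MeasurableSpace Ω] (P : Measure Ω) (S : Set (Ω → EReal)) (Y : Ω → EReal) : Prop :=
  AEMeasurable Y P ∧ (∀ f ∈ S, f ≤ᵐ[P] Y) ∧
    ∀ Y' : Ω → EReal, AEMeasurable Y' P → (∀ f ∈ S, f ≤ᵐ[P] Y') → Y ≤ᵐ[P] Y'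

end Chain

end MarkovRBSDE

end

open MarkovRBSDE

/-!
# The discounted reflected BSDE of a Markov chain and its optimal stopping problem

*Discounting.* This part is a statement about single paths. The driver of the discounted equation
is `H_s = -(s + 1) ∑_j A^{ji} σ^{ij} (z_j - z_i)` in state `i` (`discDriver_eq`), so it vanishes for
`s = -1`. A path of the chain has finitely many jumps in bounded time, so an additive identity over
time intervals has to be checked only on intervals `[a, b]` such that the path is constant on
`[a, b)` (`IsRCLL.path_induction`). There `π` and `V` are continuous apart from one possible jump at
`b`: the deterministic product rule treats the continuous parts, `π` is multiplied by `1 + σ` at the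
jump, and the result is the integrand `I` (`discounted_increment_of_const`, `discounted_equation`).

*The martingale part.* Transition probabilities over short times are close to the rates
(`real_trans_sub_le`). Counting the transitions along finer and finer grids shows that the number of
jumps from `i` to `j` is compensated by the integrated rate (`setIntegral_jumpCount`). Hence the
random measure of these jumps and its compensator, together with `P`, define the same measure on the
predictable σ-algebra (`trim_jumpKer`), and every predictable integrand that is integrable with
respect to the compensators has an integral against `M` of mean zero (`integral_intM`). The number
of jumps has exponential moments (`lintegral_pow_jumpCount`), so `π` is bounded on `[0, T]` by a
square-integrable random variable; with the integrability of `V` and `Z` this makes the integrand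
and the driver of the discounted equation integrable (`integrable_jumpIntgd`,
`integrable_discDriver`). For a stopping time `τ ≥ t` and an event `B` known at time `t`, the set
`B × (t, τ]` is predictable, so the mean-zero property applied to the restricted integrand says that
the increment of the martingale part from `t` to `τ` has conditional expectation zero given `F_t`
(`condExp_stopped`).

*Optimal stopping.* By the discounted equation between `t` and `τ` and `V ≥ G`, the reward of `τ` is
at most `Ṽ_t` plus the martingale increment. There is equality at the first hitting time of the
obstacle, because `K` is flat before it and `V = G` there (`stieltjes_firstHit`, `ae_reward_le`).
Conditional expectations give the essential supremum and its attainment (`isEssSup_reward`).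

*The hitting time.* The augmented filtration is right-continuous, because the chain does not move
immediately (`chainFiltration_isRightContinuous`). Therefore the first time after a stopping time at
which the right-continuous process `V - G` is below `ε` is a stopping time. A stopping time that is
maximal among those almost surely below the hitting time is not changed by passing to the next such
time, for any `ε > 0`, so `V = G` at it, and it equals the hitting time almost surely
(`exists_stoppingTime_firstHit`). Over a complete space the hitting time is then a stopping time
itself (`mem_stoppingTimes_of_ae_eq`).
-/

namespace MarkovRBSDE

/-! ### Step paths -/

section Paths

variable {S : Type*} [TopologicalSpace S]

/-- The set of jump times of a path. -/
def jumps (x : ℝ≥0 → S) : Set ℝ≥0 := {u | Function.leftLim x u ≠ x u}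

/-- The times at which a path jumps from a state `i` to a state `j` with `r i j`. -/
def jumpsRel (x : ℝ≥0 → S) (r : S → S → Prop) : Set ℝ≥0 := {u | r (Function.leftLim x u) (x u)}

lemma jumpsRel_subset (x : ℝ≥0 → S) {r : S → S → Prop} (hr : ∀ i, ¬ r i i) :
    jumpsRel x r ⊆ jumps x := fun u h h' => hr (x u) (by
  have h2 : r (Function.leftLim x u) (x u) := h
  rwa [h'] at h2)

lemma jumpsRel_ne (x : ℝ≥0 → S) : jumpsRel x (fun i j => i ≠ j) = jumps x := rfl

variable [DiscreteTopology S]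

lemma nnreal_nhdsLT_neBot {t : ℝ≥0} (ht : 0 < t) : (𝓝[<] t).NeBot :=
  nhdsLT_neBot_of_exists_lt ⟨0, ht⟩

/-- A right-continuous path in a discrete space is constant on some `[t, t + ε)`. -/
lemma IsRCLL.exists_right {x : ℝ≥0 → S} (hx : IsRCLL x) (t : ℝ≥0) :
    ∃ b, t < b ∧ ∀ u, t ≤ u → u < b → x u = x t := by
  have h : ∀ᶠ u in 𝓝[≥] t, x u = x t := by
    have := hx.1 t
    rw [ContinuousWithinAt, nhds_discrete, tendsto_pure] at this
    exact this
  obtain ⟨b, hb, h⟩ := (mem_nhdsGE_iff_exists_Ico_subset' (a := t) (u' := t + 1)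
    (by simp)).1 h
  exact ⟨b, hb, fun u h1 h2 => h ⟨h1, h2⟩⟩

lemma IsRCLL.tendsto_leftLim {E : Type*} [TopologicalSpace E] {x : ℝ≥0 → E}
    (hx : IsRCLL x) {t : ℝ≥0} : Tendsto x (𝓝[<] t) (𝓝 (Function.leftLim x t)) :=
  tendsto_leftLim_of_tendsto (hx.2 t)

lemma IsRCLL.exists_left {x : ℝ≥0 → S} (hx : IsRCLL x) {t : ℝ≥0} (ht : 0 < t) :
    ∃ a, a < t ∧ ∀ u, a ≤ u → u < t → x u = Function.leftLim x t := by
  have h : ∀ᶠ u in 𝓝[<] t, x u = Function.leftLim x t := by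
    have := hx.tendsto_leftLim (t := t)
    rw [nhds_discrete, tendsto_pure] at this
    exact this
  obtain ⟨a, ha, h⟩ := (mem_nhdsLT_iff_exists_Ioo_subset' (a := t) (l' := 0) ht).1 h
  obtain ⟨a', h1, h2⟩ := exists_between (mem_Iio.1 ha)
  exact ⟨a', h2, fun u hu hu' => h ⟨h1.trans_le hu, hu'⟩⟩

lemma leftLim_eq_of_const_Ico {E : Type*} [TopologicalSpace E] [T2Space E] {x : ℝ≥0 → E}
    {a t : ℝ≥0} {c : E} (hat : a < t) (h : ∀ u, a ≤ u → u < t → x u = c) :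
    Function.leftLim x t = c := by
  have : (𝓝[<] t).NeBot := nnreal_nhdsLT_neBot (pos_of_gt hat)
  refine leftLim_eq_of_tendsto (tendsto_const_nhds.congr' ?_)
  filter_upwards [Ico_mem_nhdsLT hat] with u hu using (h u hu.1 hu.2).symm

/-- The analogue of real induction for step paths: a transitive relation between times that holds
for `a` and `b` as soon as the path is constant on `[a, b)` holds for any two times. -/
theorem IsRCLL.path_induction {x : ℝ≥0 → S} (hx : IsRCLL x) {R : ℝ≥0 → ℝ≥0 → Prop}
    (trans : ∀ a b c, a ≤ b → b ≤ c → R a b → R b c → R a c)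
    (step : ∀ a b, a ≤ b → (∀ u, a ≤ u → u < b → x u = x a) → R a b)
    {a b : ℝ≥0} (hab : a ≤ b) : R a b := by
  have key : Icc a b ⊆ {t | R a t} := by
    have hclosed : ∀ t, a < t → (∀ u, a ≤ u → u < t → R a u) → R a t := by
      intro t hat h
      obtain ⟨l, hl, hc⟩ := hx.exists_left (pos_of_gt hat)
      have h1 : max a l < t := max_lt hat hl
      refine trans a (max a l) t (le_max_left _ _) h1.le (h _ (le_max_left _ _) h1)
        (step _ _ h1.le fun u hu hut => ?_)
      rw [hc u ((le_max_right _ _).trans hu) hut, hc _ (le_max_right _ _) h1]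
    by_contra hne
    obtain ⟨t, ht, htn⟩ := not_subset.1 hne
    set B := {t | a ≤ t ∧ ¬ R a t} with hB
    have hBne : B.Nonempty := ⟨t, ht.1, htn⟩
    set m := sInf B with hm
    have ham : a ≤ m := le_csInf hBne fun u hu => hu.1
    have hlt : ∀ u, a ≤ u → u < m → R a u := by
      intro u hu hum
      by_contra hn
      exact absurd (csInf_le (OrderBot.bddBelow B) (show u ∈ B from ⟨hu, hn⟩)) (not_le.2 hum)
    have hRm : R a m := by
      rcases ham.eq_or_lt with h | h
      · rw [← h]
        exact step a a le_rfl fun u h1 h2 => absurd h1 (not_le.2 h2)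
      · exact hclosed m h hlt
    obtain ⟨c, hc, hcc⟩ := hx.exists_right m
    have : c ≤ m := by
      refine le_csInf hBne fun u hu => ?_
      by_contra huc
      have hmu : m ≤ u := csInf_le (OrderBot.bddBelow B) hu
      refine hu.2 (trans a m u ham hmu hRm (step m u hmu fun v h1 h2 => ?_))
      exact hcc v h1 (h2.trans (not_le.1 huc))
    exact absurd this (not_le.2 hc)
  exact key ⟨hab, le_rfl⟩

lemma IsRCLL.finite_jumps_Ioc {x : ℝ≥0 → S} (hx : IsRCLL x) {a b : ℝ≥0} (hab : a ≤ b) :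
    (jumps x ∩ Ioc a b).Finite := by
  refine hx.path_induction (R := fun a b => (jumps x ∩ Ioc a b).Finite) ?_ ?_ hab
  · intro a b c hab hbc h1 h2
    refine (h1.union h2).subset ?_
    rw [← Ioc_union_Ioc_eq_Ioc hab hbc, inter_union_distrib_left]
  · intro a b _ hc
    refine (finite_singleton b).subset ?_
    rintro u ⟨hu, hau, hub⟩
    by_contra hne
    have hub' : u < b := lt_of_le_of_ne hub hne
    refine hu ?_
    rw [leftLim_eq_of_const_Ico hau (fun v h1 h2 => hc v h1 (h2.trans hub')), hc u hau.le hub']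

lemma IsRCLL.eq_of_no_jumps {x : ℝ≥0 → S} (hx : IsRCLL x) {a b : ℝ≥0} (hab : a ≤ b)
    (h : ∀ u, a < u → u ≤ b → u ∉ jumps x) : x b = x a := by
  refine hx.path_induction
    (R := fun a b => (∀ u, a < u → u ≤ b → u ∉ jumps x) → x b = x a) ?_ ?_ hab h
  · intro a b c hab hbc h1 h2 h
    rw [h2 fun u hu hu' => h u (hab.trans_lt hu) hu', h1 fun u hu hu' => h u hu (hu'.trans hbc)]
  · intro a b hab hc h
    rcases hab.eq_or_lt with rfl | hlt
    · rfl
    have := h b hlt le_rfl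
    rw [jumps, mem_ofPred_eq, not_not, leftLim_eq_of_const_Ico hlt hc] at this
    exact this.symm

/-- On short intervals a step path jumps at most once. -/
lemma IsRCLL.exists_gap {x : ℝ≥0 → S} (hx : IsRCLL x) {a b : ℝ≥0} (hab : a ≤ b) :
    ∃ δ : ℝ≥0, 0 < δ ∧ ∀ u v, u ∈ jumps x ∩ Ioc a b → v ∈ jumps x ∩ Ioc a b → u < v → u + δ ≤ v := by
  have hf := hx.finite_jumps_Ioc hab
  have hf2 : ((fun p : ℝ≥0 × ℝ≥0 => p.2 - p.1) ''
      {p | p ∈ (jumps x ∩ Ioc a b) ×ˢ (jumps x ∩ Ioc a b) ∧ p.1 < p.2}).Finite :=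
    ((hf.prod hf).subset fun p hp => hp.1).image _
  obtain ⟨δ, hδ, h⟩ : ∃ δ : ℝ≥0, 0 < δ ∧ ∀ d ∈ ((fun p : ℝ≥0 × ℝ≥0 => p.2 - p.1) ''
      {p | p ∈ (jumps x ∩ Ioc a b) ×ˢ (jumps x ∩ Ioc a b) ∧ p.1 < p.2}), δ ≤ d := by
    rcases ((fun p : ℝ≥0 × ℝ≥0 => p.2 - p.1) ''
      {p | p ∈ (jumps x ∩ Ioc a b) ×ˢ (jumps x ∩ Ioc a b) ∧ p.1 < p.2}).eq_empty_or_nonempty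
      with h | h
    · exact ⟨1, one_pos, fun d hd => by rw [h] at hd; exact absurd hd (notMem_empty d)⟩
    · obtain ⟨d, hd, hmin⟩ := hf2.exists_minimalFor id _ h
      refine ⟨d, ?_, fun d' hd' => ?_⟩
      · obtain ⟨p, hp, rfl⟩ := hd
        exact tsub_pos_of_lt hp.2
      · rcases le_total d d' with h | h
        · exact h
        · exact hmin hd' h
  refine ⟨δ, hδ, fun u v hu hv huv => ?_⟩
  have := h _ ⟨(u, v), ⟨⟨hu, hv⟩, huv⟩, rfl⟩
  rw [add_comm]
  exact (le_tsub_iff_right huv.le).1 this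

/-- On an interval with at most one jump, the endpoints tell which jump occurs. -/
lemma IsRCLL.jumpsRel_encard_of_short {x : ℝ≥0 → S} (hx : IsRCLL x) {a b : ℝ≥0} (hab : a ≤ b)
    (h : (jumps x ∩ Ioc a b).Subsingleton) {r : S → S → Prop} [DecidableRel r]
    (hr : ∀ i, ¬ r i i) :
    (jumpsRel x r ∩ Ioc a b).encard = if r (x a) (x b) then 1 else 0 := by
  rcases h.eq_empty_or_singleton with h | ⟨v, h⟩
  · have h1 : x b = x a := hx.eq_of_no_jumps hab fun u h1 h2 h3 => by
      have : u ∈ jumps x ∩ Ioc a b := ⟨h3, h1, h2⟩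
      simp [h] at this
    have h2 : jumpsRel x r ∩ Ioc a b = ∅ :=
      subset_empty_iff.1 ((inter_subset_inter_left _ (jumpsRel_subset x hr)).trans h.subset)
    rw [h2, h1, if_neg (hr _)]
    simp
  · have hv : v ∈ jumps x ∩ Ioc a b := by simp [h]
    have hnot : ∀ u, u ≠ v → a < u → u ≤ b → u ∉ jumps x := fun u hne h1 h2 h3 => by
      have : u ∈ jumps x ∩ Ioc a b := ⟨h3, h1, h2⟩
      rw [h] at this
      exact hne this
    have h1 : x b = x v := hx.eq_of_no_jumps hv.2.2 fun u h1 h2 =>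
      hnot u h1.ne' (hv.2.1.trans h1) h2
    have h2 : Function.leftLim x v = x a := by
      refine leftLim_eq_of_const_Ico hv.2.1 fun u hu huv => ?_
      exact hx.eq_of_no_jumps hu fun w h1 h2 => hnot w (h2.trans_lt huv).ne h1
        ((h2.trans huv.le).trans hv.2.2)
    split_ifs with hc
    · have : jumpsRel x r ∩ Ioc a b = {v} := by
        refine Subset.antisymm ((inter_subset_inter_left _ (jumpsRel_subset x hr)).trans
          h.subset) ?_
        rintro _ rfl
        refine ⟨?_, hv.2⟩
        rw [jumpsRel, mem_ofPred_eq, h2, ← h1]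
        exact hc
      rw [this, encard_singleton]
    · have : jumpsRel x r ∩ Ioc a b = ∅ := by
        rw [eq_empty_iff_forall_notMem]
        rintro u ⟨hu, hu'⟩
        have huv : u = v := by
          by_contra hne
          exact hnot u hne hu'.1 hu'.2 (jumpsRel_subset x hr hu)
        subst huv
        refine hc ?_
        rw [← h2, h1]
        exact hu
      simp [this]

/-- The points of the uniform grid with `n` steps on `[s, t]`. -/
noncomputable def grid (s t : ℝ≥0) (n k : ℕ) : ℝ≥0 := s + k * ((t - s) / n)

lemma grid_zero (s t : ℝ≥0) (n : ℕ) : grid s t n 0 = s := by simp [grid]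

lemma grid_last {s t : ℝ≥0} (hst : s ≤ t) {n : ℕ} (hn : n ≠ 0) : grid s t n n = t := by
  have : (n : ℝ≥0) ≠ 0 := by exact_mod_cast hn
  rw [grid, mul_div_cancel₀ _ this, add_tsub_cancel_of_le hst]

lemma grid_succ (s t : ℝ≥0) (n k : ℕ) : grid s t n (k + 1) = grid s t n k + (t - s) / n := by
  simp [grid]; ring

lemma grid_mono (s t : ℝ≥0) (n : ℕ) : Monotone (grid s t n) :=
  monotone_nat_of_le_succ fun k => by rw [grid_succ]; exact le_self_add

lemma le_grid (s t : ℝ≥0) (n k : ℕ) : s ≤ grid s t n k := le_self_add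

lemma grid_le {s t : ℝ≥0} (hst : s ≤ t) {n k : ℕ} (hn : n ≠ 0) (hk : k ≤ n) : grid s t n k ≤ t :=
  (grid_mono s t n hk).trans (grid_last hst hn).le

/-- The number of jumps in `(s, t]` is the number of transitions along any sufficiently fine grid. -/
theorem IsRCLL.eventually_ncard {x : ℝ≥0 → S} (hx : IsRCLL x) {s t : ℝ≥0} (hst : s ≤ t) {r : S → S → Prop}
    [DecidableRel r] (hr : ∀ i, ¬ r i i) :
    ∀ᶠ n : ℕ in atTop, (jumpsRel x r ∩ Ioc s t).ncard =
      ∑ k ∈ Finset.range n, if r (x (grid s t n k)) (x (grid s t n (k + 1))) then 1 else 0 := by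
  obtain ⟨δ, hδ, hgap⟩ := hx.exists_gap hst
  obtain ⟨m, hm⟩ := exists_nat_gt ((t - s) / δ)
  filter_upwards [eventually_ge_atTop m, eventually_ne_atTop 0] with n hn hn0
  have hn0' : (n : ℝ≥0) ≠ 0 := by exact_mod_cast hn0
  have hmesh : (t - s) / n < δ := by
    rw [div_lt_iff₀ (pos_iff_ne_zero.2 hn0'), mul_comm, ← div_lt_iff₀ hδ]
    exact hm.trans_le (by exact_mod_cast hn)
  have hsub : ∀ k < n, (jumps x ∩ Ioc (grid s t n k) (grid s t n (k + 1))).Subsingleton := by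
    intro k hk u hu v hv
    have hI : Ioc (grid s t n k) (grid s t n (k + 1)) ⊆ Ioc s t :=
      Ioc_subset_Ioc (le_grid _ _ _ _) (grid_le hst hn0 hk)
    have aux : ∀ u v, u ∈ jumps x ∩ Ioc (grid s t n k) (grid s t n (k + 1)) →
        v ∈ jumps x ∩ Ioc (grid s t n k) (grid s t n (k + 1)) → ¬ u < v := by
      intro u v hu hv huv
      have h1 := hgap u v ⟨hu.1, hI hu.2⟩ ⟨hv.1, hI hv.2⟩ huv
      have h2 := hv.2.2
      rw [grid_succ] at h2
      have h3 : u + δ < u + δ := (h1.trans h2).trans_lt (add_lt_add hu.2.1 hmesh)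
      exact lt_irrefl _ h3
    exact le_antisymm (not_lt.1 (aux v u hv hu)) (not_lt.1 (aux u v hu hv))
  have hsum : ∀ m ≤ n, (jumpsRel x r ∩ Ioc s (grid s t n m)).encard =
      ∑ k ∈ Finset.range m,
        if r (x (grid s t n k)) (x (grid s t n (k + 1))) then 1 else 0 := by
    intro m
    induction m with
    | zero => intro _; simp [grid_zero]
    | succ m ih =>
      intro hm
      rw [Finset.sum_range_succ, ← ih (by omega), ← hx.jumpsRel_encard_of_short
        (grid_mono s t n (Nat.le_succ m)) (hsub m hm) hr, ← encard_union_eq,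
        ← inter_union_distrib_left, Ioc_union_Ioc_eq_Ioc (le_grid _ _ _ _)
        (grid_mono s t n (Nat.le_succ m))]
      exact (Ioc_disjoint_Ioc_of_le le_rfl).mono inter_subset_right inter_subset_right
  have h := hsum n le_rfl
  rw [grid_last hst hn0] at h
  rw [ncard, h, ← ENat.toNat_natCast (∑ k ∈ Finset.range n, _)]
  simp

end Paths

/-! ### Integration on the time axis -/

section Leb

lemma measurableEmbedding_coe : MeasurableEmbedding ((↑) : ℝ≥0 → ℝ) :=
  MeasurableEmbedding.subtype_coe measurableSet_Ici

lemma map_coe_leb : leb.map ((↑) : ℝ≥0 → ℝ) = volume.restrict (Ici 0) := by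
  rw [leb, measurableEmbedding_coe.map_comap]
  congr 1
  ext x
  simp only [mem_range, mem_Ici]
  exact ⟨fun ⟨y, hy⟩ => hy ▸ y.2, fun h => ⟨⟨x, h⟩, rfl⟩⟩

lemma coe_image_Ioc (a b : ℝ≥0) : ((↑) : ℝ≥0 → ℝ) '' Ioc a b = Ioc (a : ℝ) b := by
  ext x
  constructor
  · rintro ⟨y, hy, rfl⟩
    exact ⟨by exact_mod_cast hy.1, by exact_mod_cast hy.2⟩
  · rintro ⟨h1, h2⟩
    exact ⟨⟨x, a.2.trans h1.le⟩, ⟨h1, h2⟩, rfl⟩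

lemma leb_Ioc (a b : ℝ≥0) : leb (Ioc a b) = ENNReal.ofReal (b - a) := by
  rw [leb, measurableEmbedding_coe.comap_apply, coe_image_Ioc, Real.volume_Ioc]

instance : NullSingletonClass leb where
  measure_singleton x := by
    rw [leb, measurableEmbedding_coe.comap_apply, image_singleton, measure_singleton]

instance (a b : ℝ≥0) : IsFiniteMeasure (leb.restrict (Ioc a b)) :=
  ⟨by rw [Measure.restrict_apply_univ, leb_Ioc]; exact ENNReal.ofReal_lt_top⟩

instance : SigmaFinite leb := by
  refine ⟨⟨⟨fun n => Icc 0 (n : ℝ≥0), fun _ => trivial, fun n => ?_, ?_⟩⟩⟩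
  · rw [← measure_congr Ioc_ae_eq_Icc, leb_Ioc]
    exact ENNReal.ofReal_lt_top
  · rw [eq_univ_iff_forall]
    intro x
    obtain ⟨n, hn⟩ := exists_nat_ge x
    exact mem_iUnion.2 ⟨n, zero_le, hn⟩

lemma setIntegral_leb {a b : ℝ≥0} (h : a ≤ b) (f : ℝ → ℝ) :
    ∫ u in Ioc a b, f u ∂leb = ∫ x in (a : ℝ)..b, f x := by
  have h1 := measurableEmbedding_coe.setIntegral_map (μ := leb) f (Ioc (a : ℝ) b)
  have h2 : Ioc (a : ℝ) b ⊆ Ici 0 := fun x hx => a.2.trans hx.1.le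
  rw [map_coe_leb, Measure.restrict_restrict measurableSet_Ioc, inter_eq_left.2 h2] at h1
  rw [intervalIntegral.integral_of_le (by exact_mod_cast h), h1, ← coe_image_Ioc,
    preimage_image_eq _ NNReal.coe_injective]

lemma integrableOn_leb_of_bounded {a b : ℝ≥0} {f : ℝ≥0 → ℝ} (hf : Measurable f) {c : ℝ}
    (hc : ∀ u ∈ Ioc a b, |f u| ≤ c) : IntegrableOn f (Ioc a b) leb :=
  Measure.integrableOn_of_bounded (by rw [leb_Ioc]; exact ENNReal.ofReal_ne_top)
    hf.aestronglyMeasurable ((ae_restrict_iff' measurableSet_Ioc).2 (ae_of_all _ hc))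

/-- `x_t = exp (-∫_a^t d)` solves `dx = -d x dt`. -/
lemma exp_neg_integral {a b : ℝ≥0} (hab : a ≤ b) {d : ℝ≥0 → ℝ} (hd : Measurable d) {c : ℝ}
    (hc : ∀ u ∈ Ioc a b, |d u| ≤ c) :
    Real.exp (-∫ u in Ioc a b, d u ∂leb) =
      1 - ∫ t in Ioc a b, d t * Real.exp (-∫ u in Ioc a t, d u ∂leb) ∂leb := by
  set D : ℝ → ℝ := fun x => (Ioc (a : ℝ) b).indicator (fun x => d x.toNNReal) x with hD
  have hDm : Measurable D := (hd.comp measurable_real_toNNReal).indicator measurableSet_Ioc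
  have hc0 : ∀ x, |D x| ≤ |c| := by
    intro x
    by_cases hx : x ∈ Ioc (a : ℝ) b
    · rw [hD]
      simp only [indicator_of_mem hx]
      refine (hc _ ⟨?_, ?_⟩).trans (le_abs_self c)
      · rw [← NNReal.coe_lt_coe, Real.coe_toNNReal _ (a.2.trans hx.1.le)]; exact hx.1
      · rw [← NNReal.coe_le_coe, Real.coe_toNNReal _ (a.2.trans hx.1.le)]; exact hx.2
    · simp [hD, indicator_of_notMem hx]
  have hDd : ∀ u ∈ Ioc a b, D u = d u := by
    intro u hu
    have : (u : ℝ) ∈ Ioc (a : ℝ) b := ⟨by exact_mod_cast hu.1, by exact_mod_cast hu.2⟩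
    simp only [hD, indicator_of_mem this, Real.toNNReal_coe]
  have hDi : ∀ x y, IntervalIntegrable D volume x y := fun x y => by
    rw [intervalIntegrable_iff]
    exact Measure.integrableOn_of_bounded measure_Ioc_lt_top.ne
      hDm.aestronglyMeasurable (ae_of_all _ hc0)
  set y : ℝ → ℝ := fun x => ∫ u in (a : ℝ)..x, D u with hy
  have hyt : ∀ t ∈ Icc a b, ∫ u in Ioc a t, d u ∂leb = y t := by
    intro t ht
    simp only [hy]
    rw [← setIntegral_leb ht.1]
    exact setIntegral_congr_fun measurableSet_Ioc fun u hu => (hDd u ⟨hu.1, hu.2.trans ht.2⟩).symm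
  have hLip : LipschitzWith ⟨|c|, abs_nonneg c⟩ y := by
    refine LipschitzWith.of_dist_le_mul fun s t => ?_
    rw [Real.dist_eq, hy, intervalIntegral.integral_interval_sub_left (hDi _ _) (hDi _ _),
      Real.dist_eq]
    exact intervalIntegral.norm_integral_le_of_norm_le_const (f := D) (C := |c|)
      fun x _ => (Real.norm_eq_abs _).trans_le (hc0 x)
  have hab' : (a : ℝ) ≤ b := by exact_mod_cast hab
  have hAC : AbsolutelyContinuousOnInterval (fun x => Real.exp (-y x)) a b := by
    have h1 : ContDiff ℝ 1 fun z : ℝ => Real.exp (-z) := by fun_prop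
    obtain ⟨K, hK⟩ := h1.locallyLipschitz.locallyLipschitzOn.exists_lipschitzOnWith_of_compact
      (s := y '' uIcc (a : ℝ) b) (isCompact_uIcc.image hLip.continuous)
    have := hK.comp hLip.lipschitzOnWith (mapsTo_image y _)
    exact this.absolutelyContinuousOnInterval
  have hft := hAC.integral_deriv_eq_sub
  have hya : y a = 0 := by simp [hy]
  rw [hya] at hft
  have hder : ∫ x in (a : ℝ)..b, deriv (fun x => Real.exp (-y x)) x =
      ∫ x in (a : ℝ)..b, -(D x * Real.exp (-y x)) := by
    refine intervalIntegral.integral_congr_ae ?_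
    filter_upwards [(hDi a b).ae_hasDerivAt_integral] with x hx hxI
    have h2 : HasDerivAt (fun x => Real.exp (-y x)) (Real.exp (-y x) * -D x) x :=
      (hx (uIoc_subset_uIcc hxI) a left_mem_uIcc).neg.exp
    rw [h2.deriv]
    ring
  rw [hder, intervalIntegral.integral_neg, ← setIntegral_leb hab] at hft
  have hint : ∫ t in Ioc a b, d t * Real.exp (-∫ u in Ioc a t, d u ∂leb) ∂leb =
      ∫ u in Ioc a b, D u * Real.exp (-y u) ∂leb :=
    setIntegral_congr_fun measurableSet_Ioc fun u hu => by
      rw [hDd u hu, hyt u ⟨hu.1.le, hu.2⟩]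
  rw [hint, hyt b ⟨hab, le_rfl⟩]
  simp only [neg_zero, Real.exp_zero] at hft
  linarith

/-- The product rule for two functions of finite variation, one of which is continuous. -/
lemma product_rule {μ ν : Measure ℝ≥0} [NullSingletonClass ν] {a b : ℝ≥0} (hab : a ≤ b)
    [IsFiniteMeasure (μ.restrict (Ioc a b))] [IsFiniteMeasure (ν.restrict (Ioc a b))]
    {f h x y : ℝ≥0 → ℝ} (hf : IntegrableOn f (Ioc a b) μ) (hh : IntegrableOn h (Ioc a b) ν)
    (hx : ∀ t ∈ Icc a b, x t = x a + ∫ u in Ioc a t, f u ∂μ)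
    (hy : ∀ t ∈ Icc a b, y t = y a + ∫ u in Ioc a t, h u ∂ν) :
    x b * y b - x a * y a = ∫ u in Ioc a b, x u * h u ∂ν + ∫ u in Ioc a b, f u * y u ∂μ := by
  set m := μ.restrict (Ioc a b)
  set n := ν.restrict (Ioc a b)
  have hprod : Integrable (fun p : ℝ≥0 × ℝ≥0 => f p.1 * h p.2) (m.prod n) := hf.mul_prod hh
  have hms : MeasurableSet {p : ℝ≥0 × ℝ≥0 | p.1 ≤ p.2} := measurableSet_le measurable_fst measurable_snd
  have h1 : ∫ w in Ioc a b, x w * h w ∂ν =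
      x a * ∫ w in Ioc a b, h w ∂ν
        + ∫ p, {p : ℝ≥0 × ℝ≥0 | p.1 ≤ p.2}.indicator (fun p => f p.1 * h p.2) p ∂(m.prod n) := by
    rw [integral_prod_symm _ (hprod.indicator hms), ← integral_const_mul, ← integral_add]
    · refine setIntegral_congr_fun measurableSet_Ioc fun w hw => ?_
      rw [hx w ⟨hw.1.le, hw.2⟩, add_mul]
      congr 1
      have : ∀ u, {p : ℝ≥0 × ℝ≥0 | p.1 ≤ p.2}.indicator (fun p => f p.1 * h p.2) (u, w) =
          (Iic w).indicator f u * h w := by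
        intro u
        by_cases hu : u ≤ w
        · rw [indicator_of_mem (by exact hu), indicator_of_mem (by exact hu)]
        · rw [indicator_of_notMem (by exact hu), indicator_of_notMem (by exact hu), zero_mul]
      simp_rw [this]
      rw [integral_mul_const, integral_indicator measurableSet_Iic,
        Measure.restrict_restrict measurableSet_Iic, inter_comm, Ioc_inter_Iic, min_eq_right hw.2]
    · exact hh.const_mul _
    · exact (hprod.indicator hms).integral_prod_right
  have h2 : ∫ u in Ioc a b, f u * y u ∂μ =
      y a * ∫ u in Ioc a b, f u ∂μ
        + ∫ p, {p : ℝ≥0 × ℝ≥0 | p.1 ≤ p.2}ᶜ.indicator (fun p => f p.1 * h p.2) p ∂(m.prod n) := by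
    have hsl : ∀ u ∈ Ioc a b,
        ∫ w, {p : ℝ≥0 × ℝ≥0 | p.1 ≤ p.2}ᶜ.indicator (fun p => f p.1 * h p.2) (u, w) ∂n =
          f u * ∫ w in Ioc a u, h w ∂ν := by
      intro u hu
      have : ∀ w, {p : ℝ≥0 × ℝ≥0 | p.1 ≤ p.2}ᶜ.indicator (fun p => f p.1 * h p.2) (u, w) =
          f u * (Iio u).indicator h w := by
        intro w
        by_cases hw : w < u
        · rw [indicator_of_mem (by simpa using hw), indicator_of_mem (by exact hw)]
        · rw [indicator_of_notMem (by simpa using hw), indicator_of_notMem (by exact hw), mul_zero]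
      simp_rw [this]
      rw [integral_const_mul, integral_indicator measurableSet_Iio,
        Measure.restrict_restrict measurableSet_Iio, ← setIntegral_congr_set Ioo_ae_eq_Ioc]
      congr 3
      ext w
      simp only [mem_inter_iff, mem_Iio, mem_Ioc, mem_Ioo]
      exact ⟨fun h => ⟨h.2.1, h.1⟩, fun h => ⟨h.2, h.1, (h.2.trans_le hu.2).le⟩⟩
    have hI := hprod.indicator hms.compl
    rw [integral_prod _ hI, setIntegral_congr_fun measurableSet_Ioc hsl, ← integral_const_mul,
      ← integral_add (Integrable.const_mul hf _)]
    · refine setIntegral_congr_fun measurableSet_Ioc fun u hu => ?_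
      rw [hy u ⟨hu.1.le, hu.2⟩]
      ring
    · exact hI.integral_prod_left.congr ((ae_restrict_iff' measurableSet_Ioc).2 (ae_of_all _ hsl))
  have h3 : (∫ u in Ioc a b, f u ∂μ) * ∫ w in Ioc a b, h w ∂ν =
      ∫ p, {p : ℝ≥0 × ℝ≥0 | p.1 ≤ p.2}.indicator (fun p => f p.1 * h p.2) p ∂(m.prod n)
      + ∫ p, {p : ℝ≥0 × ℝ≥0 | p.1 ≤ p.2}ᶜ.indicator (fun p => f p.1 * h p.2) p ∂(m.prod n) := by
    rw [integral_indicator hms, integral_indicator hms.compl, integral_add_compl hms hprod,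
      integral_prod_mul]
  have hxb := hx b ⟨hab, le_rfl⟩
  have hyb := hy b ⟨hab, le_rfl⟩
  rw [h1, h2, hxb, hyb]
  linear_combination h3

end Leb

/-! ### Stieltjes measures of continuous monotone functions -/

section Stieltjes

variable {k : ℝ≥0 → ℝ}

lemma stieltjes_apply_eq (hk : Monotone k) (hc : Continuous k) (t : ℝ≥0) :
    hk.stieltjesFunction t = k t := by
  rw [hk.stieltjesFunction_eq]
  exact rightLim_eq_of_tendsto (hc.continuousWithinAt (s := Ioi t) (x := t))

lemma stieltjes_Ioc (hk : Monotone k) (hc : Continuous k) (a b : ℝ≥0) :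
    stieltjes k (Ioc a b) = ENNReal.ofReal (k b - k a) := by
  rw [stieltjes, dif_pos hk, StieltjesFunction.measure_Ioc, stieltjes_apply_eq hk hc,
    stieltjes_apply_eq hk hc]

lemma stieltjes_nullSingleton (hk : Monotone k) (hc : Continuous k) :
    NullSingletonClass (stieltjes k) := by
  refine ⟨fun a => ?_⟩
  have : (hk.stieltjesFunction : ℝ≥0 → ℝ) = k := funext (stieltjes_apply_eq hk hc)
  have h2 : Function.leftLim k a = k a :=
    ContinuousWithinAt.leftLim_eq hc.continuousAt.continuousWithinAt
  rw [stieltjes, dif_pos hk, StieltjesFunction.measure_singleton, this, h2, sub_self,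
    ENNReal.ofReal_zero]

lemma stieltjes_finite (hk : Monotone k) (hc : Continuous k) (a b : ℝ≥0) :
    IsFiniteMeasure ((stieltjes k).restrict (Ioc a b)) :=
  ⟨by rw [Measure.restrict_apply_univ, stieltjes_Ioc hk hc]; exact ENNReal.ofReal_lt_top⟩

lemma stieltjes_integral_one (hk : Monotone k) (hc : Continuous k) {a b : ℝ≥0} (hab : a ≤ b) :
    ∫ _ in Ioc a b, (1 : ℝ) ∂(stieltjes k) = k b - k a := by
  rw [integral_const, measureReal_restrict_apply_univ, measureReal_def, stieltjes_Ioc hk hc,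
    ENNReal.toReal_ofReal (sub_nonneg.2 (hk hab))]
  simp

end Stieltjes

/-! ### Path regularity and measurability -/

section Reg

/-- The first point of the grid `ℕ / (n + 1)` that lies strictly to the right of `u`. -/
noncomputable def rightGrid (n : ℕ) (u : ℝ≥0) : ℝ≥0 := (⌊(n + 1 : ℝ≥0) * u⌋₊ + 1) / (n + 1)

lemma lt_rightGrid (n : ℕ) (u : ℝ≥0) : u < rightGrid n u := by
  rw [rightGrid, lt_div_iff₀ (by positivity), mul_comm]
  exact Nat.lt_floor_add_one _

lemma rightGrid_le (n : ℕ) (u : ℝ≥0) : rightGrid n u ≤ u + 1 / (n + 1) := by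
  have : (0 : ℝ≥0) < n + 1 := by positivity
  rw [rightGrid, add_div]
  gcongr
  rw [div_le_iff₀ this, mul_comm]
  exact Nat.floor_le zero_le

lemma tendsto_one_div_nnreal : Tendsto (fun n : ℕ => (1 : ℝ≥0) / (n + 1)) atTop (𝓝 0) := by
  rw [← NNReal.tendsto_coe]
  simpa using tendsto_one_div_add_atTop_nhds_zero_nat (𝕜 := ℝ)

lemma tendsto_rightGrid (u : ℝ≥0) : Tendsto (fun n => rightGrid n u) atTop (𝓝[≥] u) := by
  refine tendsto_nhdsWithin_iff.2 ⟨?_, Eventually.of_forall fun n => (lt_rightGrid n u).le⟩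
  refine tendsto_of_tendsto_of_tendsto_of_le_of_le tendsto_const_nhds ?_
    (fun n => (lt_rightGrid n u).le) (fun n => rightGrid_le n u)
  simpa using tendsto_one_div_nnreal.const_add u

lemma measurable_of_rightContinuous {x : ℝ≥0 → ℝ} (hx : ∀ t, ContinuousWithinAt x (Ici t) t) :
    Measurable x := by
  refine measurable_of_tendsto_metrizable (f := fun n u => x (rightGrid n u)) (fun n => ?_)
    (tendsto_pi_nhds.2 fun u => (hx u).tendsto.comp (tendsto_rightGrid u))
  have : Measurable fun u : ℝ≥0 => ⌊(n + 1 : ℝ≥0) * u⌋₊ :=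
    Nat.measurable_floor.comp (measurable_const_mul _)
  exact (measurable_from_nat (f := fun k : ℕ => x ((k + 1) / (n + 1)))).comp this

lemma IsRCLL.comp_continuous {E F : Type*} [TopologicalSpace E] [TopologicalSpace F]
    {x : ℝ≥0 → E} (hx : IsRCLL x) {g : E → F} (hg : Continuous g) : IsRCLL fun t => g (x t) :=
  ⟨fun t => hg.continuousAt.comp_continuousWithinAt (hx.1 t), fun t => by
    obtain ⟨l, hl⟩ := hx.2 t
    exact ⟨g l, (hg.tendsto l).comp hl⟩⟩

lemma IsRCLL.measurable_fin {N : ℕ} {x : ℝ≥0 → Fin N} (hx : IsRCLL x) : Measurable x := by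
  refine measurable_to_countable' fun i => ?_
  have h : IsRCLL fun t => if x t = i then (1 : ℝ) else 0 :=
    hx.comp_continuous (g := fun j => if j = i then (1 : ℝ) else 0) continuous_of_discreteTopology
  have h2 := measurable_of_rightContinuous h.1 (measurableSet_singleton 1)
  convert h2 using 1
  ext t
  by_cases hxt : x t = i <;> simp [hxt]

lemma measurable_select {α : Type*} [MeasurableSpace α] {N : ℕ} {x : α → Fin N} (hx : Measurable x)
    {f : Fin N → α → ℝ} (hf : ∀ i, Measurable (f i)) : Measurable fun u => f (x u) u := by
  have : (fun u => f (x u) u) = fun u => ∑ i, (x ⁻¹' {i}).indicator (f i) u := by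
    ext u
    rw [Finset.sum_eq_single (x u)]
    · simp
    · intro j _ hj
      exact indicator_of_notMem (by simpa using hj.symm) _
    · simp
  rw [this]
  exact Finset.measurable_sum _ fun i _ => (hf i).indicator (hx (measurableSet_singleton i))

/-- Paths with right and left limits are bounded on bounded intervals. -/
lemma IsRCLL.exists_bound {x : ℝ≥0 → ℝ} (hx : IsRCLL x) (T : ℝ≥0) :
    ∃ c, ∀ t ≤ T, |x t| ≤ c := by
  have h : ∃ c, ∀ t ∈ Icc 0 T, |x t| ≤ c := by
    refine isCompact_Icc.induction_on (p := fun s => ∃ c, ∀ t ∈ s, |x t| ≤ c) ⟨0, by simp⟩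
      ?_ ?_ ?_
    · rintro s t hst ⟨c, hc⟩
      exact ⟨c, fun u hu => hc u (hst hu)⟩
    · rintro s t ⟨c, hc⟩ ⟨d, hd⟩
      exact ⟨max c d, fun u hu => hu.elim (fun h => (hc u h).trans (le_max_left _ _))
        fun h => (hd u h).trans (le_max_right _ _)⟩
    · intro t _
      obtain ⟨l, hl⟩ := hx.2 t
      have h1 : ∀ᶠ u in 𝓝[≥] t, |x u| < |x t| + 1 :=
        (hx.1 t).abs.eventually_lt_const (lt_add_one _)
      have h2 : ∀ᶠ u in 𝓝[<] t, |x u| < |l| + 1 := hl.abs.eventually_lt_const (lt_add_one _)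
      have h3 : ∀ᶠ u in 𝓝 t, |x u| ≤ max (|x t| + 1) (|l| + 1) := by
        rw [← nhdsLT_sup_nhdsGE, eventually_sup]
        exact ⟨h2.mono fun u hu => hu.le.trans (le_max_right _ _),
          h1.mono fun u hu => hu.le.trans (le_max_left _ _)⟩
      exact ⟨_, mem_nhdsWithin_of_mem_nhds h3, _, fun u hu => hu⟩
  obtain ⟨c, hc⟩ := h
  exact ⟨c, fun t ht => hc t ⟨zero_le, ht⟩⟩

/-- Indefinite integrals are left-continuous. -/
lemma tendsto_setIntegral_left {μ : Measure ℝ≥0} [NullSingletonClass μ] {a u : ℝ≥0} {f : ℝ≥0 → ℝ}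
    (hf : IntegrableOn f (Ioc a u) μ) :
    Tendsto (fun t => ∫ w in Ioc a t, f w ∂μ) (𝓝[<] u) (𝓝 (∫ w in Ioc a u, f w ∂μ)) := by
  have h1 : ∀ t, t < u → ∫ w in Ioc a t, f w ∂μ =
      ∫ w in Ioc a u, (Iic t).indicator f w ∂μ := by
    intro t ht
    rw [integral_indicator measurableSet_Iic, Measure.restrict_restrict measurableSet_Iic,
      inter_comm, Ioc_inter_Iic, min_eq_right ht.le]
  have h2 : Tendsto (fun t => ∫ w in Ioc a u, (Iic t).indicator f w ∂μ) (𝓝[<] u)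
      (𝓝 (∫ w in Ioc a u, f w ∂μ)) := by
    refine tendsto_integral_filter_of_dominated_convergence (fun w => ‖f w‖)
      (Eventually.of_forall fun t => hf.aestronglyMeasurable.indicator measurableSet_Iic)
      (Eventually.of_forall fun t => ae_of_all _ fun w => norm_indicator_le_norm_self _ _)
      hf.norm ?_
    have : ∀ᵐ w ∂(μ.restrict (Ioc a u)), w ≠ u := by
      rw [ae_iff]
      simp only [ne_eq, not_not, ofPred_eq_eq_singleton]
      exact measure_singleton u
    filter_upwards [this, ae_restrict_mem measurableSet_Ioc] with w hw hw'
    refine tendsto_const_nhds.congr' ?_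
    filter_upwards [Ioo_mem_nhdsLT (lt_of_le_of_ne hw'.2 hw)] with t ht
    rw [indicator_of_mem (show w ∈ Iic t from ht.1.le)]
  refine h2.congr' ?_
  filter_upwards [self_mem_nhdsWithin] with t ht using (h1 t ht).symm

end Reg

/-! ### The drivers along the states of the chain -/

section Algebra

variable {Ω : Type*} {N : ℕ} (A C : ℝ≥0 → Matrix (Fin N) (Fin N) ℝ) (X : ℝ≥0 → Ω → Fin N)
  (D : ℝ≥0 → Fin N → ℝ)

lemma dotProduct_vec (v : Fin N → ℝ) (u : ℝ≥0) (ω : Ω) : v ⬝ᵥ vec X u ω = v (X u ω) := by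
  simp [vec]

lemma vec_dotProduct (v : Fin N → ℝ) (u : ℝ≥0) (ω : Ω) : vec X u ω ⬝ᵥ v = v (X u ω) := by
  simp [vec]

lemma mulVec_vec (M : Matrix (Fin N) (Fin N) ℝ) (u : ℝ≥0) (ω : Ω) (j : Fin N) :
    (M *ᵥ vec X u ω) j = M j (X u ω) := by
  simp [vec]

lemma sig_self (u : ℝ≥0) (i : Fin N) : sig C u i i = 0 := by simp [sig]

/-- `∑_j A^{ji} (z_j - z_i)`: the compensator of `z' dX` in state `i`. -/
def comp1 (u : ℝ≥0) (i : Fin N) (z : Fin N → ℝ) : ℝ := ∑ j, A u j i * (z j - z i)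

/-- `∑_j A^{ji} σ^{ij} (z_j - z_i)`. -/
noncomputable def compSig (u : ℝ≥0) (i : Fin N) (z : Fin N → ℝ) : ℝ :=
  ∑ j, A u j i * sig C u i j * (z j - z i)

variable {A}

lemma dotProduct_mulVec_vec (hA : IsRateMatrix A) (z : Fin N → ℝ) (u : ℝ≥0) (ω : Ω) :
    z ⬝ᵥ (A u *ᵥ vec X u ω) = comp1 A u (X u ω) z := by
  simp only [dotProduct, mulVec_vec, comp1, mul_sub, Finset.sum_sub_distrib, ← Finset.sum_mul,
    hA.sum_eq_zero, zero_mul, sub_zero]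
  exact Finset.sum_congr rfl fun j _ => mul_comm _ _

lemma rate_eq (u : ℝ≥0) (ω : Ω) :
    rate A X C D u ω = D u (X u ω) - ∑ j, A u j (X u ω) * sig C u (X u ω) j := by
  rw [rate, dotProduct_vec, vec_dotProduct]
  congr 1
  change ∑ j, sig C u (X u ω) j * (A u *ᵥ vec X u ω) j = _
  refine Finset.sum_congr rfl fun j _ => ?_
  rw [mulVec_vec, mul_comm]

lemma excess_eq (u : ℝ≥0) (ω : Ω) (z : Fin N → ℝ) :
    excess A X C D u ω z = -compSig A C u (X u ω) z := by
  set i := X u ω with hi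
  have h : ((A u)ᵀ *ᵥ z) i - ((Gam A C D u)ᵀ *ᵥ z) i =
      D u i * z i - ∑ j, A u j i * sig C u i j * z j := by
    simp only [Matrix.mulVec, dotProduct, Matrix.transpose_apply, ← Finset.sum_sub_distrib]
    rw [← Finset.sum_erase_add _ _ (Finset.mem_univ i),
      ← Finset.sum_erase_add (f := fun j => A u j i * sig C u i j * z j) _ (Finset.mem_univ i)]
    simp only [sig_self]
    have : ∑ j ∈ Finset.univ.erase i, (A u j i * z j - Gam A C D u j i * z j) =
        -∑ j ∈ Finset.univ.erase i, A u j i * sig C u i j * z j := by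
      rw [← Finset.sum_neg_distrib]
      refine Finset.sum_congr rfl fun j hj => ?_
      simp only [Gam, Matrix.of_apply, if_neg (Finset.ne_of_mem_erase hj), sig]
      ring
    rw [this]
    simp only [Gam, Matrix.of_apply, if_true]
    ring
  rw [excess, vec_dotProduct, ← hi]
  simp only [Matrix.sub_mulVec, Pi.add_apply, Pi.sub_apply, Pi.smul_apply, smul_eq_mul, h,
    rate_eq, ← hi, compSig, mul_sub, Finset.sum_sub_distrib, ← Finset.sum_mul]
  ring

lemma driver_eq (u : ℝ≥0) (ω : Ω) (v : ℝ) (z : Fin N → ℝ) :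
    driver A X C D u ω v z = -(rate A X C D u ω) * v + compSig A C u (X u ω) z := by
  rw [driver, excess_eq]; ring

/-- The two terms of the driver `H_s` are multiples of the same sum, and they cancel for `s = -1`. -/
lemma discDriver_eq (s : ℝ) (u : ℝ≥0) (ω : Ω) (z : Fin N → ℝ) :
    discDriver s A X C D u ω z = -(s + 1) * compSig A C u (X u ω) z := by
  have : ∑ i, ∑ j, vec X u ω i * A u j i * sig C u i j * (z ⬝ᵥ (Pi.single j 1 - Pi.single i 1)) =
      compSig A C u (X u ω) z := by
    rw [Finset.sum_eq_single (X u ω)]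
    · simp [compSig, vec, dotProduct_sub]
    · intro i _ hi
      simp [vec, hi]
    · simp
  rw [discDriver, excess_eq, this]; ring

/-- In state `i`, the seminorm is the carré du champ `∑_j A^{ji} (z_j - z_i)²`. -/
lemma seminormSq_eq (hA : IsRateMatrix A) (u : ℝ≥0) (ω : Ω) (z : Fin N → ℝ) :
    seminormSq A X u ω z = ∑ j, A u j (X u ω) * (z j - z (X u ω)) ^ 2 := by
  set i := X u ω with hi
  have h1 : ∀ j, (Matrix.diagonal (A u *ᵥ vec X u ω) *ᵥ z) j = A u j i * z j := by
    intro j; rw [Matrix.mulVec_diagonal, mulVec_vec]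
  have h2 : z ⬝ᵥ ((Matrix.diagonal (vec X u ω) * (A u)ᵀ) *ᵥ z) = z i * ∑ j, A u j i * z j := by
    rw [← Matrix.mulVec_mulVec]
    simp only [dotProduct, Matrix.mulVec_diagonal]
    rw [Finset.sum_eq_single i]
    · simp [vec, ← hi, Matrix.mulVec, dotProduct]
    · intro j _ hj
      simp [vec, ← hi, hj]
    · simp
  have h3 : z ⬝ᵥ ((A u * Matrix.diagonal (vec X u ω)) *ᵥ z) = z i * ∑ j, A u j i * z j := by
    rw [← Matrix.mulVec_mulVec]
    have : Matrix.diagonal (vec X u ω) *ᵥ z = z i • vec X u ω := by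
      ext j
      rw [Matrix.mulVec_diagonal]
      by_cases hj : j = i
      · subst hj; simp [vec, ← hi]
      · simp [vec, ← hi, hj]
    rw [this, Matrix.mulVec_smul, dotProduct_smul, smul_eq_mul]
    simp only [dotProduct, mulVec_vec, ← hi]
    congr 1
    exact Finset.sum_congr rfl fun j _ => mul_comm _ _
  rw [seminormSq, Psi, Matrix.sub_mulVec, Matrix.sub_mulVec, dotProduct_sub, dotProduct_sub, h2, h3]
  simp only [dotProduct, h1]
  have h4 : ∑ j, A u j i * (z j - z i) ^ 2 =
      ∑ j, z j * (A u j i * z j) - 2 * z i * ∑ j, A u j i * z j + z i ^ 2 * ∑ j, A u j i := by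
    rw [Finset.mul_sum, Finset.mul_sum, ← Finset.sum_sub_distrib, ← Finset.sum_add_distrib]
    exact Finset.sum_congr rfl fun j _ => by ring
  rw [h4, hA.sum_eq_zero]
  ring

/-- When the chain jumps from `i` to `j`, `Ṽ = π V` jumps by `Ṽ_{u-} σ^{ij}` because of `π`, and by
`1 + σ^{ij}` times the jump of `Z̃` because of `V`. -/
lemma discIntegrand_sub (u : ℝ≥0) (ω : Ω) (z : Fin N → ℝ) (v : ℝ) {i : Fin N}
    (hi : Function.leftLim (fun u => X u ω) u = i) (j : Fin N) :
    discIntegrand X C u ω z v j - discIntegrand X C u ω z v i =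
      v * sig C u i j + (1 + sig C u i j) * (z j - z i) := by
  have h : ∀ k, discIntegrand X C u ω z v k = v * sig C u i k + sig C u i k * (z k - z i) + z k := by
    intro k
    simp only [discIntegrand, Pi.add_apply, Pi.smul_apply, smul_eq_mul, Finset.sum_apply, vecL, hi]
    congr 2
    · simp
    · rw [Finset.sum_eq_single i]
      · rw [Finset.sum_eq_single k]
        · simp [dotProduct_sub]
        · intro l _ hl; simp [hl.symm]
        · simp
      · intro l _ hl; simp [hl]
      · simp
  rw [h, h, sig_self]
  ring

end Algebra

/-! ### Increments of pathwise integrals -/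

section Increments

variable {Ω : Type*} {N : ℕ} {A C : ℝ≥0 → Matrix (Fin N) (Fin N) ℝ} {X : ℝ≥0 → Ω → Fin N}
  {D : ℝ≥0 → Fin N → ℝ} {ω : Ω} {T : ℝ≥0}

/-- `∫_{(a,b]} φ_u' dX_u`. -/
noncomputable def jumpSum (X : ℝ≥0 → Ω → Fin N) (φ : ℝ≥0 → Ω → Fin N → ℝ) (a b : ℝ≥0) (ω : Ω) : ℝ :=
  ∑ᶠ u ∈ Ioc a b, φ u ω ⬝ᵥ (vec X u ω - vecL X u ω)

lemma dotProduct_jump (φ : Fin N → ℝ) (u : ℝ≥0) :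
    φ ⬝ᵥ (vec X u ω - vecL X u ω) = φ (X u ω) - φ (Function.leftLim (fun u => X u ω) u) := by
  simp [vec, vecL, dotProduct_sub]

lemma support_jump_subset (φ : ℝ≥0 → Ω → Fin N → ℝ) :
    (Function.support fun u => φ u ω ⬝ᵥ (vec X u ω - vecL X u ω)) ⊆ jumps fun u => X u ω := by
  intro u hu
  by_contra h
  rw [jumps, mem_ofPred_eq, not_not] at h
  exact hu (by beta_reduce; rw [dotProduct_jump, h, sub_self])

lemma jumpSum_add (hx : IsRCLL fun u => X u ω) (φ : ℝ≥0 → Ω → Fin N → ℝ) {a b c : ℝ≥0}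
    (hab : a ≤ b) (hbc : b ≤ c) : jumpSum X φ a c ω = jumpSum X φ a b ω + jumpSum X φ b c ω := by
  have hfin : ∀ {a b}, a ≤ b → (Ioc a b ∩
      Function.support fun u => φ u ω ⬝ᵥ (vec X u ω - vecL X u ω)).Finite := fun hab =>
    (hx.finite_jumps_Ioc hab).subset fun u hu => ⟨support_jump_subset φ hu.2, hu.1⟩
  rw [jumpSum, ← Ioc_union_Ioc_eq_Ioc hab hbc,
    finsum_mem_union' (Ioc_disjoint_Ioc_of_le le_rfl) (hfin hab) (hfin hbc)]
  rfl

lemma jumpSum_self (φ : ℝ≥0 → Ω → Fin N → ℝ) (a : ℝ≥0) : jumpSum X φ a a ω = 0 := by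
  simp [jumpSum]

lemma jumpSum_of_const {φ : ℝ≥0 → Ω → Fin N → ℝ} {a b : ℝ≥0} (hab : a < b)
    (hc : ∀ u, a ≤ u → u < b → X u ω = X a ω) :
    jumpSum X φ a b ω = φ b ω (X b ω) - φ b ω (X a ω) := by
  have h1 : jumpSum X φ a b ω =
      ∑ᶠ u ∈ ({b} : Set ℝ≥0), φ u ω ⬝ᵥ (vec X u ω - vecL X u ω) := by
    refine finsum_mem_inter_support_eq _ _ _ ?_
    ext u
    simp only [mem_inter_iff, mem_Ioc, mem_singleton_iff, and_congr_left_iff]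
    intro hu
    refine ⟨fun h => ?_, by rintro rfl; exact ⟨hab, le_rfl⟩⟩
    by_contra hne
    have hub : u < b := lt_of_le_of_ne h.2 hne
    refine support_jump_subset φ hu ?_
    rw [leftLim_eq_of_const_Ico h.1 fun v h1 h2 => hc v h1 (h2.trans hub)]
    exact (hc u h.1.le hub).symm
  rw [h1, finsum_mem_singleton, dotProduct_jump, leftLim_eq_of_const_Ico hab hc]

lemma setIntegral_Ioc_add {μ : Measure ℝ≥0} {f : ℝ≥0 → ℝ} {a b c : ℝ≥0} (hab : a ≤ b) (hbc : b ≤ c)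
    (hf : IntegrableOn f (Ioc a c) μ) :
    ∫ u in Ioc a c, f u ∂μ = (∫ u in Ioc a b, f u ∂μ) + ∫ u in Ioc b c, f u ∂μ := by
  rw [← Ioc_union_Ioc_eq_Ioc hab hbc]
  exact setIntegral_union (Ioc_disjoint_Ioc_of_le le_rfl) measurableSet_Ioc
    (hf.mono_set (Ioc_subset_Ioc_right hbc)) (hf.mono_set (Ioc_subset_Ioc_left hab))

lemma intM_sub (hx : IsRCLL fun u => X u ω) {φ : ℝ≥0 → Ω → Fin N → ℝ} {a b : ℝ≥0} (hab : a ≤ b)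
    (hφ : IntegrableOn (fun u => φ u ω ⬝ᵥ (A u *ᵥ vec X u ω)) (Ioc 0 b) leb) :
    intM A X φ b ω - intM A X φ a ω =
      jumpSum X φ a b ω - ∫ u in Ioc a b, φ u ω ⬝ᵥ (A u *ᵥ vec X u ω) ∂leb := by
  have h1 : ∀ t, intX X φ t ω = jumpSum X φ 0 t ω := fun _ => rfl
  rw [intM, intM, h1, h1, jumpSum_add hx φ zero_le hab, setIntegral_Ioc_add zero_le hab hφ]
  ring

lemma ae_Ioc_ne (a b : ℝ≥0) : ∀ᵐ u ∂(leb.restrict (Ioc a b)), u ∈ Ioo a b := by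
  have h1 : ∀ᵐ u ∂leb, u ≠ b := by
    rw [ae_iff]; simp
  filter_upwards [ae_restrict_of_ae h1, ae_restrict_mem measurableSet_Ioc] with u h1 h2
  exact ⟨h2.1, lt_of_le_of_ne h2.2 h1⟩

lemma measurable_setIntegral_Ioc {μ : Measure ℝ≥0} [SFinite μ] {f : ℝ≥0 → ℝ} (hf : Measurable f)
    (a : ℝ≥0) : Measurable fun t => ∫ u in Ioc a t, f u ∂μ := by
  have h : ∀ t, ∫ u in Ioc a t, f u ∂μ =
      ∫ u, {p : ℝ≥0 × ℝ≥0 | a < p.2 ∧ p.2 ≤ p.1}.indicator (fun p => f p.2) (t, u) ∂μ := by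
    intro t
    rw [← integral_indicator measurableSet_Ioc]
    rfl
  simp_rw [h]
  have hm : MeasurableSet {p : ℝ≥0 × ℝ≥0 | a < p.2 ∧ p.2 ≤ p.1} := by
    have h1 : MeasurableSet {p : ℝ≥0 × ℝ≥0 | a < p.2} := measurable_snd measurableSet_Ioi
    have h2 : MeasurableSet {p : ℝ≥0 × ℝ≥0 | p.2 ≤ p.1} :=
      measurableSet_le measurable_snd measurable_fst
    exact h1.inter h2
  exact ((hf.comp measurable_snd).indicator hm).stronglyMeasurable.integral_prod_right'.measurable

lemma sig_bound (hC' : ∃ c : ℝ, ∀ t ≤ T, ∀ i j, |C t i j| ≤ c) :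
    ∃ c, 0 ≤ c ∧ ∀ t ≤ T, ∀ i j, |sig C t i j| ≤ c := by
  obtain ⟨c, hc⟩ := hC'
  refine ⟨Real.exp (2 * c) + 1, by positivity, fun t ht i j => ?_⟩
  have h1 := abs_le.1 (hc t ht i i)
  have h2 := abs_le.1 (hc t ht i j)
  have h3 : Real.exp (C t i i - C t i j) ≤ Real.exp (2 * c) := Real.exp_le_exp.2 (by linarith)
  have h4 := Real.exp_pos (C t i i - C t i j)
  rw [sig, Matrix.of_apply, abs_le]
  constructor <;> linarith

lemma sig_measurable (hC : ∀ i j, Measurable fun t => C t i j) (i j : Fin N) :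
    Measurable fun t => sig C t i j := by
  simp only [sig, Matrix.of_apply]
  exact (((hC i i).sub (hC i j)).exp).sub_const 1

lemma abs_weighted_le (hA : IsRateMatrix A) {m : ℝ} (hm : ∀ t i j, |A t i j| ≤ m) (u : ℝ≥0)
    (z g : Fin N → ℝ) {c : ℝ} (hg : ∀ j, |g j| ≤ c) :
    |∑ j, A u j (X u ω) * g j * (z j - z (X u ω))| ≤ c * (N * m + seminormSq A X u ω z) := by
  have hc : ∀ j : Fin N, 0 ≤ c := fun j => (abs_nonneg _).trans (hg j)
  rw [seminormSq_eq X hA]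
  set i := X u ω
  have h : ∀ j, |A u j i * g j * (z j - z i)| ≤ c * (m + A u j i * (z j - z i) ^ 2) := by
    intro j
    rw [abs_mul, abs_mul, mul_comm |A u j i|, mul_assoc]
    refine mul_le_mul (hg j) ?_ (by positivity) (hc j)
    by_cases hj : j = i
    · simpa [hj] using (abs_nonneg _).trans (hm u i i)
    · have h0 := hA.nonneg u i j hj
      rw [abs_of_nonneg h0]
      have h1 : A u j i * |z j - z i| ≤ A u j i * (1 + (z j - z i) ^ 2) := by
        refine mul_le_mul_of_nonneg_left ?_ h0
        rw [← sq_abs (z j - z i)]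
        nlinarith [sq_nonneg (|z j - z i| - 1), abs_nonneg (z j - z i)]
      have h2 := (le_abs_self _).trans (hm u j i)
      linarith
  refine (Finset.abs_sum_le_sum_abs _ _).trans ((Finset.sum_le_sum fun j _ => h j).trans ?_)
  rw [← Finset.mul_sum, Finset.sum_add_distrib]
  simp

/-- Sums `∑_j A^{ji} g_j (z_j - z_i)` with bounded weights `g` are integrable in time as soon as
`‖z‖²_X` is. -/
lemma integrableOn_weighted (hA : IsRateMatrix A) (hx : IsRCLL fun u => X u ω)
    {Z : ℝ≥0 → Fin N → ℝ} (hZm : ∀ j, Measurable fun u => Z u j)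
    (hZ : IntegrableOn (fun u => seminormSq A X u ω (Z u)) (Ioc 0 T) leb)
    {g : ℝ≥0 → Fin N → Fin N → ℝ} (hgm : ∀ i j, Measurable fun u => g u i j) {c : ℝ}
    (hg : ∀ u ≤ T, ∀ i j, |g u i j| ≤ c) :
    IntegrableOn (fun u => ∑ j, A u j (X u ω) * g u (X u ω) j * (Z u j - Z u (X u ω)))
      (Ioc 0 T) leb := by
  obtain ⟨m, hm⟩ := hA.bounded
  have hmeas : Measurable fun u =>
      ∑ j, A u j (X u ω) * g u (X u ω) j * (Z u j - Z u (X u ω)) :=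
    measurable_select (f := fun i u => ∑ j, A u j i * g u i j * (Z u j - Z u i)) hx.measurable_fin
      fun i => Finset.measurable_sum _ fun j _ =>
        ((hA.measurable j i).mul (hgm i j)).mul ((hZm j).sub (hZm i))
  have hdom : IntegrableOn (fun u => c * (N * m + seminormSq A X u ω (Z u))) (Ioc 0 T) leb :=
    ((integrable_const _).add hZ).const_mul c
  refine Integrable.mono' hdom hmeas.aestronglyMeasurable ?_
  filter_upwards [ae_restrict_mem measurableSet_Ioc] with u hu
  exact abs_weighted_le hA hm u (Z u) _ (hg u hu.2 _)

lemma integrableOn_D (hx : IsRCLL fun u => X u ω) (hD : ∀ i, Measurable fun t => D t i)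
    (hD' : ∃ c : ℝ, ∀ t ≤ T, ∀ i, |D t i| ≤ c) :
    IntegrableOn (fun u => D u ⬝ᵥ vec X u ω) (Ioc 0 T) leb := by
  obtain ⟨c, hc⟩ := hD'
  simp only [dotProduct_vec]
  exact integrableOn_leb_of_bounded (measurable_select (f := fun i u => D u i) hx.measurable_fin hD)
    fun u hu => hc u hu.2 _

lemma sdf_eq_mul (hx : IsRCLL fun u => X u ω) (hD : ∀ i, Measurable fun t => D t i)
    (hD' : ∃ c : ℝ, ∀ t ≤ T, ∀ i, |D t i| ≤ c) {a b : ℝ≥0} (hab : a ≤ b) (hb : b ≤ T) :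
    sdf X C D b ω = sdf X C D a ω * Real.exp (-jumpSum X (fun u ω => vecL X u ω ᵥ* C u) a b ω
      - ∫ u in Ioc a b, D u ⬝ᵥ vec X u ω ∂leb) := by
  have h1 : ∀ t, intX X (fun u ω => vecL X u ω ᵥ* C u) t ω =
    jumpSum X (fun u ω => vecL X u ω ᵥ* C u) 0 t ω := fun _ => rfl
  rw [sdf, sdf, h1, h1, ← Real.exp_add, jumpSum_add hx _ zero_le hab,
    setIntegral_Ioc_add zero_le hab
      ((integrableOn_D hx hD hD').mono_set (Ioc_subset_Ioc_right hb))]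
  congr 1
  ring

lemma sdf_pos (t : ℝ≥0) : 0 < sdf X C D t ω := Real.exp_pos _

/-- Between two jumps the discount function is `exp (-∫ D)`. -/
lemma sdf_of_const (hx : IsRCLL fun u => X u ω) (hD : ∀ i, Measurable fun t => D t i)
    (hD' : ∃ c : ℝ, ∀ t ≤ T, ∀ i, |D t i| ≤ c) {a b : ℝ≥0} (hb : b ≤ T)
    (hc : ∀ u, a ≤ u → u < b → X u ω = X a ω) {t : ℝ≥0} (hat : a ≤ t) (htb : t < b) :
    sdf X C D t ω = sdf X C D a ω * Real.exp (-∫ u in Ioc a t, D u (X a ω) ∂leb) := by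
  rw [sdf_eq_mul hx hD hD' hat (htb.le.trans hb)]
  have h1 : jumpSum X (fun u ω => vecL X u ω ᵥ* C u) a t ω = 0 := by
    rcases hat.eq_or_lt with rfl | h
    · exact jumpSum_self _ _
    · rw [jumpSum_of_const h fun u h1 h2 => hc u h1 (h2.trans htb), hc t hat htb, sub_self]
  have h2 : ∫ u in Ioc a t, D u ⬝ᵥ vec X u ω ∂leb = ∫ u in Ioc a t, D u (X a ω) ∂leb := by
    refine setIntegral_congr_fun measurableSet_Ioc fun u hu => ?_
    rw [dotProduct_vec, hc u hu.1.le (hu.2.trans_lt htb)]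
  rw [h1, h2, neg_zero, zero_sub]

/-- At a jump the discount function is multiplied by `1 + σ`. -/
lemma sdf_of_const_right (hx : IsRCLL fun u => X u ω) (hD : ∀ i, Measurable fun t => D t i)
    (hD' : ∃ c : ℝ, ∀ t ≤ T, ∀ i, |D t i| ≤ c) {a b : ℝ≥0} (hb : b ≤ T) (hab : a < b)
    (hc : ∀ u, a ≤ u → u < b → X u ω = X a ω) :
    sdf X C D b ω = sdf X C D a ω * Real.exp (-∫ u in Ioc a b, D u (X a ω) ∂leb)
      * (1 + sig C b (X a ω) (X b ω)) := by
  rw [sdf_eq_mul hx hD hD' hab.le hb, jumpSum_of_const hab hc]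
  have h2 : ∫ u in Ioc a b, D u ⬝ᵥ vec X u ω ∂leb = ∫ u in Ioc a b, D u (X a ω) ∂leb := by
    refine integral_congr_ae ?_
    filter_upwards [ae_Ioc_ne a b] with u hu
    rw [dotProduct_vec, hc u hu.1.le hu.2]
  have h3 : ∀ k, (vecL X b ω ᵥ* C b) k = C b (X a ω) k := by
    intro k
    rw [vecL, leftLim_eq_of_const_Ico hab hc]
    simp
  rw [h2, h3, h3, mul_assoc, sig, Matrix.of_apply, add_sub_cancel, ← Real.exp_add]
  congr 2
  ring

end Increments

/-! ### The product rule for the discounted value -/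

section Product

variable {Ω : Type*} {N : ℕ} {A C : ℝ≥0 → Matrix (Fin N) (Fin N) ℝ} {X : ℝ≥0 → Ω → Fin N}
  {D : ℝ≥0 → Fin N → ℝ} {ω : Ω} {T : ℝ≥0}

/-- The integrand `I(u, Z̃_u, Ṽ_{u-})` of the discounted equation. -/
noncomputable def intgd (X : ℝ≥0 → Ω → Fin N) (C : ℝ≥0 → Matrix (Fin N) (Fin N) ℝ)
    (D : ℝ≥0 → Fin N → ℝ) (V : ℝ≥0 → Ω → ℝ) (Z : ℝ≥0 → Ω → Fin N → ℝ) (u : ℝ≥0) (ω : Ω) :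
    Fin N → ℝ :=
  discIntegrand X C u ω (discZ X C D Z u ω) (Function.leftLim (fun v => discV X C D V v ω) u)

/-- The increment of the discounted value over an interval `(a, b]` such that the chain is
constant on `[a, b)`: the product rule for the continuous parts, together with one jump at `b`. -/
lemma discounted_increment_of_const (hA : IsRateMatrix A) (hx : IsRCLL fun u => X u ω)
    (hC : ∀ i j, Measurable fun t => C t i j) (hD : ∀ i, Measurable fun t => D t i)
    (hC' : ∃ c : ℝ, ∀ t ≤ T, ∀ i j, |C t i j| ≤ c) (hD' : ∃ c : ℝ, ∀ t ≤ T, ∀ i, |D t i| ≤ c)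
    {V : ℝ≥0 → Ω → ℝ} {Z : ℝ≥0 → Ω → Fin N → ℝ} {K : ℝ≥0 → Ω → ℝ}
    (hV : IsRCLL fun t => V t ω) (hZm : ∀ j, Measurable fun u => Z u ω j)
    (hZ : IntegrableOn (fun u => seminormSq A X u ω (Z u ω)) (Ioc 0 T) leb)
    (hKc : Continuous fun t => K t ω) (hKm : Monotone fun t => K t ω)
    (hEq : ∀ a b, a ≤ b → b ≤ T → V b ω = V a ω
      - (∫ u in Ioc a b, driver A X C D u ω (V u ω) (Z u ω) ∂leb) - (K b ω - K a ω)
      + (jumpSum X Z a b ω - ∫ u in Ioc a b, Z u ω ⬝ᵥ (A u *ᵥ vec X u ω) ∂leb))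
    {a b : ℝ≥0} (hab : a < b) (hb : b ≤ T) (hc : ∀ u, a ≤ u → u < b → X u ω = X a ω) :
    IntegrableOn (fun u => intgd X C D V Z u ω ⬝ᵥ (A u *ᵥ vec X u ω)) (Ioc a b) leb ∧
    IntegrableOn (fun u => sdf X C D u ω) (Ioc a b) (stieltjes fun u => K u ω) ∧
    discV X C D V b ω - discV X C D V a ω =
      -(∫ u in Ioc a b, sdf X C D u ω ∂(stieltjes fun u => K u ω))
      + (jumpSum X (intgd X C D V Z) a b ω
        - ∫ u in Ioc a b, intgd X C D V Z u ω ⬝ᵥ (A u *ᵥ vec X u ω) ∂leb) := by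
  set i := X a ω with hi
  set k := X b ω with hk
  set κ := stieltjes fun u => K u ω with hκ
  have hκnull : NullSingletonClass κ := stieltjes_nullSingleton hKm hKc
  have hκfin : IsFiniteMeasure (κ.restrict (Ioc a b)) := stieltjes_finite hKm hKc a b
  have hsub : Ioc a b ⊆ Ioc 0 T := Ioc_subset_Ioc zero_le hb
  obtain ⟨cs, hcs0, hcs⟩ := sig_bound hC'
  obtain ⟨cd, hcd⟩ := hD'
  have hD' : ∃ c : ℝ, ∀ t ≤ T, ∀ i, |D t i| ≤ c := ⟨cd, hcd⟩
  obtain ⟨cv, hcv⟩ := hV.exists_bound T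
  obtain ⟨m, hm⟩ := hA.bounded
  have hVm : Measurable fun t => V t ω := measurable_of_rightContinuous hV.1
  -- rates and coefficients in state `i`
  set ρ : ℝ≥0 → ℝ := fun u => ∑ j, A u j i * sig C u i j with hρ
  have hρm : Measurable ρ := Finset.measurable_sum _ fun j _ =>
    (hA.measurable j i).mul (sig_measurable hC i j)
  have hρb : ∀ u ≤ T, |ρ u| ≤ N * (m * cs) := by
    intro u hu
    refine (Finset.abs_sum_le_sum_abs _ _).trans ?_
    have : ∀ j ∈ Finset.univ, |A u j i * sig C u i j| ≤ m * cs := fun j _ => by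
      rw [abs_mul]
      exact mul_le_mul (hm u j i) (hcs u hu i j) (abs_nonneg _) ((abs_nonneg _).trans (hm u j i))
    refine (Finset.sum_le_sum this).trans ?_
    simp
  have hi1 : IntegrableOn (fun u => comp1 A u (X u ω) (Z u ω)) (Ioc 0 T) leb := by
    have := integrableOn_weighted hA hx hZm hZ (g := fun _ _ _ => 1) (c := 1)
      (fun _ _ => measurable_const) (by simp)
    simpa only [mul_one, comp1] using this
  have hi2 : IntegrableOn (fun u => compSig A C u (X u ω) (Z u ω)) (Ioc 0 T) leb :=
    integrableOn_weighted hA hx hZm hZ (g := fun u => sig C u) (sig_measurable hC) hcs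
  have hj1 : IntegrableOn (fun u => comp1 A u i (Z u ω)) (Ioc a b) leb :=
    (hi1.mono_set hsub).congr (by
      filter_upwards [ae_Ioc_ne a b] with u hu
      rw [hc u hu.1.le hu.2])
  have hj2 : IntegrableOn (fun u => compSig A C u i (Z u ω)) (Ioc a b) leb :=
    (hi2.mono_set hsub).congr (by
      filter_upwards [ae_Ioc_ne a b] with u hu
      rw [hc u hu.1.le hu.2])
  have hj3 : IntegrableOn (fun u => (D u i - ρ u) * V u ω) (Ioc a b) leb := by
    refine integrableOn_leb_of_bounded (((hD i).sub hρm).mul hVm) (c := (cd + N * (m * cs)) * cv)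
      fun u hu => ?_
    have huT := hu.2.trans hb
    rw [abs_mul]
    refine mul_le_mul ((abs_sub _ _).trans (add_le_add (hcd u huT i) (hρb u huT))) (hcv u huT)
      (abs_nonneg _) (add_nonneg ((abs_nonneg _).trans (hcd u huT i))
        ((abs_nonneg _).trans (hρb u huT)))
  -- before the jump at `b`, the discount function is `p` and `V = y1 + y2`, where `y1` is the
  -- absolutely continuous part and `y2` the part driven by `K`
  set g : ℝ≥0 → ℝ := fun u => (D u i - ρ u) * V u ω - compSig A C u i (Z u ω)
    - comp1 A u i (Z u ω) with hg
  have hgi : IntegrableOn g (Ioc a b) leb := (hj3.sub hj2).sub hj1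
  set p : ℝ≥0 → ℝ := fun t => sdf X C D a ω * Real.exp (-∫ u in Ioc a t, D u i ∂leb) with hp
  set y1 : ℝ≥0 → ℝ := fun t => V a ω + ∫ u in Ioc a t, g u ∂leb with hy1
  set y2 : ℝ≥0 → ℝ := fun t => -(K t ω - K a ω) with hy2
  have hpm : Measurable p := ((measurable_setIntegral_Ioc (hD i) a).neg.exp).const_mul _
  have hpa : p a = sdf X C D a ω := by simp [hp]
  have hpb : ∃ c, 0 ≤ c ∧ ∀ t ∈ Icc a b, |p t| ≤ c := by
    have hpos := sdf_pos (X := X) (C := C) (D := D) (ω := ω) a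
    refine ⟨sdf X C D a ω * Real.exp (cd * b), by positivity, fun t ht => ?_⟩
    rw [abs_of_nonneg (by positivity)]
    refine mul_le_mul_of_nonneg_left (Real.exp_le_exp.2 ?_) (sdf_pos a).le
    have h1 : ‖∫ u in Ioc a t, D u i ∂leb‖ ≤ cd * leb.real (Ioc a t) :=
      norm_setIntegral_le_of_norm_le_const (by rw [leb_Ioc]; exact ENNReal.ofReal_lt_top)
        fun u hu => hcd u (hu.2.trans (ht.2.trans hb)) i
    have h0 : 0 ≤ cd := (abs_nonneg _).trans (hcd 0 zero_le i)
    have h2 : leb.real (Ioc a t) ≤ b := by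
      rw [measureReal_def, leb_Ioc, ENNReal.toReal_ofReal
        (sub_nonneg.2 (by exact_mod_cast ht.1))]
      have : (t : ℝ) ≤ b := by exact_mod_cast ht.2
      linarith [a.2, (show (0:ℝ) ≤ a from a.2)]
    calc -∫ u in Ioc a t, D u i ∂leb ≤ ‖∫ u in Ioc a t, D u i ∂leb‖ := neg_le_abs _
      _ ≤ cd * b := h1.trans (mul_le_mul_of_nonneg_left h2 h0)
  obtain ⟨cp, hcp0, hcp⟩ := hpb
  have hsdf : ∀ t, a ≤ t → t < b → sdf X C D t ω = p t := fun t h1 h2 =>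
    sdf_of_const hx hD hD' hb hc h1 h2
  have hsdfb : sdf X C D b ω = p b * (1 + sig C b i k) := sdf_of_const_right hx hD hD' hb hab hc
  have hVt : ∀ t, a ≤ t → t < b → V t ω = y1 t + y2 t := by
    intro t h1 h2
    rw [hEq a t h1 (h2.le.trans hb)]
    have hj : jumpSum X Z a t ω = 0 := by
      rcases h1.eq_or_lt with rfl | h
      · exact jumpSum_self _ _
      · rw [jumpSum_of_const h fun u h3 h4 => hc u h3 (h4.trans h2), hc t h1 h2, sub_self]
    have hsub' : Ioc a t ⊆ Ioc a b := Ioc_subset_Ioc_right h2.le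
    have e1 : ∫ u in Ioc a t, driver A X C D u ω (V u ω) (Z u ω) ∂leb =
        -∫ u in Ioc a t, ((D u i - ρ u) * V u ω - compSig A C u i (Z u ω)) ∂leb := by
      rw [← integral_neg]
      refine setIntegral_congr_fun measurableSet_Ioc fun u hu => ?_
      rw [driver_eq, rate_eq, hc u hu.1.le (hu.2.trans_lt h2)]
      ring
    have e2 : ∫ u in Ioc a t, Z u ω ⬝ᵥ (A u *ᵥ vec X u ω) ∂leb =
        ∫ u in Ioc a t, comp1 A u i (Z u ω) ∂leb := by
      refine setIntegral_congr_fun measurableSet_Ioc fun u hu => ?_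
      rw [dotProduct_mulVec_vec X hA, hc u hu.1.le (hu.2.trans_lt h2)]
    have e3 : ∫ u in Ioc a t, g u ∂leb =
        (∫ u in Ioc a t, ((D u i - ρ u) * V u ω - compSig A C u i (Z u ω)) ∂leb)
          - ∫ u in Ioc a t, comp1 A u i (Z u ω) ∂leb :=
      integral_sub ((hj3.sub hj2).mono_set hsub') (hj1.mono_set hsub')
    rw [e1, e2, hj, hy1, hy2]
    simp only [e3]
    ring
  have hVb : V b ω = y1 b + y2 b + (Z b ω k - Z b ω i) := by
    rw [hEq a b hab.le hb, jumpSum_of_const hab hc]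
    have e1 : ∫ u in Ioc a b, driver A X C D u ω (V u ω) (Z u ω) ∂leb =
        -∫ u in Ioc a b, ((D u i - ρ u) * V u ω - compSig A C u i (Z u ω)) ∂leb := by
      rw [← integral_neg]
      refine integral_congr_ae ?_
      filter_upwards [ae_Ioc_ne a b] with u hu
      rw [driver_eq, rate_eq, hc u hu.1.le hu.2]
      ring
    have e2 : ∫ u in Ioc a b, Z u ω ⬝ᵥ (A u *ᵥ vec X u ω) ∂leb =
        ∫ u in Ioc a b, comp1 A u i (Z u ω) ∂leb := by
      refine integral_congr_ae ?_
      filter_upwards [ae_Ioc_ne a b] with u hu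
      rw [dotProduct_mulVec_vec X hA, hc u hu.1.le hu.2]
    have e3 : ∫ u in Ioc a b, g u ∂leb =
        (∫ u in Ioc a b, ((D u i - ρ u) * V u ω - compSig A C u i (Z u ω)) ∂leb)
          - ∫ u in Ioc a b, comp1 A u i (Z u ω) ∂leb :=
      integral_sub (hj3.sub hj2) hj1
    rw [e1, e2, hy1, hy2]
    simp only [e3]
    ring
  -- left limits
  have hdV : ∀ u ∈ Ioc a b, Tendsto (fun v => discV X C D V v ω) (𝓝[<] u)
      (𝓝 (p u * (y1 u + y2 u))) := by
    intro u hu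
    have t1 : Tendsto p (𝓝[<] u) (𝓝 (p u)) :=
      ((Real.continuous_exp.tendsto _).comp (tendsto_setIntegral_left (μ := leb) (a := a)
        (integrableOn_leb_of_bounded (hD i) fun w hw => hcd w (hw.2.trans (hu.2.trans hb)) i)).neg
        ).const_mul _
    have t2 : Tendsto y1 (𝓝[<] u) (𝓝 (y1 u)) :=
      (tendsto_setIntegral_left (hgi.mono_set (Ioc_subset_Ioc_right hu.2))).const_add _
    have t3 : Tendsto y2 (𝓝[<] u) (𝓝 (y2 u)) :=
      (((hKc.tendsto u).mono_left nhdsWithin_le_nhds).sub_const _).neg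
    refine (t1.mul (t2.add t3)).congr' ?_
    filter_upwards [Ico_mem_nhdsLT hu.1] with v hv
    rw [discV, hsdf v hv.1 (hv.2.trans_le hu.2), hVt v hv.1 (hv.2.trans_le hu.2)]
  have hdVl : ∀ u ∈ Ioc a b,
      Function.leftLim (fun v => discV X C D V v ω) u = p u * (y1 u + y2 u) := fun u hu => by
    have : (𝓝[<] u).NeBot := nnreal_nhdsLT_neBot (pos_of_gt hu.1)
    exact leftLim_eq_of_tendsto (hdV u hu)
  have hsdfl : ∀ u ∈ Ioc a b, sdfL X C D u ω = p u := fun u hu => by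
    have : (𝓝[<] u).NeBot := nnreal_nhdsLT_neBot (pos_of_gt hu.1)
    refine leftLim_eq_of_tendsto ?_
    have t1 : Tendsto p (𝓝[<] u) (𝓝 (p u)) :=
      ((Real.continuous_exp.tendsto _).comp (tendsto_setIntegral_left (μ := leb) (a := a)
        (integrableOn_leb_of_bounded (hD i) fun w hw => hcd w (hw.2.trans (hu.2.trans hb)) i)).neg
        ).const_mul _
    refine t1.congr' ?_
    filter_upwards [Ico_mem_nhdsLT hu.1] with v hv
    rw [hsdf v hv.1 (hv.2.trans_le hu.2)]
  have hxl : ∀ u ∈ Ioc a b, Function.leftLim (fun u => X u ω) u = i := fun u hu =>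
    leftLim_eq_of_const_Ico hu.1 fun v h1 h2 => hc v h1 (h2.trans_le hu.2)
  have hI : ∀ u ∈ Ioc a b, ∀ j, intgd X C D V Z u ω j - intgd X C D V Z u ω i =
      p u * ((y1 u + y2 u) * sig C u i j + (1 + sig C u i j) * (Z u ω j - Z u ω i)) := by
    intro u hu j
    rw [intgd, discIntegrand_sub C X u ω _ _ (hxl u hu), hdVl u hu]
    simp only [discZ, hsdfl u hu, Pi.smul_apply, smul_eq_mul]
    ring
  set f : ℝ≥0 → ℝ := fun u => -(D u i * p u) with hf
  have hIA : ∀ u ∈ Ioo a b, intgd X C D V Z u ω ⬝ᵥ (A u *ᵥ vec X u ω) =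
      -(p u * g u + f u * V u ω) := by
    intro u hu
    have hu' : u ∈ Ioc a b := ⟨hu.1, hu.2.le⟩
    rw [dotProduct_mulVec_vec X hA, hc u hu.1.le hu.2, comp1]
    simp only [hI u hu', ← hVt u hu.1.le hu.2, hg, hf, hρ, compSig, comp1]
    have : ∀ j, A u j i * (p u * (V u ω * sig C u i j + (1 + sig C u i j) * (Z u ω j - Z u ω i))) =
        p u * (V u ω * (A u j i * sig C u i j) + A u j i * (Z u ω j - Z u ω i)
          + A u j i * sig C u i j * (Z u ω j - Z u ω i)) := fun j => by ring
    simp only [this, ← Finset.mul_sum, Finset.sum_add_distrib]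
    ring
  -- integrability
  have hpgi : IntegrableOn (fun u => p u * g u) (Ioc a b) leb :=
    Integrable.bdd_mul hgi hpm.aestronglyMeasurable (c := cp)
      ((ae_restrict_iff' measurableSet_Ioc).2 (ae_of_all _ fun u hu => hcp u ⟨hu.1.le, hu.2⟩))
  have hfm : Measurable f := ((hD i).mul hpm).neg
  have hfb : ∀ u ∈ Ioc a b, |f u| ≤ cd * cp := fun u hu => by
    rw [hf, abs_neg, abs_mul]
    exact mul_le_mul (hcd u (hu.2.trans hb) i) (hcp u ⟨hu.1.le, hu.2⟩) (abs_nonneg _)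
      ((abs_nonneg _).trans (hcd u (hu.2.trans hb) i))
  have hfi : IntegrableOn f (Ioc a b) leb := integrableOn_leb_of_bounded hfm hfb
  have hfVi : IntegrableOn (fun u => f u * V u ω) (Ioc a b) leb :=
    integrableOn_leb_of_bounded (hfm.mul hVm) (c := cd * cp * cv) fun u hu => by
      rw [abs_mul]
      exact mul_le_mul (hfb u hu) (hcv u (hu.2.trans hb)) (abs_nonneg _)
        ((abs_nonneg _).trans (hfb u hu))
  have hfy2 : IntegrableOn (fun u => f u * y2 u) (Ioc a b) leb :=
    integrableOn_leb_of_bounded (hfm.mul (hKc.measurable.sub_const _).neg)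
      (c := cd * cp * (K b ω - K a ω)) fun u hu => by
      rw [abs_mul]
      refine mul_le_mul (hfb u hu) ?_ (abs_nonneg _) ((abs_nonneg _).trans (hfb u hu))
      have h1 : K a ω ≤ K u ω := hKm hu.1.le
      have h2 : K u ω ≤ K b ω := hKm hu.2
      rw [hy2, abs_neg, abs_of_nonneg (by linarith)]
      linarith
  have hfy1 : IntegrableOn (fun u => f u * y1 u) (Ioc a b) leb := by
    refine (hfVi.sub hfy2).congr ?_
    filter_upwards [ae_Ioc_ne a b] with u hu
    rw [Pi.sub_apply, hVt u hu.1.le hu.2]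
    ring
  have hpκ : IntegrableOn p (Ioc a b) κ :=
    Measure.integrableOn_of_bounded (by
        have := hκfin.measure_univ_lt_top
        rw [Measure.restrict_apply_univ] at this
        exact this.ne)
      hpm.aestronglyMeasurable
      ((ae_restrict_iff' measurableSet_Ioc).2 (ae_of_all _ fun u hu => hcp u ⟨hu.1.le, hu.2⟩))
  have hκne : ∀ᵐ u ∂(κ.restrict (Ioc a b)), u ∈ Ioo a b := by
    have h1 : ∀ᵐ u ∂κ, u ≠ b := by rw [ae_iff]; simp
    filter_upwards [ae_restrict_of_ae h1, ae_restrict_mem measurableSet_Ioc] with u h1 h2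
    exact ⟨h2.1, lt_of_le_of_ne h2.2 h1⟩
  have hsκ : p =ᵐ[κ.restrict (Ioc a b)] fun u => sdf X C D u ω := by
    filter_upwards [hκne] with u hu
    rw [hsdf u hu.1.le hu.2]
  -- product rules
  have hpeq : ∀ t ∈ Icc a b, p t = p a + ∫ u in Ioc a t, f u ∂leb := by
    intro t ht
    rw [hpa]
    change sdf X C D a ω * Real.exp (-∫ u in Ioc a t, D u i ∂leb) = _
    rw [exp_neg_integral ht.1 (hD i) fun u hu => hcd u (hu.2.trans (ht.2.trans hb)) i,
      mul_sub, mul_one, sub_eq_add_neg, ← integral_const_mul, ← integral_neg]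
    congr 1
    refine setIntegral_congr_fun measurableSet_Ioc fun u _ => ?_
    simp only [hf, hp]
    ring
  have pr1 := product_rule (μ := leb) (ν := leb) hab.le hfi hgi (x := p) (y := y1) hpeq
    (fun t _ => by simp [hy1])
  have pr2 := product_rule (μ := leb) (ν := κ) hab.le hfi
    (h := fun _ => -1) (integrable_const _) (x := p) (y := y2) hpeq
    (fun t ht => by
      rw [integral_neg, stieltjes_integral_one hKm hKc ht.1]
      simp [hy2])
  have hIAi : ∫ u in Ioc a b, intgd X C D V Z u ω ⬝ᵥ (A u *ᵥ vec X u ω) ∂leb =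
      -((∫ u in Ioc a b, p u * g u ∂leb) + ((∫ u in Ioc a b, f u * y1 u ∂leb)
        + ∫ u in Ioc a b, f u * y2 u ∂leb)) := by
    have e := integral_add hpgi (hfy1.add hfy2)
    simp only [Pi.add_apply] at e
    rw [← integral_add hfy1 hfy2, ← e, ← integral_neg]
    refine integral_congr_ae ?_
    filter_upwards [ae_Ioc_ne a b] with u hu
    rw [hIA u hu, hVt u hu.1.le hu.2]
    ring
  refine ⟨?_, hpκ.congr hsκ, ?_⟩
  · refine (hpgi.add hfVi).neg.congr ?_
    filter_upwards [ae_Ioc_ne a b] with u hu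
    rw [hIA u hu]
    rfl
  · rw [hIAi, jumpSum_of_const hab hc, ← integral_congr_ae hsκ, ← hk, ← hi,
      hI b ⟨hab, le_rfl⟩ k, discV, discV, hsdfb, hVb, ← hpa]
    have hy1a : y1 a = V a ω := by simp [hy1]
    have hy2a : y2 a = 0 := by simp [hy2]
    simp only [mul_neg, mul_one, integral_neg] at pr2
    rw [hy1a] at pr1
    rw [hy2a] at pr2
    linear_combination pr1 + pr2

end Product

section Product

variable {Ω : Type*} {N : ℕ} {A C : ℝ≥0 → Matrix (Fin N) (Fin N) ℝ} {X : ℝ≥0 → Ω → Fin N}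
  {D : ℝ≥0 → Fin N → ℝ} {ω : Ω} {T : ℝ≥0}

lemma integrableOn_comp1 (hA : IsRateMatrix A) (hx : IsRCLL fun u => X u ω)
    {Z : ℝ≥0 → Ω → Fin N → ℝ} (hZm : ∀ j, Measurable fun u => Z u ω j)
    (hZ : IntegrableOn (fun u => seminormSq A X u ω (Z u ω)) (Ioc 0 T) leb) :
    IntegrableOn (fun u => Z u ω ⬝ᵥ (A u *ᵥ vec X u ω)) (Ioc 0 T) leb := by
  have := integrableOn_weighted hA hx hZm hZ (g := fun _ _ _ => 1) (c := 1)
    (fun _ _ => measurable_const) (by simp)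
  simp only [dotProduct_mulVec_vec X hA]
  simpa only [mul_one, comp1] using this

lemma integrableOn_driver (hA : IsRateMatrix A) (hx : IsRCLL fun u => X u ω)
    (hC : ∀ i j, Measurable fun t => C t i j) (hD : ∀ i, Measurable fun t => D t i)
    (hC' : ∃ c : ℝ, ∀ t ≤ T, ∀ i j, |C t i j| ≤ c) (hD' : ∃ c : ℝ, ∀ t ≤ T, ∀ i, |D t i| ≤ c)
    {V : ℝ≥0 → Ω → ℝ} {Z : ℝ≥0 → Ω → Fin N → ℝ}
    (hV : IsRCLL fun t => V t ω) (hZm : ∀ j, Measurable fun u => Z u ω j)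
    (hZ : IntegrableOn (fun u => seminormSq A X u ω (Z u ω)) (Ioc 0 T) leb) :
    IntegrableOn (fun u => driver A X C D u ω (V u ω) (Z u ω)) (Ioc 0 T) leb := by
  obtain ⟨cs, hcs0, hcs⟩ := sig_bound hC'
  obtain ⟨cd, hcd⟩ := hD'
  obtain ⟨cv, hcv⟩ := hV.exists_bound T
  obtain ⟨m, hm⟩ := hA.bounded
  have hr : Measurable fun u => rate A X C D u ω := by
    simp only [rate_eq]
    exact measurable_select (f := fun i u => D u i - ∑ j, A u j i * sig C u i j) hx.measurable_fin
      fun i => (hD i).sub (Finset.measurable_sum _ fun j _ =>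
        (hA.measurable j i).mul (sig_measurable hC i j))
  have hrb : ∀ u ≤ T, |rate A X C D u ω| ≤ cd + N * (m * cs) := by
    intro u hu
    rw [rate_eq]
    refine (abs_sub _ _).trans (add_le_add (hcd u hu _) ?_)
    refine (Finset.abs_sum_le_sum_abs _ _).trans ?_
    have : ∀ j ∈ Finset.univ, |A u j (X u ω) * sig C u (X u ω) j| ≤ m * cs := fun j _ => by
      rw [abs_mul]
      exact mul_le_mul (hm u j (X u ω)) (hcs u hu _ j) (abs_nonneg _)
        ((abs_nonneg _).trans (hm u j (X u ω)))
    refine (Finset.sum_le_sum this).trans ?_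
    simp
  have h1 : IntegrableOn (fun u => -(rate A X C D u ω) * V u ω) (Ioc 0 T) leb := by
    refine integrableOn_leb_of_bounded (hr.neg.mul (measurable_of_rightContinuous hV.1))
      (c := (cd + N * (m * cs)) * cv) fun u hu => ?_
    rw [abs_mul, abs_neg]
    exact mul_le_mul (hrb u hu.2) (hcv u hu.2) (abs_nonneg _) ((abs_nonneg _).trans (hrb u hu.2))
  have h2 : IntegrableOn (fun u => compSig A C u (X u ω) (Z u ω)) (Ioc 0 T) leb :=
    integrableOn_weighted hA hx hZm hZ (g := fun u => sig C u) (sig_measurable hC) hcs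
  simp only [driver_eq]
  exact h1.add h2

/-- The product rule for the discounted value, over any time interval. -/
lemma discounted_increment (hA : IsRateMatrix A) (hx : IsRCLL fun u => X u ω)
    (hC : ∀ i j, Measurable fun t => C t i j) (hD : ∀ i, Measurable fun t => D t i)
    (hC' : ∃ c : ℝ, ∀ t ≤ T, ∀ i j, |C t i j| ≤ c) (hD' : ∃ c : ℝ, ∀ t ≤ T, ∀ i, |D t i| ≤ c)
    {V : ℝ≥0 → Ω → ℝ} {Z : ℝ≥0 → Ω → Fin N → ℝ} {K : ℝ≥0 → Ω → ℝ}
    (hV : IsRCLL fun t => V t ω) (hZm : ∀ j, Measurable fun u => Z u ω j)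
    (hZ : IntegrableOn (fun u => seminormSq A X u ω (Z u ω)) (Ioc 0 T) leb)
    (hKc : Continuous fun t => K t ω) (hKm : Monotone fun t => K t ω)
    (hEq : ∀ a b, a ≤ b → b ≤ T → V b ω = V a ω
      - (∫ u in Ioc a b, driver A X C D u ω (V u ω) (Z u ω) ∂leb) - (K b ω - K a ω)
      + (jumpSum X Z a b ω - ∫ u in Ioc a b, Z u ω ⬝ᵥ (A u *ᵥ vec X u ω) ∂leb))
    {a b : ℝ≥0} (hab : a ≤ b) (hb : b ≤ T) :
    IntegrableOn (fun u => intgd X C D V Z u ω ⬝ᵥ (A u *ᵥ vec X u ω)) (Ioc a b) leb ∧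
    IntegrableOn (fun u => sdf X C D u ω) (Ioc a b) (stieltjes fun u => K u ω) ∧
    discV X C D V b ω - discV X C D V a ω =
      -(∫ u in Ioc a b, sdf X C D u ω ∂(stieltjes fun u => K u ω))
      + (jumpSum X (intgd X C D V Z) a b ω
        - ∫ u in Ioc a b, intgd X C D V Z u ω ⬝ᵥ (A u *ᵥ vec X u ω) ∂leb) := by
  refine hx.path_induction (R := fun a b => b ≤ T →
    IntegrableOn (fun u => intgd X C D V Z u ω ⬝ᵥ (A u *ᵥ vec X u ω)) (Ioc a b) leb ∧
    IntegrableOn (fun u => sdf X C D u ω) (Ioc a b) (stieltjes fun u => K u ω) ∧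
    discV X C D V b ω - discV X C D V a ω =
      -(∫ u in Ioc a b, sdf X C D u ω ∂(stieltjes fun u => K u ω))
      + (jumpSum X (intgd X C D V Z) a b ω
        - ∫ u in Ioc a b, intgd X C D V Z u ω ⬝ᵥ (A u *ᵥ vec X u ω) ∂leb)) ?_ ?_ hab hb
  · intro a b c hab hbc h1 h2 hc
    obtain ⟨i1, j1, e1⟩ := h1 (hbc.trans hc)
    obtain ⟨i2, j2, e2⟩ := h2 hc
    have i3 := i1.union i2
    have j3 := j1.union j2
    rw [Ioc_union_Ioc_eq_Ioc hab hbc] at i3 j3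
    refine ⟨i3, j3, ?_⟩
    rw [setIntegral_Ioc_add hab hbc i3, setIntegral_Ioc_add hab hbc j3, jumpSum_add hx _ hab hbc]
    linear_combination e1 + e2
  · intro a b hab hc hb
    rcases hab.eq_or_lt with rfl | hlt
    · simp [jumpSum_self]
    · exact discounted_increment_of_const hA hx hC hD hC' hD' hV hZm hZ hKc hKm hEq hlt hb hc

/-- Along a path, the reflected equation implies the discounted one. -/
theorem discounted_equation (hA : IsRateMatrix A) (hx : IsRCLL fun u => X u ω)
    (hC : ∀ i j, Measurable fun t => C t i j) (hD : ∀ i, Measurable fun t => D t i)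
    (hC' : ∃ c : ℝ, ∀ t ≤ T, ∀ i j, |C t i j| ≤ c) (hD' : ∃ c : ℝ, ∀ t ≤ T, ∀ i, |D t i| ≤ c)
    {G V : ℝ≥0 → Ω → ℝ} {Z : ℝ≥0 → Ω → Fin N → ℝ} {K : ℝ≥0 → Ω → ℝ}
    (hV : IsRCLL fun t => V t ω) (hZm : ∀ j, Measurable fun u => Z u ω j)
    (hZ : IntegrableOn (fun u => seminormSq A X u ω (Z u ω)) (Ioc 0 T) leb)
    (hKc : Continuous fun t => K t ω) (hKm : Monotone fun t => K t ω)
    (hEq : ∀ t ≤ T,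
      V t ω = G T ω + (∫ u in Ioc t T, driver A X C D u ω (V u ω) (Z u ω) ∂leb)
        + (K T ω - K t ω) - (intM A X Z T ω - intM A X Z t ω)) {t : ℝ≥0} (ht : t ≤ T) :
    discV X C D V t ω = sdf X C D T ω * G T ω
      + (∫ u in Ioc t T, discDriver (-1) A X C D u ω (discZ X C D Z u ω) ∂leb)
      + (discK X C D K T ω - discK X C D K t ω)
      - (intM A X (intgd X C D V Z) T ω - intM A X (intgd X C D V Z) t ω) := by
  have i1 := integrableOn_comp1 hA hx hZm hZ
  have i2 := integrableOn_driver hA hx hC hD hC' hD' hV hZm hZ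
  have hEq' : ∀ a b, a ≤ b → b ≤ T → V b ω = V a ω
      - (∫ u in Ioc a b, driver A X C D u ω (V u ω) (Z u ω) ∂leb) - (K b ω - K a ω)
      + (jumpSum X Z a b ω - ∫ u in Ioc a b, Z u ω ⬝ᵥ (A u *ᵥ vec X u ω) ∂leb) := by
    intro a b hab hb
    have e1 := hEq a (hab.trans hb)
    have e2 := hEq b hb
    have e3 := intM_sub hx hab (i1.mono_set (Ioc_subset_Ioc_right hb))
    rw [setIntegral_Ioc_add hab hb (i2.mono_set (Ioc_subset_Ioc_left zero_le))] at e1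
    linear_combination e2 - e1 + e3
  have hinc := fun {a b : ℝ≥0} => discounted_increment (a := a) (b := b)
    hA hx hC hD hC' hD' hV hZm hZ hKc hKm hEq'
  obtain ⟨-, -, e1⟩ := hinc ht le_rfl
  obtain ⟨i3, j3, -⟩ := hinc (zero_le (a := T)) le_rfl
  have e2 := intM_sub hx ht i3
  have e3 : discK X C D K T ω = discK X C D K t ω +
      ∫ u in Ioc t T, sdf X C D u ω ∂(stieltjes fun u => K u ω) :=
    setIntegral_Ioc_add zero_le ht j3
  have e4 : V T ω = G T ω := by simpa using hEq T le_rfl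
  have e5 : discV X C D V T ω = sdf X C D T ω * G T ω := by rw [discV, e4]
  simp only [discDriver_eq, neg_add_cancel, neg_zero, zero_mul, integral_zero]
  linear_combination e5 - e1 + e2 - e3

end Product

/-! ### Transition estimates for the chain -/

section Markov

variable {Ω : Type*} [MeasurableSpace Ω] {P : Measure Ω} {N : ℕ}
  {A : ℝ≥0 → Matrix (Fin N) (Fin N) ℝ} {X : ℝ≥0 → Ω → Fin N}

lemma measurableSet_state (hX : ∀ t, Measurable (X t)) {s t : ℝ≥0} (hst : s ≤ t)
    (S : Set (Fin N)) : MeasurableSet[chainFiltration P X t] (X s ⁻¹' S) := by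
  refine ⟨hX s trivial, X s ⁻¹' S, ?_, EventuallyEq.rfl⟩
  exact le_iSup (fun u : Iic t => MeasurableSpace.comap (X u) ⊤) ⟨s, hst⟩ _ ⟨S, trivial, rfl⟩

lemma measurable_state (hX : ∀ t, Measurable (X t)) {s t : ℝ≥0} (hst : s ≤ t) :
    Measurable[chainFiltration P X t] (X s) := fun S _ => measurableSet_state hX hst S

variable [IsProbabilityMeasure P]

lemma sum_real_state (hX : ∀ t, Measurable (X t)) (S : Set Ω) (t : ℝ≥0) :
    ∑ k, P.real (S ∩ X t ⁻¹' {k}) = P.real S := by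
  have h := sum_measureReal_preimage_singleton (μ := P.restrict S) (f := X t) Finset.univ
    fun y _ => hX t (measurableSet_singleton y)
  simp only [Finset.coe_univ, preimage_univ, measureReal_restrict_apply_univ] at h
  rw [← h]
  refine Finset.sum_congr rfl fun k _ => ?_
  rw [measureReal_restrict_apply (hX t (measurableSet_singleton k)), inter_comm]

lemma real_trans_eq (hX : IsMarkovChain P A X) {p : ℝ≥0 → ℝ≥0 → Matrix (Fin N) (Fin N) ℝ}
    (hp : ∀ s t, s ≤ t → ∀ j,
      P[(X t ⁻¹' {j}).indicator (fun _ => (1 : ℝ)) | chainFiltration P X s]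
        =ᵐ[P] fun ω => p s t j (X s ω))
    {s t : ℝ≥0} (hst : s ≤ t) {B : Set Ω} (hB : MeasurableSet[chainFiltration P X s] B)
    (i j : Fin N) :
    P.real (B ∩ X s ⁻¹' {i} ∩ X t ⁻¹' {j}) = p s t j i * P.real (B ∩ X s ⁻¹' {i}) := by
  have hS : MeasurableSet[chainFiltration P X s] (B ∩ X s ⁻¹' {i}) :=
    hB.inter (measurableSet_state hX.measurable le_rfl _)
  have hle := (chainFiltration P X).le s
  have hj : MeasurableSet (X t ⁻¹' {j}) := hX.measurable t (measurableSet_singleton j)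
  have h1 := setIntegral_condExp hle (μ := P) (f := (X t ⁻¹' {j}).indicator (fun _ => (1 : ℝ)))
    ((integrable_const _).indicator hj) hS
  rw [setIntegral_congr_ae (hle _ hS) (g := fun _ => p s t j i)
    ((hp s t hst j).mono fun ω h hω => h.trans (congrArg (fun i => p s t j i) hω.2)), setIntegral_const,
    setIntegral_indicator hj, setIntegral_const] at h1
  simp only [smul_eq_mul, mul_one] at h1
  rw [← h1, mul_comm]

/-- The forward equation, on an event of the past. -/
lemma real_forward (hX : IsMarkovChain P A X) {s t : ℝ≥0} (hst : s ≤ t) {B : Set Ω}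
    (hB : MeasurableSet[chainFiltration P X s] B) {i j : Fin N} (hij : i ≠ j) :
    P.real (B ∩ X s ⁻¹' {i} ∩ X t ⁻¹' {j}) =
      ∫ u in Ioc s t, ∑ k, A u j k * P.real (B ∩ X s ⁻¹' {i} ∩ X u ⁻¹' {k}) ∂leb := by
  obtain ⟨p, hp1, hp2⟩ := hX.markov
  rw [real_trans_eq hX hp2 hst hB, hp1.forward s t hst, Matrix.one_apply_ne hij.symm, zero_add,
    ← integral_mul_const]
  refine setIntegral_congr_fun measurableSet_Ioc fun u hu => ?_
  simp only [Matrix.mul_apply, Finset.sum_mul]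
  refine Finset.sum_congr rfl fun k _ => ?_
  rw [real_trans_eq hX hp2 hu.1.le hB, mul_assoc]

/-- Given the past up to `s`, the chain is unlikely to have moved shortly after `s`. -/
lemma real_move_le (hX : IsMarkovChain P A X) {m : ℝ} (hm : ∀ t i j, |A t i j| ≤ m)
    {s t : ℝ≥0} (hst : s ≤ t) {B : Set Ω} (hB : MeasurableSet[chainFiltration P X s] B) :
    P.real (B ∩ {ω | X s ω ≠ X t ω}) ≤ N * m * (t - s) * P.real B := by
  have hts : (0 : ℝ) ≤ t - s := sub_nonneg.2 (by exact_mod_cast hst)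
  have h1 : ∀ i j, i ≠ j →
      P.real (B ∩ X s ⁻¹' {i} ∩ X t ⁻¹' {j}) ≤ m * (t - s) * P.real (B ∩ X s ⁻¹' {i}) := by
    intro i j hij
    rw [real_forward hX hst hB hij]
    refine (le_abs_self _).trans ?_
    have := norm_setIntegral_le_of_norm_le_const (μ := leb) (s := Ioc s t)
      (f := fun u => ∑ k, A u j k * P.real (B ∩ X s ⁻¹' {i} ∩ X u ⁻¹' {k}))
      (C := m * P.real (B ∩ X s ⁻¹' {i})) (by rw [leb_Ioc]; exact ENNReal.ofReal_lt_top) ?_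
    · refine this.trans (le_of_eq ?_)
      rw [show leb.real (Ioc s t) = t - s by
        rw [measureReal_def, leb_Ioc, ENNReal.toReal_ofReal hts]]
      ring
    · intro u _
      refine (norm_sum_le _ _).trans ?_
      rw [← sum_real_state hX.measurable (B ∩ X s ⁻¹' {i}) u, Finset.mul_sum]
      refine Finset.sum_le_sum fun k _ => ?_
      rw [norm_mul, Real.norm_of_nonneg measureReal_nonneg]
      exact mul_le_mul_of_nonneg_right (hm _ _ _) measureReal_nonneg
  have h2 : P.real (B ∩ {ω | X s ω ≠ X t ω}) ≤
      ∑ i, ∑ j, if i ≠ j then P.real (B ∩ X s ⁻¹' {i} ∩ X t ⁻¹' {j}) else 0 := by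
    have hU : B ∩ {ω | X s ω ≠ X t ω} ⊆ ⋃ i, ⋃ j,
        (if i ≠ j then B ∩ X s ⁻¹' {i} ∩ X t ⁻¹' {j} else ∅) := by
      rintro ω ⟨hω, hne⟩
      refine mem_iUnion.2 ⟨X s ω, mem_iUnion.2 ⟨X t ω, ?_⟩⟩
      rw [if_pos (show X s ω ≠ X t ω from hne)]
      exact ⟨⟨hω, rfl⟩, rfl⟩
    refine (measureReal_mono hU).trans ((measureReal_iUnion_fintype_le _).trans
      (Finset.sum_le_sum fun i _ => (measureReal_iUnion_fintype_le _).trans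
        (Finset.sum_le_sum fun j _ => ?_)))
    split_ifs <;> simp
  have h3 : ∀ i : Fin N, ∑ j, (if i ≠ j then P.real (B ∩ X s ⁻¹' {i} ∩ X t ⁻¹' {j}) else 0) ≤
      N * (m * (t - s) * P.real (B ∩ X s ⁻¹' {i})) := by
    intro i
    have hm0 : 0 ≤ m := (abs_nonneg _).trans (hm 0 i i)
    have : ∀ j ∈ Finset.univ, (if i ≠ j then P.real (B ∩ X s ⁻¹' {i} ∩ X t ⁻¹' {j}) else 0) ≤
        m * (t - s) * P.real (B ∩ X s ⁻¹' {i}) := by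
      intro j _
      split_ifs with h
      · exact h1 i j h
      · positivity
    refine (Finset.sum_le_sum this).trans ?_
    simp
  refine h2.trans ((Finset.sum_le_sum fun i _ => h3 i).trans (le_of_eq ?_))
  rw [← Finset.mul_sum, ← Finset.mul_sum, sum_real_state hX.measurable]
  ring

lemma continuous_real_state (hX : IsMarkovChain P A X) (S : Set Ω) (i : Fin N) :
    Continuous fun u => P.real (S ∩ X u ⁻¹' {i}) := by
  obtain ⟨m, hm⟩ := hX.rate.bounded
  have hm0 : 0 ≤ m := (abs_nonneg _).trans (hm 0 i i)
  have key : ∀ u v : ℝ≥0, u ≤ v →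
      |P.real (S ∩ X u ⁻¹' {i}) - P.real (S ∩ X v ⁻¹' {i})| ≤ N * m * (v - u) := by
    intro u v huv
    have h0 := real_move_le hX hm huv (B := univ) MeasurableSet.univ
    rw [univ_inter, probReal_univ, mul_one] at h0
    have h1 : P.real (S ∩ X u ⁻¹' {i}) ≤ P.real (S ∩ X v ⁻¹' {i}) + P.real {ω | X u ω ≠ X v ω} := by
      refine (measureReal_mono ?_).trans (measureReal_union_le _ _)
      rintro ω ⟨h1, h2⟩
      by_cases h : X u ω = X v ω
      · exact Or.inl ⟨h1, h.symm.trans h2⟩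
      · exact Or.inr h
    have h2 : P.real (S ∩ X v ⁻¹' {i}) ≤ P.real (S ∩ X u ⁻¹' {i}) + P.real {ω | X u ω ≠ X v ω} := by
      refine (measureReal_mono ?_).trans (measureReal_union_le _ _)
      rintro ω ⟨h1, h2⟩
      by_cases h : X u ω = X v ω
      · exact Or.inl ⟨h1, h.trans h2⟩
      · exact Or.inr h
    rw [abs_le]
    constructor <;> linarith
  have : LipschitzWith ⟨N * m, by positivity⟩ fun u => P.real (S ∩ X u ⁻¹' {i}) := by
    refine LipschitzWith.of_dist_le_mul fun u v => ?_
    rw [Real.dist_eq, NNReal.dist_eq]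
    rcases le_total u v with h | h
    · refine (key u v h).trans ?_
      rw [abs_sub_comm]
      exact mul_le_mul_of_nonneg_left (le_abs_self _) (by positivity)
    · rw [abs_sub_comm]
      refine (key v u h).trans ?_
      exact mul_le_mul_of_nonneg_left (le_abs_self _) (by positivity)
  exact this.continuous

lemma integrableOn_rate_state (hX : IsMarkovChain P A X) (S : Set Ω) (i j k : Fin N) (s t : ℝ≥0) :
    IntegrableOn (fun u => A u j k * P.real (S ∩ X u ⁻¹' {i})) (Ioc s t) leb := by
  obtain ⟨m, hm⟩ := hX.rate.bounded
  refine integrableOn_leb_of_bounded ((hX.rate.measurable j k).mul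
    (continuous_real_state hX S i).measurable) (c := m) fun u _ => ?_
  rw [abs_mul, abs_of_nonneg measureReal_nonneg]
  calc |A u j k| * P.real (S ∩ X u ⁻¹' {i}) ≤ m * 1 :=
        mul_le_mul (hm _ _ _) measureReal_le_one measureReal_nonneg ((abs_nonneg _).trans (hm u j k))
    _ = m := mul_one m

/-- Over short intervals, transitions from `i` to `j` occur with the rate `A^{ji}`, up to an error
of second order. -/
lemma real_trans_sub_le (hX : IsMarkovChain P A X) {m : ℝ} (hm : ∀ t i j, |A t i j| ≤ m)
    {s t : ℝ≥0} (hst : s ≤ t) {B : Set Ω} (hB : MeasurableSet[chainFiltration P X s] B)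
    {i j : Fin N} (hij : i ≠ j) :
    |P.real (B ∩ X s ⁻¹' {i} ∩ X t ⁻¹' {j}) - ∫ u in Ioc s t, A u j i * P.real (B ∩ X u ⁻¹' {i}) ∂leb|
      ≤ (N * m) ^ 2 * (t - s) ^ 2 := by
  have hts : (0 : ℝ) ≤ t - s := sub_nonneg.2 (by exact_mod_cast hst)
  have hm0 : 0 ≤ m := (abs_nonneg _).trans (hm 0 i i)
  rw [real_forward hX hst hB hij, ← integral_sub
    (integrable_finsetSum _ fun k _ => integrableOn_rate_state hX _ k j k s t)
    (integrableOn_rate_state hX _ i j i s t)]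
  have hbound : ∀ u ∈ Ioc s t, ‖(∑ k, A u j k * P.real (B ∩ X s ⁻¹' {i} ∩ X u ⁻¹' {k}))
      - A u j i * P.real (B ∩ X u ⁻¹' {i})‖ ≤ N * m * (N * m * (t - s)) := by
    intro u hu
    set q := P.real (B ∩ {ω | X s ω ≠ X u ω}) with hq
    have hq1 : q ≤ N * m * (t - s) := by
      refine (real_move_le hX hm hu.1.le hB).trans ?_
      have h1 : (u : ℝ) - s ≤ t - s := sub_le_sub_right (by exact_mod_cast hu.2) _
      have h2 : (0 : ℝ) ≤ u - s := sub_nonneg.2 (by exact_mod_cast hu.1.le)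
      calc N * m * (u - s) * P.real B ≤ N * m * (u - s) * 1 :=
            mul_le_mul_of_nonneg_left measureReal_le_one (by positivity)
        _ ≤ _ := by rw [mul_one]; exact mul_le_mul_of_nonneg_left h1 (by positivity)
    have hsplit : (∑ k, A u j k * P.real (B ∩ X s ⁻¹' {i} ∩ X u ⁻¹' {k}))
        - A u j i * P.real (B ∩ X u ⁻¹' {i}) =
        ∑ k, A u j k * (P.real (B ∩ X s ⁻¹' {i} ∩ X u ⁻¹' {k}) -
          if k = i then P.real (B ∩ X u ⁻¹' {i}) else 0) := by
      simp only [mul_sub, Finset.sum_sub_distrib, mul_ite, mul_zero, Finset.sum_ite_eq',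
        Finset.mem_univ, if_true]
    rw [hsplit]
    refine (norm_sum_le _ _).trans ?_
    have hterm : ∀ k ∈ Finset.univ, ‖A u j k * (P.real (B ∩ X s ⁻¹' {i} ∩ X u ⁻¹' {k}) -
        if k = i then P.real (B ∩ X u ⁻¹' {i}) else 0)‖ ≤ m * q := by
      intro k _
      rw [norm_mul]
      refine mul_le_mul (hm _ _ _) ?_ (norm_nonneg _) hm0
      rw [Real.norm_eq_abs]
      split_ifs with hk
      · rw [hk, abs_sub_comm, abs_of_nonneg (sub_nonneg.2 (measureReal_mono
          (inter_subset_inter_left _ inter_subset_left))), sub_le_iff_le_add]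
        refine (measureReal_mono ?_).trans (measureReal_union_le _ _)
        rintro ω ⟨h1, h2⟩
        by_cases h : X s ω = X u ω
        · exact Or.inr ⟨⟨h1, h.trans h2⟩, h2⟩
        · exact Or.inl ⟨h1, h⟩
      · rw [sub_zero, abs_of_nonneg measureReal_nonneg]
        refine measureReal_mono ?_
        rintro ω ⟨⟨h1, h2⟩, h3⟩
        refine ⟨h1, fun h => hk ?_⟩
        exact (h3.symm.trans h.symm).trans h2
    refine (Finset.sum_le_sum hterm).trans ?_
    simp only [Finset.sum_const, Finset.card_univ, Fintype.card_fin, nsmul_eq_mul]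
    rw [mul_assoc]
    gcongr
  refine (norm_setIntegral_le_of_norm_le_const (by rw [leb_Ioc]; exact ENNReal.ofReal_lt_top)
    hbound).trans (le_of_eq ?_)
  rw [measureReal_def, leb_Ioc, ENNReal.toReal_ofReal hts]
  ring

end Markov

/-! ### The number of jumps -/

section Count

variable {Ω : Type*} [MeasurableSpace Ω] {P : Measure Ω} {N : ℕ}
  {A : ℝ≥0 → Matrix (Fin N) (Fin N) ℝ} {X : ℝ≥0 → Ω → Fin N}

/-- The number of jumps in `(s, t]` from a state `i` to a state `j` with `r i j`. -/
noncomputable def jumpCount (X : ℝ≥0 → Ω → Fin N) (r : Fin N → Fin N → Prop) (s t : ℝ≥0) (ω : Ω) :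
    ℕ := (jumpsRel (fun u => X u ω) r ∩ Ioc s t).ncard

/-- The number of transitions along a grid. -/
noncomputable def gridCount (X : ℝ≥0 → Ω → Fin N) (r : Fin N → Fin N → Prop) [DecidableRel r] (s t : ℝ≥0) (n : ℕ)
    (ω : Ω) : ℕ :=
  ∑ k ∈ Finset.range n, if r (X (grid s t n k) ω) (X (grid s t n (k + 1)) ω) then 1 else 0

lemma eventually_jumpCount (hX : IsMarkovChain P A X) (r : Fin N → Fin N → Prop) [DecidableRel r]
    (hr : ∀ i, ¬ r i i) {s t : ℝ≥0} (hst : s ≤ t) (ω : Ω) :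
    ∀ᶠ n in atTop, jumpCount X r s t ω = gridCount X r s t n ω :=
  (hX.rcll ω).eventually_ncard hst hr

lemma measurable_gridCount (hX : ∀ t, Measurable (X t)) (r : Fin N → Fin N → Prop) [DecidableRel r]
    {s t : ℝ≥0} (hst : s ≤ t) (n : ℕ) :
    Measurable[chainFiltration P X t] (gridCount X r s t n) := by
  rcases eq_or_ne n 0 with rfl | hn
  · have : gridCount X r s t 0 = fun _ => 0 := by ext; simp [gridCount]
    rw [this]
    exact measurable_const
  refine Finset.measurable_sum _ fun k hk => ?_
  have hk' : k + 1 ≤ n := Finset.mem_range.1 hk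
  have h1 := measurable_state (P := P) hX (grid_le hst hn (by omega : k ≤ n))
  have h2 := measurable_state (P := P) hX (grid_le hst hn hk')
  have h3 : Measurable fun q : Fin N × Fin N => if r q.1 q.2 then 1 else 0 := measurable_of_countable _
  exact h3.comp (h1.prodMk h2)

lemma measurable_jumpCount (hX : IsMarkovChain P A X) (r : Fin N → Fin N → Prop)
    (hr : ∀ i, ¬ r i i) {s t : ℝ≥0} (hst : s ≤ t) :
    Measurable[chainFiltration P X t] (jumpCount X r s t) := by
  classical
  refine @measurable_of_tendsto_metrizable _ _ (chainFiltration P X t) _ _ _ _ _ _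
    (fun n => measurable_gridCount hX.measurable r hst n) (tendsto_pi_nhds.2 fun ω => ?_)
  exact tendsto_const_nhds.congr' (eventually_jumpCount hX r hr hst ω)

variable [IsProbabilityMeasure P]

/-- A variable known at time `s` picks up at most a factor of order `t - s` when it is integrated
over the event that the chain has moved at time `t`. -/
lemma lintegral_move_le (hX : IsMarkovChain P A X) {m : ℝ} (hm : ∀ t i j, |A t i j| ≤ m)
    {s t : ℝ≥0} (hst : s ≤ t) {Y : Ω → ℝ≥0∞} (hY : Measurable[chainFiltration P X s] Y) :
    ∫⁻ ω in {ω | X s ω ≠ X t ω}, Y ω ∂P ≤ ENNReal.ofReal (N * m * (t - s)) * ∫⁻ ω, Y ω ∂P := by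
  have hle := (chainFiltration P X).le s
  have h : (P.restrict {ω | X s ω ≠ X t ω}).trim hle ≤
      (ENNReal.ofReal (N * m * (t - s)) • P).trim hle := by
    refine Measure.le_iff.2 fun B hB => ?_
    rw [trim_measurableSet_eq hle hB, trim_measurableSet_eq hle hB, Measure.smul_apply, smul_eq_mul,
      Measure.restrict_apply (hle _ hB)]
    have := real_move_le hX hm hst hB
    have hreal : ∀ S : Set Ω, P S = ENNReal.ofReal (P.real S) := fun S => by
      rw [measureReal_def, ENNReal.ofReal_toReal (measure_ne_top _ _)]
    rw [hreal, hreal B, ← ENNReal.ofReal_mul' measureReal_nonneg]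
    exact ENNReal.ofReal_le_ofReal this
  rw [← smul_eq_mul, ← lintegral_smul_measure, ← lintegral_trim hle hY, ← lintegral_trim hle hY]
  exact lintegral_mono' h le_rfl

/-- The number of jumps on a bounded interval has exponential moments of all orders. -/
theorem lintegral_pow_jumpCount (hX : IsMarkovChain P A X) (a T : ℝ≥0) :
    ∫⁻ ω, (a : ℝ≥0∞) ^ jumpCount X (fun i j => i ≠ j) 0 T ω ∂P < ∞ := by
  obtain ⟨m', hm'⟩ := hX.rate.bounded
  obtain ⟨m, hm0, hm⟩ : ∃ m : ℝ, 0 ≤ m ∧ ∀ t i j, |A t i j| ≤ m :=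
    ⟨max m' 0, le_max_right _ _, fun t i j => (hm' t i j).trans (le_max_left _ _)⟩
  set c : ℝ := N * m * T with hc
  have hc0 : 0 ≤ c := by positivity
  have hgrid : ∀ n : ℕ, n ≠ 0 →
      ∫⁻ ω, (a : ℝ≥0∞) ^ gridCount X (fun i j => i ≠ j) 0 T n ω ∂P ≤
        ENNReal.ofReal (Real.exp (a * c)) := by
    intro n hn
    have hn' : (n : ℝ) ≠ 0 := by exact_mod_cast hn
    set Y : ℕ → Ω → ℝ≥0∞ := fun l ω => (a : ℝ≥0∞) ^ (∑ k ∈ Finset.range l,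
      if X (grid 0 T n k) ω ≠ X (grid 0 T n (k + 1)) ω then 1 else 0) with hY
    have hYm : ∀ l, Measurable[chainFiltration P X (grid 0 T n l)] (Y l) := by
      intro l
      refine Measurable.const_pow ?_ _
      refine Finset.measurable_sum _ fun k hk => ?_
      have hk' : k + 1 ≤ l := Finset.mem_range.1 hk
      have h1 := measurable_state (P := P) hX.measurable (grid_mono 0 T n (by omega : k ≤ l))
      have h2 := measurable_state (P := P) hX.measurable (grid_mono 0 T n hk')
      have h3 : Measurable fun q : Fin N × Fin N => if q.1 ≠ q.2 then 1 else 0 :=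
        measurable_of_countable _
      exact h3.comp (h1.prodMk h2)
    -- by the transition estimate, each of the `n` steps multiplies the mean by at most `1 + a c / n`
    have hstep : ∀ l, ∫⁻ ω, Y (l + 1) ω ∂P ≤ ENNReal.ofReal (1 + a * (c / n)) * ∫⁻ ω, Y l ω ∂P := by
      intro l
      have hle : grid 0 T n l ≤ grid 0 T n (l + 1) := grid_mono 0 T n (Nat.le_succ l)
      have hne : MeasurableSet {ω | X (grid 0 T n l) ω ≠ X (grid 0 T n (l + 1)) ω} :=
        (measurableSet_eq_fun (hX.measurable _) (hX.measurable _)).compl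
      have hYm' : Measurable (Y l) := (hYm l).mono ((chainFiltration P X).le _) le_rfl
      have h1 : ∀ ω, Y (l + 1) ω ≤ Y l ω +
          a * {ω | X (grid 0 T n l) ω ≠ X (grid 0 T n (l + 1)) ω}.indicator (Y l) ω := by
        intro ω
        simp only [hY, Finset.sum_range_succ, pow_add]
        by_cases h : X (grid 0 T n l) ω ≠ X (grid 0 T n (l + 1)) ω
        · rw [if_pos h, indicator_of_mem (by exact h), pow_one, mul_comm]
          exact le_add_self
        · rw [if_neg h, pow_zero, mul_one]
          exact le_self_add
      refine (lintegral_mono h1).trans ?_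
      rw [lintegral_add_left hYm', lintegral_const_mul _ (hYm'.indicator hne),
        lintegral_indicator hne]
      have h2 := lintegral_move_le hX hm hle (hYm l)
      have h3 : ((grid 0 T n (l + 1) : ℝ≥0) : ℝ) - grid 0 T n l = T / n := by
        rw [grid_succ]; push_cast; simp
      rw [h3, show N * m * (T / n : ℝ) = c / n by rw [hc]; ring] at h2
      rw [ENNReal.ofReal_add zero_le_one (by positivity), ENNReal.ofReal_one, add_mul, one_mul,
        ENNReal.ofReal_mul (by positivity), ENNReal.ofReal_coe_nnreal, mul_assoc]
      gcongr
    have hiter : ∀ l, ∫⁻ ω, Y l ω ∂P ≤ ENNReal.ofReal (1 + a * (c / n)) ^ l := by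
      intro l
      induction l with
      | zero => simp [hY]
      | succ l ih =>
        refine (hstep l).trans ?_
        rw [pow_succ']
        gcongr
    refine (hiter n).trans ?_
    rw [← ENNReal.ofReal_pow (by positivity)]
    refine ENNReal.ofReal_le_ofReal ?_
    have h1 : 1 + a * (c / n) ≤ Real.exp (a * (c / n)) := by
      rw [add_comm]; exact Real.add_one_le_exp _
    refine (pow_le_pow_left₀ (by positivity) h1 n).trans (le_of_eq ?_)
    rw [← Real.exp_nat_mul]
    congr 1
    field_simp
  have hlim : ∀ ω, (a : ℝ≥0∞) ^ jumpCount X (fun i j => i ≠ j) 0 T ω ≤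
      liminf (fun n => (a : ℝ≥0∞) ^ gridCount X (fun i j => i ≠ j) 0 T n ω) atTop := by
    intro ω
    have : Tendsto (fun n => (a : ℝ≥0∞) ^ gridCount X (fun i j => i ≠ j) 0 T n ω) atTop
        (𝓝 ((a : ℝ≥0∞) ^ jumpCount X (fun i j => i ≠ j) 0 T ω)) := by
      refine tendsto_const_nhds.congr' ?_
      filter_upwards [eventually_jumpCount hX (fun i j => i ≠ j) (by simp) (zero_le (a := T)) ω]
        with n hn
      rw [hn]
    rw [this.liminf_eq]
  refine ((lintegral_mono hlim).trans (lintegral_liminf_le fun n => ?_)).trans_lt ?_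
  · exact ((measurable_gridCount hX.measurable _ zero_le n).mono
      ((chainFiltration P X).le T) le_rfl).const_pow _
  · refine lt_of_le_of_lt ?_ (ENNReal.ofReal_lt_top (r := Real.exp (a * c)))
    refine liminf_le_of_frequently_le' (Eventually.frequently ?_)
    filter_upwards [eventually_ne_atTop 0] with n hn using hgrid n hn

end Count

/-! ### Compensation of the jumps -/

section Kernel

open ProbabilityTheory

/-- A kernel all of whose measures are finite is s-finite. -/
lemma isSFiniteKernel_of_isFiniteMeasure {α β : Type*} [MeasurableSpace α] [MeasurableSpace β]
    (κ : Kernel α β) [∀ a, IsFiniteMeasure (κ a)] : IsSFiniteKernel κ := by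
  classical
  have hS : ∀ n : ℕ, MeasurableSet {a | κ a univ ∈ Ico (n : ℝ≥0∞) (n + 1)} := fun n =>
    (κ.measurable_coe MeasurableSet.univ) measurableSet_Ico
  refine ⟨⟨fun n => Kernel.piecewise (hS n) κ 0, fun n => ?_, ?_⟩⟩
  · refine ⟨⟨n + 1, by simp, fun a => ?_⟩⟩
    rw [Kernel.piecewise_apply]
    split_ifs with h
    · exact h.2.le
    · simp
  · refine Kernel.ext fun a => Measure.ext fun s hs => ?_
    rw [Kernel.sum_apply' _ _ hs]
    set n := ⌊(κ a univ).toReal⌋₊ with hn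
    have h0 : κ a univ = ENNReal.ofReal (κ a univ).toReal :=
      (ENNReal.ofReal_toReal (measure_ne_top _ _)).symm
    have h1 : ∀ k : ℕ, κ a univ ∈ Ico (k : ℝ≥0∞) (k + 1) ↔ k = n := by
      intro k
      have e1 : (k : ℝ≥0∞) ≤ κ a univ ↔ (k : ℝ) ≤ (κ a univ).toReal := by
        rw [← ENNReal.toReal_natCast k,
          ENNReal.toReal_le_toReal (ENNReal.natCast_ne_top k) (measure_ne_top _ _)]
      have e2 : κ a univ < (k : ℝ≥0∞) + 1 ↔ (κ a univ).toReal < k + 1 := by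
        rw [← Nat.cast_succ, ← Nat.cast_succ, ← ENNReal.toReal_natCast (k + 1),
          ENNReal.toReal_lt_toReal (measure_ne_top _ _) (ENNReal.natCast_ne_top _)]
      rw [mem_Ico, e1, e2, hn, eq_comm, Nat.floor_eq_iff ENNReal.toReal_nonneg]
    rw [tsum_eq_single n fun k hk => ?_]
    · rw [Kernel.piecewise_apply, if_pos (show a ∈ {a | κ a univ ∈ Ico (n : ℝ≥0∞) (n + 1)} from (h1 n).2 rfl)]
    · rw [Kernel.piecewise_apply, if_neg (show a ∉ {a | κ a univ ∈ Ico (k : ℝ≥0∞) (k + 1)} from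
        fun h => hk ((h1 k).1 h))]
      simp

end Kernel

section Comp

variable {Ω : Type*} [MeasurableSpace Ω] {P : Measure Ω} {N : ℕ}
  {A : ℝ≥0 → Matrix (Fin N) (Fin N) ℝ} {X : ℝ≥0 → Ω → Fin N}

/-- The relation singling out the jumps from `i` to `j`; it is empty for `i = j`. -/
def Trans (i j a b : Fin N) : Prop := i ≠ j ∧ a = i ∧ b = j

instance (i j : Fin N) : DecidableRel (Trans i j) := fun a b => by unfold Trans; infer_instance

lemma trans_irrefl (i j a : Fin N) : ¬ Trans i j a a := fun h => h.1 (h.2.1.symm.trans h.2.2)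

lemma finite_jumpsRel (hX : IsMarkovChain P A X) {r : Fin N → Fin N → Prop} (hr : ∀ a, ¬ r a a)
    {s t : ℝ≥0} (hst : s ≤ t) (ω : Ω) : (jumpsRel (fun u => X u ω) r ∩ Ioc s t).Finite :=
  ((hX.rcll ω).finite_jumps_Ioc hst).subset (inter_subset_inter_left _ (jumpsRel_subset _ hr))

lemma jumpCount_mono_rel (hX : IsMarkovChain P A X) {r : Fin N → Fin N → Prop}
    (hr : ∀ a, ¬ r a a) {s s' t t' : ℝ≥0} (hs : s' ≤ s) (hst : s ≤ t) (ht : t ≤ t') (ω : Ω) :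
    jumpCount X r s t ω ≤ jumpCount X (fun i j => i ≠ j) s' t' ω := by
  refine Set.ncard_le_ncard ?_ (finite_jumpsRel hX (fun a h => h rfl) (hs.trans (hst.trans ht)) ω)
  exact inter_subset_inter (jumpsRel_subset _ hr) (Ioc_subset_Ioc hs ht)

lemma gridCount_le_jumpCount (hX : IsMarkovChain P A X) {r : Fin N → Fin N → Prop} [DecidableRel r]
    (hr : ∀ a, ¬ r a a) {s t : ℝ≥0} (hst : s ≤ t) (n : ℕ) (ω : Ω) :
    gridCount X r s t n ω ≤ jumpCount X (fun i j => i ≠ j) s t ω := by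
  have key : ∀ l, ∑ k ∈ Finset.range l, (if r (X (grid s t n k) ω) (X (grid s t n (k + 1)) ω)
      then 1 else 0) ≤ (jumps (fun u => X u ω) ∩ Ioc s (grid s t n l)).ncard := by
    intro l
    induction l with
    | zero => simp
    | succ l ih =>
      have hle : grid s t n l ≤ grid s t n (l + 1) := grid_mono s t n (Nat.le_succ l)
      have hf1 := (hX.rcll ω).finite_jumps_Ioc (le_grid s t n l)
      have hf2 := (hX.rcll ω).finite_jumps_Ioc hle
      rw [Finset.sum_range_succ, ← Ioc_union_Ioc_eq_Ioc (le_grid s t n l) hle,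
        inter_union_distrib_left, ncard_union_eq ?_ hf1 hf2]
      · refine add_le_add ih ?_
        split_ifs with h
        · rw [Nat.one_le_iff_ne_zero]
          intro hne
          rw [ncard_eq_zero hf2] at hne
          refine hr _ (?_ : r (X (grid s t n l) ω) (X (grid s t n l) ω))
          have := (hX.rcll ω).eq_of_no_jumps hle fun u h1 h2 h3 =>
            (hne ▸ (⟨h3, h1, h2⟩ : u ∈ jumps (fun u => X u ω) ∩ Ioc _ _) : u ∈ (∅ : Set ℝ≥0))
          rwa [this] at h
        · exact zero_le
      · exact ((Ioc_disjoint_Ioc_of_le le_rfl).mono inter_subset_right inter_subset_right)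
  rcases eq_or_ne n 0 with rfl | hn
  · simp [gridCount]
  refine (key n).trans (le_of_eq ?_)
  rw [grid_last hst hn]
  rfl

variable [IsProbabilityMeasure P]

lemma integrable_pow_jumpCount (hX : IsMarkovChain P A X) (a T : ℝ≥0) :
    Integrable (fun ω => (a : ℝ) ^ jumpCount X (fun i j => i ≠ j) 0 T ω) P := by
  have hm := (measurable_jumpCount hX (fun i j => i ≠ j) (fun a h => h rfl) (zero_le (a := T))).mono
    ((chainFiltration P X).le T) le_rfl
  refine ⟨(hm.const_pow (a : ℝ)).aestronglyMeasurable, ?_⟩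
  rw [hasFiniteIntegral_iff_ofReal (Eventually.of_forall fun ω => by positivity)]
  refine lt_of_le_of_lt (lintegral_mono fun ω => ?_) (lintegral_pow_jumpCount hX a T)
  rw [ENNReal.ofReal_pow (by positivity), ENNReal.ofReal_coe_nnreal]

lemma integrable_jumpCount (hX : IsMarkovChain P A X) (r : Fin N → Fin N → Prop)
    (hr : ∀ a, ¬ r a a) {s t : ℝ≥0} (hst : s ≤ t) :
    Integrable (fun ω => (jumpCount X r s t ω : ℝ)) P := by
  have hm := (measurable_jumpCount hX r hr hst).mono ((chainFiltration P X).le t) le_rfl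
  refine (integrable_pow_jumpCount hX 2 t).mono' (measurable_from_top.comp hm).aestronglyMeasurable
    (Eventually.of_forall fun ω => ?_)
  rw [Real.norm_of_nonneg (Nat.cast_nonneg _)]
  refine le_trans ?_ (show ((jumpCount X (fun i j => i ≠ j) 0 t ω : ℕ) : ℝ) ≤ _ from ?_)
  · exact_mod_cast jumpCount_mono_rel hX hr zero_le hst le_rfl ω
  · exact_mod_cast (Nat.lt_two_pow_self (n := jumpCount X (fun i j => i ≠ j) 0 t ω)).le

/-- The expected number of jumps from `i` to `j`, on an event of the past: each jump is
compensated by its rate. -/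
theorem setIntegral_jumpCount (hX : IsMarkovChain P A X) {i j : Fin N} (hij : i ≠ j) {s t : ℝ≥0}
    (hst : s ≤ t) {B : Set Ω} (hB : MeasurableSet[chainFiltration P X s] B) :
    ∫ ω in B, (jumpCount X (Trans i j) s t ω : ℝ) ∂P =
      ∫ u in Ioc s t, A u j i * P.real (B ∩ X u ⁻¹' {i}) ∂leb := by
  obtain ⟨m, hm⟩ := hX.rate.bounded
  have hr := trans_irrefl (N := N) i j
  have hBm : MeasurableSet B := (chainFiltration P X).le s _ hB
  have hlim : Tendsto (fun n => ∫ ω in B, (gridCount X (Trans i j) s t n ω : ℝ) ∂P) atTop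
      (𝓝 (∫ ω in B, (jumpCount X (Trans i j) s t ω : ℝ) ∂P)) := by
    refine tendsto_integral_of_dominated_convergence
      (fun ω => (jumpCount X (fun i j => i ≠ j) s t ω : ℝ)) (fun n => ?_)
      (integrable_jumpCount hX _ (fun a h => h rfl) hst).integrableOn
      (fun n => Eventually.of_forall fun ω => ?_) (Eventually.of_forall fun ω => ?_)
    · exact (measurable_from_top.comp ((measurable_gridCount hX.measurable _ hst n).mono
        ((chainFiltration P X).le t) le_rfl)).aestronglyMeasurable
    · rw [Real.norm_of_nonneg (Nat.cast_nonneg _)]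
      exact_mod_cast gridCount_le_jumpCount hX hr hst n ω
    · refine tendsto_const_nhds.congr' ?_
      filter_upwards [eventually_jumpCount hX (Trans i j) hr hst ω] with n hn
      rw [hn]
  refine tendsto_nhds_unique hlim ?_
  rw [tendsto_iff_norm_sub_tendsto_zero]
  have hbound : ∀ n : ℕ, n ≠ 0 → ‖(∫ ω in B, (gridCount X (Trans i j) s t n ω : ℝ) ∂P) -
      ∫ u in Ioc s t, A u j i * P.real (B ∩ X u ⁻¹' {i}) ∂leb‖ ≤
      (N * m) ^ 2 * (t - s) ^ 2 * (1 / (n : ℝ)) := by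
    intro n hn
    have hn' : (n : ℝ) ≠ 0 := by exact_mod_cast hn
    have h1 : ∫ ω in B, (gridCount X (Trans i j) s t n ω : ℝ) ∂P = ∑ k ∈ Finset.range n,
        P.real (B ∩ X (grid s t n k) ⁻¹' {i} ∩ X (grid s t n (k + 1)) ⁻¹' {j}) := by
      simp only [gridCount, Nat.cast_sum, Nat.cast_ite, Nat.cast_one, Nat.cast_zero]
      have hmeas : ∀ k, MeasurableSet
          (X (grid s t n k) ⁻¹' {i} ∩ X (grid s t n (k + 1)) ⁻¹' {j}) := fun k =>
        (hX.measurable _ (measurableSet_singleton i)).inter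
          (hX.measurable _ (measurableSet_singleton j))
      have hite : ∀ k ω, (if Trans i j (X (grid s t n k) ω) (X (grid s t n (k + 1)) ω) then (1 : ℝ)
          else 0) = (X (grid s t n k) ⁻¹' {i} ∩ X (grid s t n (k + 1)) ⁻¹' {j}).indicator 1 ω := by
        intro k ω
        simp only [Trans, indicator, mem_inter_iff, mem_preimage, mem_singleton_iff, Pi.one_apply]
        simp [hij]
      simp only [hite]
      rw [integral_finsetSum]
      · refine Finset.sum_congr rfl fun k _ => ?_
        rw [integral_indicator_one (hmeas k), measureReal_restrict_apply (hmeas k), inter_comm,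
          inter_assoc]
      · intro k _
        exact (integrable_const (1 : ℝ)).indicator (hmeas k)
    have h2 : ∀ l, ∫ u in Ioc s (grid s t n l), A u j i * P.real (B ∩ X u ⁻¹' {i}) ∂leb =
        ∑ k ∈ Finset.range l, ∫ u in Ioc (grid s t n k) (grid s t n (k + 1)),
          A u j i * P.real (B ∩ X u ⁻¹' {i}) ∂leb := by
      intro l
      induction l with
      | zero => simp [grid_zero]
      | succ l ih =>
        rw [Finset.sum_range_succ, ← ih]
        exact setIntegral_Ioc_add (le_grid s t n l) (grid_mono s t n (Nat.le_succ l))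
          (integrableOn_rate_state hX _ i j i _ _)
    have h3 := h2 n
    rw [grid_last hst hn] at h3
    rw [h1, h3, ← Finset.sum_sub_distrib]
    refine (norm_sum_le _ _).trans ?_
    have hterm : ∀ k ∈ Finset.range n,
        ‖P.real (B ∩ X (grid s t n k) ⁻¹' {i} ∩ X (grid s t n (k + 1)) ⁻¹' {j}) -
          ∫ u in Ioc (grid s t n k) (grid s t n (k + 1)), A u j i * P.real (B ∩ X u ⁻¹' {i}) ∂leb‖
        ≤ (N * m) ^ 2 * ((t - s) / n) ^ 2 := by
      intro k _
      have := real_trans_sub_le hX hm (grid_mono s t n (Nat.le_succ k))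
        ((chainFiltration P X).mono (le_grid s t n k) _ hB) hij
      refine this.trans (le_of_eq ?_)
      rw [grid_succ]
      push_cast [NNReal.coe_sub hst]
      ring
    refine (Finset.sum_le_sum hterm).trans (le_of_eq ?_)
    rw [Finset.sum_const, Finset.card_range, nsmul_eq_mul]
    field_simp
  have hz : Tendsto (fun n : ℕ => (N * m) ^ 2 * ((t : ℝ) - s) ^ 2 * (1 / (n : ℝ))) atTop (𝓝 0) := by
    simpa using (tendsto_const_nhds (x := (N * m) ^ 2 * ((t : ℝ) - s) ^ 2)).mul
      tendsto_one_div_atTop_nhds_zero_nat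
  refine squeeze_zero' (Eventually.of_forall fun n => norm_nonneg _) ?_ hz
  filter_upwards [eventually_ne_atTop 0] with n hn using hbound n hn

end Comp

/-! ### Joint measurability of right-continuous processes -/

section Joint

/-- A right-continuous process stopped at the deterministic time `t` is jointly measurable, with
respect to any σ-algebra for which its values up to time `t` are measurable. -/
lemma measurable_uncurry_min {Ω E : Type*} [MeasurableSpace Ω] [TopologicalSpace E]
    [TopologicalSpace.PseudoMetrizableSpace E] [MeasurableSpace E] [BorelSpace E]
    {Y : ℝ≥0 → Ω → E} {t : ℝ≥0}
    (hY : ∀ ω u, u ≤ t → ContinuousWithinAt (fun v => Y (min v t) ω) (Ici u) u)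
    (hm : ∀ u ≤ t, Measurable (Y u)) : Measurable fun p : Ω × ℝ≥0 => Y (min p.2 t) p.1 := by
  refine measurable_of_tendsto_metrizable
    (f := fun n (p : Ω × ℝ≥0) => Y (min (rightGrid n p.2) t) p.1) (fun n => ?_)
    (tendsto_pi_nhds.2 fun p => ?_)
  · have h1 : Measurable fun p : Ω × ℝ≥0 => (⌊(n + 1 : ℝ≥0) * p.2⌋₊, p.1) :=
      (Nat.measurable_floor.comp (measurable_snd.const_mul _)).prodMk measurable_fst
    have h2 : ∀ g : ℕ → Ω → E, (∀ k, Measurable (g k)) →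
        Measurable fun p : Ω × ℝ≥0 => g ⌊(n + 1 : ℝ≥0) * p.2⌋₊ p.1 := fun g hg =>
      (measurable_from_prod_countable_right (f := fun q : ℕ × Ω => g q.1 q.2) hg).comp h1
    exact h2 (fun k => Y (min (((k : ℝ≥0) + 1) / (n + 1)) t)) fun k => hm _ (min_le_right _ _)
  · rcases le_total p.2 t with h | h
    · exact (hY p.1 p.2 h).tendsto.comp (tendsto_rightGrid p.2)
    · refine tendsto_const_nhds.congr fun n => ?_
      rw [min_eq_right h, min_eq_right (h.trans (lt_rightGrid n p.2).le)]

lemma IsRCLL.min_continuous {E : Type*} [TopologicalSpace E] {x : ℝ≥0 → E}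
    (hx : ∀ t, ContinuousWithinAt x (Ici t) t) (t u : ℝ≥0) :
    ContinuousWithinAt (fun v => x (min v t)) (Ici u) u := by
  refine ContinuousWithinAt.comp (t := Ici (min u t)) (hx _)
    (continuous_id.min continuous_const).continuousWithinAt fun v hv => ?_
  exact min_le_min_right t hv

end Joint

/-! ### Jump measures and their compensators -/

section Meas

open ProbabilityTheory

variable {Ω : Type*} [MeasurableSpace Ω] {P : Measure Ω} {N : ℕ}
  {A : ℝ≥0 → Matrix (Fin N) (Fin N) ℝ} {X : ℝ≥0 → Ω → Fin N}

lemma measurable_state_min (hX : IsMarkovChain P A X) (t : ℝ≥0) :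
    Measurable[(chainFiltration P X t).prod inferInstance]
      fun p : Ω × ℝ≥0 => X (min p.2 t) p.1 :=
  @measurable_uncurry_min Ω (Fin N) (chainFiltration P X t) _ _ _ _ X t
    (fun ω u _ => IsRCLL.min_continuous (hX.rcll ω).1 t u)
    fun _ hu => measurable_state hX.measurable hu

/-- The random measure on `(0, T]` that counts the jumps from `i` to `j ≠ i`. -/
noncomputable def jumpMeas (X : ℝ≥0 → Ω → Fin N) (i j : Fin N) (T : ℝ≥0) (ω : Ω) : Measure ℝ≥0 :=
  ∑ᶠ u ∈ jumpsRel (fun u => X u ω) (Trans i j) ∩ Ioc 0 T, Measure.dirac u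

/-- The compensator of `jumpMeas`: the rate `A^{ji}_u` on the times `u ≤ T` spent in `i ≠ j`. -/
noncomputable def compMeas (A : ℝ≥0 → Matrix (Fin N) (Fin N) ℝ) (X : ℝ≥0 → Ω → Fin N) (i j : Fin N)
    (T : ℝ≥0) (ω : Ω) : Measure ℝ≥0 :=
  (leb.restrict (Ioc 0 T)).withDensity
    fun u => if i ≠ j ∧ X u ω = i then ENNReal.ofReal (A u j i) else 0

lemma jumpMeas_eq (hX : IsMarkovChain P A X) (i j : Fin N) (T : ℝ≥0) (ω : Ω) :
    jumpMeas X i j T ω =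
      ∑ u ∈ (finite_jumpsRel hX (trans_irrefl i j) (zero_le (a := T)) ω).toFinset,
        Measure.dirac u :=
  finsum_mem_eq_finite_toFinset_sum _ _

lemma jumpMeas_apply (hX : IsMarkovChain P A X) (i j : Fin N) (T : ℝ≥0) (ω : Ω) {S : Set ℝ≥0}
    (hS : MeasurableSet S) :
    jumpMeas X i j T ω S = ((jumpsRel (fun u => X u ω) (Trans i j) ∩ Ioc 0 T ∩ S).ncard : ℕ) := by
  classical
  have hf := finite_jumpsRel hX (trans_irrefl i j) (zero_le (a := T)) ω
  rw [jumpMeas_eq hX, Measure.finsetSum_apply]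
  simp only [Measure.dirac_apply' _ hS, indicator_apply, Pi.one_apply]
  rw [Finset.sum_boole, ncard_eq_toFinset_card _ (hf.subset inter_subset_left)]
  congr 2
  ext u
  simp

lemma isFiniteMeasure_compMeas (hX : IsMarkovChain P A X) (i j : Fin N) (T : ℝ≥0) (ω : Ω) :
    IsFiniteMeasure (compMeas A X i j T ω) := by
  obtain ⟨m, hm⟩ := hX.rate.bounded
  refine isFiniteMeasure_withDensity (ne_of_lt ?_)
  refine (lintegral_mono (g := fun _ => ENNReal.ofReal m) fun u => ?_).trans_lt ?_
  · split_ifs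
    · exact ENNReal.ofReal_le_ofReal ((le_abs_self _).trans (hm u j i))
    · exact zero_le
  · rw [lintegral_const, Measure.restrict_apply_univ, leb_Ioc]
    exact ENNReal.mul_lt_top ENNReal.ofReal_lt_top ENNReal.ofReal_lt_top

lemma isFiniteMeasure_jumpMeas (hX : IsMarkovChain P A X) (i j : Fin N) (T : ℝ≥0) (ω : Ω) :
    IsFiniteMeasure (jumpMeas X i j T ω) :=
  ⟨by rw [jumpMeas_apply hX i j T ω MeasurableSet.univ]; exact ENNReal.natCast_lt_top _⟩

lemma measurable_jumpMeas (hX : IsMarkovChain P A X) (i j : Fin N) (T : ℝ≥0) :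
    Measurable[chainFiltration P X T] (jumpMeas X i j T) := by
  have h0 : ∀ ω, IsFiniteMeasure (jumpMeas X i j T ω) := isFiniteMeasure_jumpMeas hX i j T
  have hcount : ∀ t ≤ T, Measurable[chainFiltration P X T]
      fun ω => ((jumpCount X (Trans i j) 0 t ω : ℕ) : ℝ≥0∞) := fun t ht =>
    measurable_from_top.comp ((measurable_jumpCount hX (Trans i j) (trans_irrefl i j)
      (zero_le (a := t))).mono ((chainFiltration P X).mono ht) le_rfl)
  refine @Measurable.measure_of_isPiSystem Ω ℝ≥0 (chainFiltration P X T) _ _ h0 (range Iic)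
    ((BorelSpace.measurable_eq (α := ℝ≥0)).trans (borel_eq_generateFrom_Iic _)) isPiSystem_Iic ?_ ?_
  · rintro _ ⟨a, rfl⟩
    convert hcount (min T a) (min_le_left _ _) using 2 with ω
    rw [jumpMeas_apply hX i j T ω measurableSet_Iic, jumpCount, inter_assoc, Ioc_inter_Iic]
  · convert hcount T le_rfl using 2 with ω
    rw [jumpMeas_apply hX i j T ω MeasurableSet.univ, jumpCount, inter_univ]

lemma measurable_density (hX : IsMarkovChain P A X) (i j : Fin N) (T : ℝ≥0) :
    Measurable fun p : Ω × ℝ≥0 =>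
      if i ≠ j ∧ X (min p.2 T) p.1 = i then ENNReal.ofReal (A p.2 j i) else 0 := by
  have h1 : Measurable fun p : Ω × ℝ≥0 => X (min p.2 T) p.1 :=
    (measurable_state_min hX T).mono (sup_le_sup (MeasurableSpace.comap_mono
      ((chainFiltration P X).le T)) le_rfl) le_rfl
  refine Measurable.ite ?_ ((hX.rate.measurable j i).comp measurable_snd).ennreal_ofReal
    measurable_const
  exact (MeasurableSet.const _).inter (h1 (measurableSet_singleton i))

lemma compMeas_apply (i j : Fin N) (T : ℝ≥0) (ω : Ω) {S : Set ℝ≥0}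
    (hS : MeasurableSet S) :
    compMeas A X i j T ω S = ∫⁻ u in Ioc 0 T ∩ S,
      (if i ≠ j ∧ X (min u T) ω = i then ENNReal.ofReal (A u j i) else 0) ∂leb := by
  rw [compMeas, withDensity_apply _ hS, Measure.restrict_restrict hS, inter_comm]
  refine setLIntegral_congr_fun (measurableSet_Ioc.inter hS) fun u hu => ?_
  rw [min_eq_left hu.1.2]

lemma measurable_compMeas (hX : IsMarkovChain P A X) (i j : Fin N) (T : ℝ≥0) :
    Measurable (compMeas A X i j T) := by
  refine Measure.measurable_of_measurable_coe _ fun S hS => ?_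
  simp only [compMeas_apply i j T _ hS]
  exact (measurable_density hX i j T).lintegral_prod_right'

/-- `jumpMeas` as a kernel. -/
noncomputable def jumpKer (hX : IsMarkovChain P A X) (i j : Fin N) (T : ℝ≥0) : Kernel Ω ℝ≥0 :=
  ⟨jumpMeas X i j T, (measurable_jumpMeas hX i j T).mono ((chainFiltration P X).le T) le_rfl⟩

/-- `compMeas` as a kernel. -/
noncomputable def compKer (hX : IsMarkovChain P A X) (i j : Fin N) (T : ℝ≥0) : Kernel Ω ℝ≥0 :=
  ⟨compMeas A X i j T, measurable_compMeas hX i j T⟩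

instance (hX : IsMarkovChain P A X) (i j : Fin N) (T : ℝ≥0) : IsSFiniteKernel (jumpKer hX i j T) :=
  have : ∀ ω, IsFiniteMeasure (jumpKer hX i j T ω) := isFiniteMeasure_jumpMeas hX i j T
  isSFiniteKernel_of_isFiniteMeasure _

instance (hX : IsMarkovChain P A X) (i j : Fin N) (T : ℝ≥0) : IsSFiniteKernel (compKer hX i j T) :=
  have : ∀ ω, IsFiniteMeasure (compKer hX i j T ω) := isFiniteMeasure_compMeas hX i j T
  isSFiniteKernel_of_isFiniteMeasure _

lemma predictable_le (F : Filtration ℝ≥0 ‹MeasurableSpace Ω›) :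
    F.predictable ≤ (inferInstance : MeasurableSpace (ℝ≥0 × Ω)) :=
  measurableSpace_le_predictable_of_measurableSet
    (fun _ hA => (measurableSet_singleton _).prod (F.le _ _ hA))
    (fun _ _ hA => measurableSet_Ioi.prod (F.le _ _ hA))

variable [IsProbabilityMeasure P]

/-- The expectation of the jump measure, on a generator of the predictable σ-algebra. -/
lemma lintegral_jumpMeas_Ioi (hX : IsMarkovChain P A X) (i j : Fin N) (s T : ℝ≥0) {B : Set Ω}
    (hB : MeasurableSet[chainFiltration P X s] B) :
    ∫⁻ ω in B, jumpMeas X i j T ω (Ioi s) ∂P = ∫⁻ ω in B, compMeas A X i j T ω (Ioi s) ∂P := by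
  have hBm : MeasurableSet B := (chainFiltration P X).le s _ hB
  have hI : ∀ ω, jumpMeas X i j T ω (Ioi s) =
      ((jumpsRel (fun u => X u ω) (Trans i j) ∩ Ioc s T).ncard : ℕ) := by
    intro ω
    rw [jumpMeas_apply hX i j T ω measurableSet_Ioi, inter_assoc, Ioc_inter_Ioi,
      max_eq_right zero_le]
  have hI' : Ioc 0 T ∩ Ioi s = Ioc s T := by rw [Ioc_inter_Ioi, max_eq_right zero_le]
  simp only [hI, compMeas_apply i j T _ measurableSet_Ioi, hI']
  rcases le_total T s with hTs | hsT
  · simp [Ioc_eq_empty_of_le hTs]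
  by_cases hij : i = j
  · simp [hij, Trans, jumpsRel]
  have h1 : ∫⁻ ω in B, ((jumpsRel (fun u => X u ω) (Trans i j) ∩ Ioc s T).ncard : ℝ≥0∞) ∂P =
      ENNReal.ofReal (∫ ω in B, (jumpCount X (Trans i j) s T ω : ℝ) ∂P) := by
    rw [ofReal_integral_eq_lintegral_ofReal
      (integrable_jumpCount hX _ (trans_irrefl i j) hsT).integrableOn
      (Eventually.of_forall fun ω => Nat.cast_nonneg _)]
    simp [jumpCount]
  rw [h1, setIntegral_jumpCount hX hij hsT hB, ofReal_integral_eq_lintegral_ofReal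
    (integrableOn_rate_state hX B i j i s T)
    (Eventually.of_forall fun u => mul_nonneg (hX.rate.nonneg u i j (Ne.symm hij))
      measureReal_nonneg),
    lintegral_lintegral_swap (measurable_density hX i j T).aemeasurable]
  refine setLIntegral_congr_fun measurableSet_Ioc fun u hu => ?_
  rw [ENNReal.ofReal_mul (hX.rate.nonneg u i j (Ne.symm hij)), measureReal_def,
    ENNReal.ofReal_toReal (measure_ne_top _ _), min_eq_left hu.2]
  have : ∀ ω, (if i ≠ j ∧ X u ω = i then ENNReal.ofReal (A u j i) else 0) =
      (X u ⁻¹' {i}).indicator (fun _ => ENNReal.ofReal (A u j i)) ω := by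
    intro ω
    by_cases h : X u ω = i <;> simp [h, hij]
  have hm : MeasurableSet (X u ⁻¹' {i}) := hX.measurable u (measurableSet_singleton i)
  simp only [this]
  rw [lintegral_indicator_const hm, Measure.restrict_apply hm, inter_comm]

/-- On predictable sets, the jump measure and its compensator have the same expectation. -/
theorem trim_jumpKer (hX : IsMarkovChain P A X) (i j : Fin N) (T : ℝ≥0) :
    ((P ⊗ₘ jumpKer hX i j T).map Prod.swap).trim (predictable_le (chainFiltration P X)) =
      ((P ⊗ₘ compKer hX i j T).map Prod.swap).trim (predictable_le (chainFiltration P X)) := by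
  set F := chainFiltration P X with hF
  have hprod : ∀ (κ : Kernel Ω ℝ≥0) [IsSFiniteKernel κ] {S : Set ℝ≥0} {B : Set Ω},
      MeasurableSet[F.predictable] (S ×ˢ B) → MeasurableSet S → MeasurableSet B →
      ((P ⊗ₘ κ).map Prod.swap).trim (predictable_le F) (S ×ˢ B) = ∫⁻ ω in B, κ ω S ∂P := by
    intro κ _ S B h hS hB
    rw [trim_measurableSet_eq _ h, Measure.map_apply measurable_swap (hS.prod hB), preimage_swap_prod,
      Measure.compProd_apply_prod hB hS]
  -- the predictable σ-algebra is generated by the π-system of all `{0} × B` with `B ∈ F 0` and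
  -- `(s, ∞) × B` with `B ∈ F s`
  have hsing : ∀ {B : Set Ω}, MeasurableSet[F 0] B →
      ((P ⊗ₘ jumpKer hX i j T).map Prod.swap).trim (predictable_le F) ({0} ×ˢ B) = 0 ∧
      ((P ⊗ₘ compKer hX i j T).map Prod.swap).trim (predictable_le F) ({0} ×ˢ B) = 0 := by
    intro B hB
    have h : MeasurableSet[F.predictable] (({0} : Set ℝ≥0) ×ˢ B) :=
      measurableSet_predictable_singleton_bot_prod (𝓕 := F) hB
    have hBm := F.le _ _ hB
    have he : Ioc 0 T ∩ {(0 : ℝ≥0)} = ∅ := by ext; simp +contextual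
    rw [hprod _ h (measurableSet_singleton _) hBm, hprod _ h (measurableSet_singleton _) hBm]
    constructor
    · refine (lintegral_congr fun ω => ?_).trans lintegral_zero
      refine (jumpMeas_apply hX i j T ω (measurableSet_singleton _)).trans ?_
      rw [inter_assoc, he]; simp
    · refine (lintegral_congr fun ω => ?_).trans lintegral_zero
      refine (compMeas_apply i j T ω (measurableSet_singleton _)).trans ?_
      rw [he]; simp
  have hIoi : ∀ {s} {B : Set Ω}, MeasurableSet[F s] B →
      ((P ⊗ₘ jumpKer hX i j T).map Prod.swap).trim (predictable_le F) (Ioi s ×ˢ B) =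
      ((P ⊗ₘ compKer hX i j T).map Prod.swap).trim (predictable_le F) (Ioi s ×ˢ B) := by
    intro s B hB
    have h := measurableSet_predictable_Ioi_prod (𝓕 := F) hB
    have hBm := F.le _ _ hB
    rw [hprod _ h measurableSet_Ioi hBm, hprod _ h measurableSet_Ioi hBm]
    exact lintegral_jumpMeas_Ioi hX i j s T hB
  have huniv : (univ : Set (ℝ≥0 × Ω)) = {0} ×ˢ univ ∪ Ioi 0 ×ˢ univ := by
    ext p; simp [pos_iff_ne_zero, em]
  have hdisj : Disjoint (({0} : Set ℝ≥0) ×ˢ (univ : Set Ω)) (Ioi 0 ×ˢ univ) := by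
    rw [Set.disjoint_left]; rintro ⟨a, b⟩ ⟨h1, _⟩ ⟨h2, _⟩
    exact (ne_of_gt h2) h1
  have h0 : MeasurableSet[F.predictable] (({0} : Set ℝ≥0) ×ˢ (univ : Set Ω)) :=
    measurableSet_predictable_singleton_bot_prod (𝓕 := F) MeasurableSet.univ
  have h1 : MeasurableSet[F.predictable] ((Ioi (0 : ℝ≥0)) ×ˢ (univ : Set Ω)) :=
    measurableSet_predictable_Ioi_prod (𝓕 := F) MeasurableSet.univ
  have hu : ((P ⊗ₘ jumpKer hX i j T).map Prod.swap).trim (predictable_le F) univ =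
      ((P ⊗ₘ compKer hX i j T).map Prod.swap).trim (predictable_le F) univ := by
    rw [huniv, @measure_union _ F.predictable _ _ _ hdisj h1,
      @measure_union _ F.predictable _ _ _ hdisj h1, (hsing MeasurableSet.univ).1,
      (hsing MeasurableSet.univ).2, hIoi MeasurableSet.univ]
  have hfin : @IsFiniteMeasure _ F.predictable
      (((P ⊗ₘ jumpKer hX i j T).map Prod.swap).trim (predictable_le F)) := by
    refine @IsFiniteMeasure.mk _ F.predictable _ ?_
    rw [huniv, @measure_union _ F.predictable _ _ _ hdisj h1, (hsing MeasurableSet.univ).1, zero_add,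
      hprod _ h1 measurableSet_Ioi MeasurableSet.univ]
    have : ∀ ω, jumpKer hX i j T ω (Ioi 0) = ENNReal.ofReal (jumpCount X (Trans i j) 0 T ω) := by
      intro ω
      rw [ENNReal.ofReal_natCast]
      refine (jumpMeas_apply hX i j T ω measurableSet_Ioi).trans ?_
      rw [inter_assoc, Ioc_inter_Ioi, max_self, jumpCount]
    simp only [this, Measure.restrict_univ]
    rw [← ofReal_integral_eq_lintegral_ofReal (integrable_jumpCount hX _ (trans_irrefl i j) zero_le)
      (Eventually.of_forall fun ω => Nat.cast_nonneg _)]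
    exact ENNReal.ofReal_lt_top
  refine @ext_of_generate_finite _ F.predictable _ _ _ rfl ?_ hfin ?_ hu
  · rintro _ (⟨B, hB, rfl⟩ | ⟨s, B, hB, rfl⟩) _ (⟨B', hB', rfl⟩ | ⟨s', B', hB', rfl⟩) hne
    · exact Or.inl ⟨B ∩ B', hB.inter hB', by rw [prod_inter_prod, inter_self]⟩
    · obtain ⟨p, ⟨h1, _⟩, h2, _⟩ := hne
      exact absurd (h1 ▸ h2 : (⊥ : ℝ≥0) ∈ Ioi s') (by simp)
    · obtain ⟨p, ⟨h1, _⟩, h2, _⟩ := hne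
      exact absurd (h2 ▸ h1 : (⊥ : ℝ≥0) ∈ Ioi s) (by simp)
    · refine Or.inr ⟨max s s', B ∩ B', ?_, by rw [prod_inter_prod, Ioi_inter_Ioi]⟩
      exact (F.mono (le_max_left _ _) _ hB).inter (F.mono (le_max_right _ _) _ hB')
  · rintro _ (⟨B, hB, rfl⟩ | ⟨s, B, hB, rfl⟩)
    · exact (hsing hB).1.trans (hsing hB).2.symm
    · exact hIoi hB

end Meas

/-! ### Integrals with respect to the compensated jumps -/

section Mart

open ProbabilityTheory

variable {Ω : Type*} [MeasurableSpace Ω] {P : Measure Ω} {N : ℕ}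
  {A : ℝ≥0 → Matrix (Fin N) (Fin N) ℝ} {X : ℝ≥0 → Ω → Fin N}

/-- The integral against `dX`, sorted by the type of the jumps. -/
lemma intX_eq_sum (hX : IsMarkovChain P A X) {T : ℝ≥0} {ω : Ω} {φ : ℝ≥0 → Ω → Fin N → ℝ}
    {ψ : Fin N → Fin N → ℝ≥0 → ℝ}
    (h : ∀ u ∈ Ioc 0 T, ∀ i j, Function.leftLim (fun u => X u ω) u = i →
      φ u ω j - φ u ω i = ψ i j u) :
    intX X φ T ω = ∑ i, ∑ j, ∫ u, ψ i j u ∂(jumpMeas X i j T ω) := by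
  classical
  have hf := (hX.rcll ω).finite_jumps_Ioc (zero_le (a := T))
  have h1 : intX X φ T ω = ∑ u ∈ hf.toFinset,
      ψ (Function.leftLim (fun u => X u ω) u) (X u ω) u := by
    rw [intX, ← finsum_mem_inter_support, finsum_mem_eq_sum_of_inter_support_eq (t := hf.toFinset)]
    · refine Finset.sum_congr rfl fun u hu => ?_
      rw [dotProduct_jump]
      exact h u (hf.mem_toFinset.1 hu).2 _ _ rfl
    · ext u
      simp only [Finite.coe_toFinset, mem_inter_iff]
      exact ⟨fun hu => ⟨⟨support_jump_subset φ hu.2, hu.1.1⟩, hu.2⟩, fun hu => ⟨⟨hu.1.2, hu.2⟩, hu.2⟩⟩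
  have h2 : ∀ i j, ∫ u, ψ i j u ∂(jumpMeas X i j T ω) = ∑ u ∈ hf.toFinset,
      if Function.leftLim (fun u => X u ω) u = i then if X u ω = j then ψ i j u else 0 else 0 := by
    intro i j
    rw [jumpMeas_eq hX, integral_finsetSum_measure fun u _ => integrable_dirac (by simp)]
    simp only [integral_dirac]
    simp only [← ite_and]
    rw [← Finset.sum_filter]
    refine Finset.sum_congr ?_ fun _ _ => rfl
    ext u
    simp only [Finite.mem_toFinset, Finset.mem_filter, mem_inter_iff, jumpsRel, jumps, Trans,
      mem_ofPred_eq]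
    constructor
    · rintro ⟨⟨h1, h2, h3⟩, h4⟩
      exact ⟨⟨by rw [h2, h3]; exact h1, h4⟩, h2, h3⟩
    · rintro ⟨⟨h1, h4⟩, h2, h3⟩
      exact ⟨⟨by rw [h2, h3] at h1; exact h1, h2, h3⟩, h4⟩
  simp only [h1, h2]
  rw [Finset.sum_congr rfl fun i _ => Finset.sum_comm, Finset.sum_comm]
  refine Finset.sum_congr rfl fun u _ => ?_
  simp

lemma integrable_compMeas_iff (hX : IsMarkovChain P A X) (i j : Fin N) (T : ℝ≥0) (ω : Ω)
    (f : ℝ≥0 → ℝ) : Integrable f (compMeas A X i j T ω) ↔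
      IntegrableOn (fun u => (if i ≠ j ∧ X u ω = i then A u j i else 0) * f u) (Ioc 0 T) leb ∧
      ∫ u, f u ∂(compMeas A X i j T ω) =
        ∫ u in Ioc 0 T, (if i ≠ j ∧ X u ω = i then A u j i else 0) * f u ∂leb := by
  have hm : Measurable fun u => if i ≠ j ∧ X u ω = i then ENNReal.ofReal (A u j i) else 0 := by
    refine Measurable.ite ?_ (hX.rate.measurable j i).ennreal_ofReal measurable_const
    exact (MeasurableSet.const _).inter ((hX.rcll ω).measurable_fin (measurableSet_singleton i))
  have hlt : ∀ u, (if i ≠ j ∧ X u ω = i then ENNReal.ofReal (A u j i) else 0) < ∞ := by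
    intro u
    split_ifs <;> simp
  have he : ∀ u, (if i ≠ j ∧ X u ω = i then ENNReal.ofReal (A u j i) else 0).toReal =
      if i ≠ j ∧ X u ω = i then A u j i else 0 := by
    intro u
    split_ifs with h
    · exact ENNReal.toReal_ofReal (hX.rate.nonneg u i j h.1.symm)
    · rfl
  rw [compMeas, integrable_withDensity_iff_integrable_smul' hm (Eventually.of_forall hlt),
    integral_withDensity_eq_integral_toReal_smul hm (Eventually.of_forall hlt)]
  simp only [he, smul_eq_mul, and_true, IntegrableOn]

lemma ae_leftLim_eq (hX : IsMarkovChain P A X) (T : ℝ≥0) (ω : Ω) :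
    ∀ᵐ u ∂(leb.restrict (Ioc 0 T)), Function.leftLim (fun u => X u ω) u = X u ω := by
  rw [ae_restrict_iff' measurableSet_Ioc]
  have h := ((hX.rcll ω).finite_jumps_Ioc (zero_le (a := T))).measure_zero leb
  filter_upwards [measure_eq_zero_iff_ae_notMem.1 h] with u hu hu'
  by_contra hne
  exact hu ⟨hne, hu'⟩

lemma ae_comp_eq_sum (hX : IsMarkovChain P A X) {T : ℝ≥0} {ω : Ω}
    {φ : ℝ≥0 → Ω → Fin N → ℝ} {ψ : Fin N → Fin N → ℝ≥0 → ℝ}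
    (h : ∀ u ∈ Ioc 0 T, ∀ i j, Function.leftLim (fun u => X u ω) u = i →
      φ u ω j - φ u ω i = ψ i j u) :
    (fun u => ∑ i, ∑ j, (if i ≠ j ∧ X u ω = i then A u j i else 0) * ψ i j u)
      =ᵐ[leb.restrict (Ioc 0 T)] fun u => φ u ω ⬝ᵥ (A u *ᵥ vec X u ω) := by
  filter_upwards [ae_leftLim_eq hX T ω, ae_restrict_mem measurableSet_Ioc] with u hu hu'
  refine Eq.trans ?_ (dotProduct_mulVec_vec X hX.rate (φ u ω) u ω).symm
  rw [comp1, Finset.sum_eq_single (X u ω)]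
  · refine Finset.sum_congr rfl fun j _ => ?_
    rw [← h u hu' _ j hu]
    by_cases hj : X u ω = j
    · simp [hj]
    · simp [hj]
  · intro i _ hi
    refine Finset.sum_eq_zero fun j _ => ?_
    rw [if_neg fun h => hi h.2.symm, zero_mul]
  · simp

/-- The compensator of the integral, sorted by the type of the jumps. -/
lemma integral_comp_eq_sum (hX : IsMarkovChain P A X) {T : ℝ≥0} {ω : Ω}
    {φ : ℝ≥0 → Ω → Fin N → ℝ} {ψ : Fin N → Fin N → ℝ≥0 → ℝ}
    (h : ∀ u ∈ Ioc 0 T, ∀ i j, Function.leftLim (fun u => X u ω) u = i →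
      φ u ω j - φ u ω i = ψ i j u)
    (hint : ∀ i j, Integrable (ψ i j) (compMeas A X i j T ω)) :
    IntegrableOn (fun u => φ u ω ⬝ᵥ (A u *ᵥ vec X u ω)) (Ioc 0 T) leb ∧
    ∫ u in Ioc 0 T, φ u ω ⬝ᵥ (A u *ᵥ vec X u ω) ∂leb =
      ∑ i, ∑ j, ∫ u, ψ i j u ∂(compMeas A X i j T ω) := by
  have h1 : ∀ i j, ∫ u, ψ i j u ∂(compMeas A X i j T ω) =
      ∫ u in Ioc 0 T, (if i ≠ j ∧ X u ω = i then A u j i else 0) * ψ i j u ∂leb := fun i j =>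
    ((integrable_compMeas_iff hX i j T ω (ψ i j)).1 (hint i j)).2
  have h2 : ∀ i j, IntegrableOn
      (fun u => (if i ≠ j ∧ X u ω = i then A u j i else 0) * ψ i j u) (Ioc 0 T) leb := fun i j =>
    ((integrable_compMeas_iff hX i j T ω (ψ i j)).1 (hint i j)).1
  refine ⟨(integrable_finsetSum _ fun i _ => integrable_finsetSum _ fun j _ => h2 i j).congr
    (ae_comp_eq_sum hX h), ?_⟩
  simp only [h1]
  rw [Finset.sum_congr rfl fun i _ => (integral_finsetSum _ fun j _ => h2 i j).symm,
    ← integral_finsetSum _ fun i _ => integrable_finsetSum _ fun j _ => h2 i j]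
  exact integral_congr_ae (ae_comp_eq_sum hX h).symm

variable [IsProbabilityMeasure P]

lemma integrable_integral_compProd {κ : Kernel Ω ℝ≥0} [IsSFiniteKernel κ] {f : Ω × ℝ≥0 → ℝ}
    (hf : Integrable f (P ⊗ₘ κ)) : Integrable (fun ω => ∫ u, f (ω, u) ∂(κ ω)) P :=
  Integrable.integral_compProd (κ := Kernel.const Unit P) (η := Kernel.prodMkLeft Unit κ)
    (a := ()) hf

/-- A predictable function is integrable against the jumps as soon as it is integrable against
their compensator, and the two integrals have the same expectation. -/
lemma integral_jumpKer (hX : IsMarkovChain P A X) (i j : Fin N) (T : ℝ≥0) {ψ : ℝ≥0 × Ω → ℝ}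
    (hψ : StronglyMeasurable[(chainFiltration P X).predictable] ψ)
    (hint : Integrable (fun p => ψ p.swap) (P ⊗ₘ compKer hX i j T)) :
    Integrable (fun p => ψ p.swap) (P ⊗ₘ jumpKer hX i j T) ∧
      ∫ p, ψ p.swap ∂(P ⊗ₘ jumpKer hX i j T) = ∫ p, ψ p.swap ∂(P ⊗ₘ compKer hX i j T) := by
  have hle := predictable_le (chainFiltration P X)
  have hm : ∀ μ : Measure (ℝ≥0 × Ω), AEStronglyMeasurable ψ μ := fun μ =>
    (hψ.mono hle).aestronglyMeasurable
  have hint' : Integrable ψ ((P ⊗ₘ compKer hX i j T).map Prod.swap) :=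
    (integrable_map_measure (hm _) measurable_swap.aemeasurable).2 hint
  have hint2 : Integrable ψ ((P ⊗ₘ jumpKer hX i j T).map Prod.swap) := by
    refine integrable_of_integrable_trim hle ?_
    rw [trim_jumpKer]
    exact hint'.trim hle hψ
  refine ⟨(integrable_map_measure (hm _) measurable_swap.aemeasurable).1 hint2, ?_⟩
  rw [← integral_map measurable_swap.aemeasurable (hm _),
    ← integral_map measurable_swap.aemeasurable (hm _), integral_trim hle hψ, trim_jumpKer,
    ← integral_trim hle hψ]

lemma ae_integrableOn_comp (hX : IsMarkovChain P A X) {T : ℝ≥0} {φ : ℝ≥0 → Ω → Fin N → ℝ}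
    {ψ : Fin N → Fin N → ℝ≥0 × Ω → ℝ}
    (h : ∀ ω, ∀ u ∈ Ioc 0 T, ∀ i j, Function.leftLim (fun u => X u ω) u = i →
      φ u ω j - φ u ω i = ψ i j (u, ω))
    (hint : ∀ i j, Integrable (fun p => ψ i j p.swap) (P ⊗ₘ compKer hX i j T)) :
    ∀ᵐ ω ∂P, (∀ i j, Integrable (fun u => ψ i j (u, ω)) (compMeas A X i j T ω)) ∧
      IntegrableOn (fun u => φ u ω ⬝ᵥ (A u *ᵥ vec X u ω)) (Ioc 0 T) leb := by
  have hsec : ∀ᵐ ω ∂P, ∀ i j, Integrable (fun u => ψ i j (u, ω)) (compMeas A X i j T ω) := by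
    rw [ae_all_iff]; intro i
    rw [ae_all_iff]; intro j
    exact ((Measure.integrable_compProd_iff (hint i j).aestronglyMeasurable).1 (hint i j)).1
  filter_upwards [hsec] with ω hω using ⟨hω, (integral_comp_eq_sum hX (h ω) hω).1⟩

/-- The integral of a predictable process against the compensated jumps has expectation zero. -/
theorem integral_intM (hX : IsMarkovChain P A X) {T : ℝ≥0} {φ : ℝ≥0 → Ω → Fin N → ℝ}
    {ψ : Fin N → Fin N → ℝ≥0 × Ω → ℝ}
    (hψ : ∀ i j, StronglyMeasurable[(chainFiltration P X).predictable] (ψ i j))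
    (h : ∀ ω, ∀ u ∈ Ioc 0 T, ∀ i j, Function.leftLim (fun u => X u ω) u = i →
      φ u ω j - φ u ω i = ψ i j (u, ω))
    (hint : ∀ i j, Integrable (fun p => ψ i j p.swap) (P ⊗ₘ compKer hX i j T)) :
    Integrable (intM A X φ T) P ∧ ∫ ω, intM A X φ T ω ∂P = 0 := by
  have hJ := fun i j => integral_jumpKer hX i j T (hψ i j) (hint i j)
  have heq : intM A X φ T =ᵐ[P] fun ω => ∑ i, ∑ j,
      ((∫ u, ψ i j (u, ω) ∂(jumpKer hX i j T ω)) - ∫ u, ψ i j (u, ω) ∂(compKer hX i j T ω)) := by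
    filter_upwards [ae_integrableOn_comp hX h hint] with ω ⟨hω, _⟩
    rw [intM, intX_eq_sum hX (h ω), (integral_comp_eq_sum hX (h ω) hω).2]
    simp only [Finset.sum_sub_distrib]
    rfl
  have i1 : ∀ i j, Integrable (fun ω => ∫ u, ψ i j (u, ω) ∂(jumpKer hX i j T ω)) P := fun i j =>
    integrable_integral_compProd (hJ i j).1
  have i2 : ∀ i j, Integrable (fun ω => ∫ u, ψ i j (u, ω) ∂(compKer hX i j T ω)) P := fun i j =>
    integrable_integral_compProd (hint i j)
  have i3 : ∀ i j, Integrable (fun ω => (∫ u, ψ i j (u, ω) ∂(jumpKer hX i j T ω)) -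
      ∫ u, ψ i j (u, ω) ∂(compKer hX i j T ω)) P := fun i j => (i1 i j).sub (i2 i j)
  refine ⟨(integrable_finsetSum _ fun i _ => integrable_finsetSum _ fun j _ =>
    i3 i j).congr heq.symm, ?_⟩
  rw [integral_congr_ae heq, integral_finsetSum _ fun i _ => integrable_finsetSum _ fun j _ =>
    i3 i j]
  refine Finset.sum_eq_zero fun i _ => ?_
  rw [integral_finsetSum _ fun j _ => i3 i j]
  refine Finset.sum_eq_zero fun j _ => ?_
  rw [integral_sub (i1 i j) (i2 i j), sub_eq_zero]
  have e1 := Measure.integral_compProd (hJ i j).1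
  have e2 := Measure.integral_compProd (hint i j)
  exact e1.symm.trans ((hJ i j).2.trans e2)

end Mart

/-! ### Left limits are predictable -/

section Predictable

variable {Ω : Type*} [MeasurableSpace Ω]

/-- The last point of the grid `ℕ / (n + 1)` that lies strictly to the left of `u > 0`. -/
noncomputable def leftGrid (n : ℕ) (u : ℝ≥0) : ℝ≥0 := ((⌈(n + 1 : ℝ≥0) * u⌉₊ - 1 : ℕ) : ℝ≥0) / (n + 1)

lemma leftGrid_lt (n : ℕ) {u : ℝ≥0} (hu : 0 < u) : leftGrid n u < u := by
  have h0 : (0 : ℝ≥0) < n + 1 := by positivity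
  rw [leftGrid, div_lt_iff₀ h0, mul_comm u]
  have h1 : 0 < ⌈(n + 1 : ℝ≥0) * u⌉₊ := Nat.ceil_pos.2 (mul_pos h0 hu)
  exact Nat.lt_ceil.1 (Nat.sub_lt h1 one_pos)

lemma le_leftGrid_add (n : ℕ) (u : ℝ≥0) : u ≤ leftGrid n u + 1 / (n + 1) := by
  have h0 : (0 : ℝ≥0) < n + 1 := by positivity
  rw [leftGrid, ← add_div, le_div_iff₀ h0, mul_comm]
  refine (Nat.le_ceil _).trans ?_
  exact_mod_cast (by omega : ⌈(n + 1 : ℝ≥0) * u⌉₊ ≤ ⌈(n + 1 : ℝ≥0) * u⌉₊ - 1 + 1)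

lemma tendsto_leftGrid {u : ℝ≥0} (hu : 0 < u) : Tendsto (fun n => leftGrid n u) atTop (𝓝[<] u) := by
  refine tendsto_nhdsWithin_iff.2 ⟨?_, Eventually.of_forall fun n => leftGrid_lt n hu⟩
  rw [← NNReal.tendsto_coe]
  have h1 : Tendsto (fun n : ℕ => (u : ℝ) - 1 / ((n : ℝ) + 1)) atTop (𝓝 u) := by
    simpa using tendsto_const_nhds.sub (tendsto_one_div_add_atTop_nhds_zero_nat (𝕜 := ℝ))
  refine tendsto_of_tendsto_of_tendsto_of_le_of_le h1 tendsto_const_nhds (fun n => ?_)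
    (fun n => by exact_mod_cast (leftGrid_lt n hu).le)
  have := le_leftGrid_add n u
  rw [← NNReal.coe_le_coe] at this
  push_cast at this
  simp only
  linarith

lemma measurable_fst_predictable (F : Filtration ℝ≥0 ‹MeasurableSpace Ω›) :
    Measurable[F.predictable] (Prod.fst : ℝ≥0 × Ω → ℝ≥0) := by
  rw [BorelSpace.measurable_eq (α := ℝ≥0), borel_eq_generateFrom_Ioi]
  refine @measurable_generateFrom _ _ F.predictable _ _ ?_
  rintro _ ⟨a, rfl⟩
  convert measurableSet_predictable_Ioi_prod (𝓕 := F) (i := a) MeasurableSet.univ using 1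
  ext; simp

/-- If `Y` is adapted up to time `T`, then its left limit is predictable on `(0, T]`: it is the
limit of the values of `Y` at the last grid points before the current time. -/
theorem stronglyMeasurable_leftLim {F : Filtration ℝ≥0 ‹MeasurableSpace Ω›} {T : ℝ≥0}
    {Y Yl : ℝ≥0 → Ω → ℝ} (hY : ∀ t < T, Measurable[F t] (Y t))
    (hl : ∀ ω, ∀ u ∈ Ioc 0 T, Tendsto (fun v => Y v ω) (𝓝[<] u) (𝓝 (Yl u ω))) :
    StronglyMeasurable[F.predictable]
      ((Ioc 0 T ×ˢ univ).indicator (Function.uncurry Yl)) := by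
  have hfst := measurable_fst_predictable F
  have hIoc : MeasurableSet[F.predictable] (Ioc 0 T ×ˢ (univ : Set Ω)) :=
    measurableSet_predictable_Ioc_prod _ _ MeasurableSet.univ
  have hg : ∀ s, s < T → Measurable[F.predictable]
      ((Ioc s T ×ˢ (univ : Set Ω)).indicator fun p => Y s p.2) := by
    intro s hs S hS
    rw [indicator_preimage, Set.ite]
    refine MeasurableSet.union ?_ ?_
    · convert measurableSet_predictable_Ioc_prod (𝓕 := F) s T (hY s hs hS) using 1
      ext; simp [and_comm]
    · refine MeasurableSet.diff ?_ (measurableSet_predictable_Ioc_prod _ _ MeasurableSet.univ)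
      by_cases h : (0 : ℝ) ∈ S
      · convert MeasurableSet.univ using 1
        ext; simp [h]
      · convert MeasurableSet.empty using 1
        ext; simp [h]
  refine Measurable.stronglyMeasurable ?_
  refine @measurable_of_tendsto_metrizable _ _ F.predictable _ _ _ _
    (fun n p => (Ioc 0 T ×ˢ (univ : Set Ω)).indicator (fun p => Y (leftGrid n p.1) p.2) p) _
    (fun n => ?_) (tendsto_pi_nhds.2 fun p => ?_)
  · have hk : Measurable[F.predictable] fun p : ℝ≥0 × Ω => (⌈(n + 1 : ℝ≥0) * p.1⌉₊ - 1 : ℕ) :=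
      (measurable_from_top (f := fun k : ℕ => k - 1)).comp
        (Nat.measurable_ceil.comp (hfst.const_mul _))
    have h2 : ∀ g : ℕ → ℝ≥0 × Ω → ℝ, (∀ k, Measurable[F.predictable] (g k)) →
        Measurable[F.predictable] fun p : ℝ≥0 × Ω => g (⌈(n + 1 : ℝ≥0) * p.1⌉₊ - 1) p := by
      intro g hgm
      let : MeasurableSpace (ℝ≥0 × Ω) := F.predictable
      exact (measurable_from_prod_countable_right (f := fun q : ℕ × (ℝ≥0 × Ω) => g q.1 q.2)
        hgm).comp (hk.prodMk measurable_id)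
    have h3 := h2 (fun k => if (k : ℝ≥0) / (n + 1) < T then
        (Ioc ((k : ℝ≥0) / (n + 1)) T ×ˢ (univ : Set Ω)).indicator fun p => Y ((k : ℝ≥0) / (n + 1)) p.2
        else 0) fun k => by
      split_ifs with h
      · exact hg _ h
      · exact @measurable_const _ _ _ F.predictable _
    convert h3 using 1
    ext p
    change _ = (if leftGrid n p.1 < T then
        (Ioc (leftGrid n p.1) T ×ˢ (univ : Set Ω)).indicator fun p' => Y (leftGrid n p.1) p'.2
        else 0) p
    by_cases hp : p.1 ∈ Ioc 0 T
    · have h4 := leftGrid_lt n hp.1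
      rw [if_pos (h4.trans_le hp.2), indicator_of_mem (by exact ⟨hp, trivial⟩),
        indicator_of_mem (by exact ⟨⟨h4, hp.2⟩, trivial⟩)]
    · rw [indicator_of_notMem (fun h => hp h.1)]
      split_ifs with h
      · rw [indicator_of_notMem]
        rintro ⟨h5, _⟩
        exact hp ⟨pos_of_gt h5.1, h5.2⟩
      · rfl
  · by_cases hp : p.1 ∈ Ioc 0 T
    · have hmem : p ∈ Ioc 0 T ×ˢ (univ : Set Ω) := ⟨hp, trivial⟩
      simp only [indicator_of_mem hmem]
      exact (hl p.2 p.1 hp).comp (tendsto_leftGrid hp.1)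
    · have hmem : p ∉ Ioc 0 T ×ˢ (univ : Set Ω) := fun h => hp h.1
      simp only [indicator_of_notMem hmem]
      exact tendsto_const_nhds

end Predictable

/-! ### Left limits of paths -/

section Paths

/-- A path with left and right limits has at most countably many jumps. -/
lemma IsRCLL.countable_leftLim_ne {x : ℝ≥0 → ℝ} (hx : IsRCLL x) :
    {t | Function.leftLim x t ≠ x t}.Countable := by
  have h1 : ∀ q : ℚ, {t : ℝ≥0 | t ∈ Ioi (Real.toNNReal q) ∧ ∃ z, x t < z ∧
      ∀ y ∈ Ioi (Real.toNNReal q), y < t → z ≤ x y}.Countable := fun q =>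
    countable_image_gt_image_Iio_within (Ioi (Real.toNNReal q)) x
  have h2 : ∀ q : ℚ, {t : ℝ≥0 | t ∈ Ioi (Real.toNNReal q) ∧ ∃ z, z < x t ∧
      ∀ y ∈ Ioi (Real.toNNReal q), y < t → x y ≤ z}.Countable := fun q =>
    countable_image_lt_image_Iio_within (Ioi (Real.toNNReal q)) x
  refine ((countable_iUnion h1).union (countable_iUnion h2)).mono ?_
  intro t ht
  have ht0 : 0 < t := by
    rw [pos_iff_ne_zero]
    rintro rfl
    exact ht (leftLim_eq_of_isBot isBot_bot)
  have hlim := hx.tendsto_leftLim (t := t)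
  have hq : ∀ {p : ℝ → Prop}, (∀ᶠ y in 𝓝 (Function.leftLim x t), p y) →
      ∃ q : ℚ, t ∈ Ioi (Real.toNNReal q) ∧ ∀ y ∈ Ioi (Real.toNNReal q), y < t → p (x y) := by
    intro p hp
    obtain ⟨a, ha, hat⟩ := (mem_nhdsLT_iff_exists_Ioo_subset' ht0).1 (hlim.eventually hp)
    obtain ⟨q, hq1, hq2⟩ := exists_rat_btwn (show (a : ℝ) < t by exact_mod_cast ha)
    refine ⟨q, ?_, fun y hy hyt => hat ⟨lt_of_lt_of_le ?_ (le_of_lt hy), hyt⟩⟩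
    · rw [mem_Ioi, ← NNReal.coe_lt_coe, Real.coe_toNNReal _ (a.2.trans hq1.le)]
      exact hq2
    · rw [← NNReal.coe_lt_coe, Real.coe_toNNReal _ (a.2.trans hq1.le)]
      exact hq1
  rcases lt_or_gt_of_ne ht with h | h
  · obtain ⟨z, hz1, hz2⟩ := exists_between h
    obtain ⟨q, hq1, hq2⟩ := hq (eventually_le_nhds hz1)
    exact Or.inr (mem_iUnion.2 ⟨q, hq1, z, hz2, hq2⟩)
  · obtain ⟨z, hz1, hz2⟩ := exists_between h
    obtain ⟨q, hq1, hq2⟩ := hq (eventually_ge_nhds hz2)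
    exact Or.inl (mem_iUnion.2 ⟨q, hq1, z, hz1, hq2⟩)

lemma IsRCLL.ae_leftLim_eq {x : ℝ≥0 → ℝ} (hx : IsRCLL x) :
    ∀ᵐ t ∂leb, Function.leftLim x t = x t := by
  filter_upwards [measure_eq_zero_iff_ae_notMem.1 (hx.countable_leftLim_ne.measure_zero leb)] with t ht
  by_contra h
  exact ht h

end Paths

/-! ### The stochastic discount function -/

section Discount

variable {Ω : Type*} {N : ℕ} {A C : ℝ≥0 → Matrix (Fin N) (Fin N) ℝ} {X : ℝ≥0 → Ω → Fin N}
  {D : ℝ≥0 → Fin N → ℝ} {ω : Ω} {T : ℝ≥0}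

lemma sdf_leftLim_of_const (hx : IsRCLL fun u => X u ω) (hD : ∀ i, Measurable fun t => D t i)
    (hD' : ∃ c : ℝ, ∀ t ≤ T, ∀ i, |D t i| ≤ c) {a b : ℝ≥0} (hb : b ≤ T) (hab : a < b)
    (hc : ∀ u, a ≤ u → u < b → X u ω = X a ω) :
    Tendsto (fun t => sdf X C D t ω) (𝓝[<] b)
      (𝓝 (sdf X C D a ω * Real.exp (-∫ u in Ioc a b, D u (X a ω) ∂leb))) := by
  obtain ⟨c, hc'⟩ := hD'
  have hi : IntegrableOn (fun u => D u (X a ω)) (Ioc a b) leb :=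
    integrableOn_leb_of_bounded (hD _) fun u hu => hc' u (hu.2.trans hb) _
  refine Tendsto.congr' ?_ ((Real.continuous_exp.tendsto _).comp
    (tendsto_setIntegral_left hi).neg |>.const_mul (sdf X C D a ω))
  filter_upwards [Ioo_mem_nhdsLT hab] with t ht
  exact (sdf_of_const hx hD ⟨c, hc'⟩ hb hc ht.1.le ht.2).symm

lemma tendsto_sdfL (hx : IsRCLL fun u => X u ω) (hD : ∀ i, Measurable fun t => D t i)
    (hD' : ∃ c : ℝ, ∀ t ≤ T, ∀ i, |D t i| ≤ c) {u : ℝ≥0} (hu : u ∈ Ioc 0 T) :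
    Tendsto (fun t => sdf X C D t ω) (𝓝[<] u) (𝓝 (sdfL X C D u ω)) := by
  obtain ⟨a, hau, ha⟩ := hx.exists_left hu.1
  exact tendsto_leftLim_of_tendsto ⟨_, sdf_leftLim_of_const hx hD hD' hu.2 hau fun v h1 h2 =>
    (ha v h1 h2).trans (ha a le_rfl hau).symm⟩

/-- The discount function jumps only when the chain does. -/
lemma sdfL_eq_sdf (hx : IsRCLL fun u => X u ω) (hD : ∀ i, Measurable fun t => D t i)
    (hD' : ∃ c : ℝ, ∀ t ≤ T, ∀ i, |D t i| ≤ c) {u : ℝ≥0} (hu : u ∈ Ioc 0 T)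
    (hj : u ∉ jumps fun u => X u ω) : sdfL X C D u ω = sdf X C D u ω := by
  obtain ⟨a, hau, ha⟩ := hx.exists_left hu.1
  have hc : ∀ v, a ≤ v → v < u → X v ω = X a ω := fun v h1 h2 =>
    (ha v h1 h2).trans (ha a le_rfl hau).symm
  have : (𝓝[<] u).NeBot := nnreal_nhdsLT_neBot hu.1
  have hXu : X u ω = X a ω := by
    rw [jumps, mem_ofPred_eq, not_not, leftLim_eq_of_const_Ico hau hc] at hj
    exact hj.symm
  rw [sdf_of_const_right hx hD hD' hu.2 hau hc, hXu, sig_self, add_zero, mul_one]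
  exact leftLim_eq_of_tendsto (sdf_leftLim_of_const hx hD hD' hu.2 hau hc)

end Discount

section DiscountMeas

open ProbabilityTheory

variable {Ω : Type*} [MeasurableSpace Ω] {P : Measure Ω} {N : ℕ}
  {A C : ℝ≥0 → Matrix (Fin N) (Fin N) ℝ} {X : ℝ≥0 → Ω → Fin N} {D : ℝ≥0 → Fin N → ℝ} {T : ℝ≥0}

lemma intX_vecL_eq_sum (hX : IsMarkovChain P A X) (t : ℝ≥0) (ω : Ω) :
    intX X (fun u ω => vecL X u ω ᵥ* C u) t ω =
      ∑ i, ∑ j, ∫ u, (C u i j - C u i i) ∂(jumpMeas X i j t ω) := by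
  refine intX_eq_sum hX (ψ := fun i j u => C u i j - C u i i) fun u _ i j hi => ?_
  simp [vecL, hi]

lemma measurable_integral_measure {α : Type*} [MeasurableSpace α] {μ : α → Measure ℝ≥0}
    (hμ : Measurable μ) {f : ℝ≥0 → ℝ} (hf : Measurable f) : Measurable fun a => ∫ u, f u ∂(μ a) :=
  (StronglyMeasurable.integral_kernel (κ := (⟨μ, hμ⟩ : Kernel α ℝ≥0))
    hf.stronglyMeasurable).measurable

lemma measurable_integral_select {α : Type*} [MeasurableSpace α] {x : α × ℝ≥0 → Fin N}
    (hx : Measurable x) (hD : ∀ i, Measurable fun t => D t i) (t : ℝ≥0) :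
    Measurable fun a => ∫ u in Ioc 0 t, D u (x (a, u)) ∂leb :=
  (measurable_select (f := fun i p => D p.2 i) hx
    fun i => (hD i).comp measurable_snd).stronglyMeasurable.integral_prod_right'.measurable

/-- The discount function is adapted. -/
theorem measurable_sdf (hX : IsMarkovChain P A X) (hC : ∀ i j, Measurable fun t => C t i j)
    (hD : ∀ i, Measurable fun t => D t i) (t : ℝ≥0) :
    Measurable[chainFiltration P X t] (sdf X C D t) := by
  have h1 : Measurable[chainFiltration P X t] fun ω =>
      intX X (fun u ω => vecL X u ω ᵥ* C u) t ω := by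
    simp only [intX_vecL_eq_sum hX]
    exact Finset.measurable_sum _ fun i _ => Finset.measurable_sum _ fun j _ =>
      @measurable_integral_measure _ (chainFiltration P X t) _ (measurable_jumpMeas hX i j t) _
        ((hC i j).sub (hC i i))
  have h2 : Measurable[chainFiltration P X t] fun ω => ∫ u in Ioc 0 t, D u ⬝ᵥ vec X u ω ∂leb := by
    have h3 := @measurable_integral_select N D Ω (chainFiltration P X t) _
      (measurable_state_min hX t) hD t
    convert h3 using 2 with ω
    refine setIntegral_congr_fun measurableSet_Ioc fun u hu => ?_
    rw [dotProduct_vec, min_eq_left hu.2]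
  exact Real.measurable_exp.comp (h1.neg.sub h2)

/-- The discount function on `[0, T]` is bounded in terms of the number of jumps. -/
lemma sdf_le (hX : IsMarkovChain P A X) (hC' : ∃ c : ℝ, ∀ t ≤ T, ∀ i j, |C t i j| ≤ c)
    (hD' : ∃ c : ℝ, ∀ t ≤ T, ∀ i, |D t i| ≤ c) :
    ∃ a c : ℝ≥0, ∀ ω, ∀ t ≤ T,
      sdf X C D t ω ≤ c * (a : ℝ) ^ jumpCount X (fun i j => i ≠ j) 0 T ω := by
  obtain ⟨cc, hcc⟩ := hC'
  obtain ⟨cd, hcd⟩ := hD'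
  refine ⟨⟨Real.exp (2 * cc), (Real.exp_pos _).le⟩, ⟨Real.exp (cd * T), (Real.exp_pos _).le⟩,
    fun ω t ht => ?_⟩
  have hfin := (hX.rcll ω).finite_jumps_Ioc (zero_le (a := T))
  have hft := (hX.rcll ω).finite_jumps_Ioc (zero_le (a := t))
  rcases Nat.eq_zero_or_pos N with hN | hN
  · subst hN
    exact (X 0 ω).elim0
  have hcc0 : 0 ≤ cc := (abs_nonneg _).trans (hcc 0 zero_le ⟨0, hN⟩ ⟨0, hN⟩)
  have hcd0 : 0 ≤ cd := (abs_nonneg _).trans (hcd 0 zero_le ⟨0, hN⟩)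
  have h1 : -intX X (fun u ω => vecL X u ω ᵥ* C u) t ω ≤
      jumpCount X (fun i j => i ≠ j) 0 T ω * (2 * cc) := by
    have e1 : intX X (fun u ω => vecL X u ω ᵥ* C u) t ω = ∑ u ∈ hft.toFinset,
        (vecL X u ω ᵥ* C u) ⬝ᵥ (vec X u ω - vecL X u ω) := by
      rw [intX, ← finsum_mem_inter_support,
        finsum_mem_eq_sum_of_inter_support_eq (t := hft.toFinset)]
      ext u
      simp only [Finite.coe_toFinset, mem_inter_iff]
      exact ⟨fun hu => ⟨⟨support_jump_subset (fun u ω => vecL X u ω ᵥ* C u) hu.2, hu.1.1⟩, hu.2⟩,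
        fun hu => ⟨⟨hu.1.2, hu.2⟩, hu.2⟩⟩
    have e2 : ∀ u ∈ hft.toFinset,
        |(vecL X u ω ᵥ* C u) ⬝ᵥ (vec X u ω - vecL X u ω)| ≤ 2 * cc := by
      intro u hu
      have hu' := ((hft.mem_toFinset.1 hu).2.2).trans ht
      rw [dotProduct_jump]
      simp only [vecL, Matrix.single_one_vecMul]
      refine (abs_sub _ _).trans ?_
      rw [two_mul]
      exact add_le_add (hcc u hu' _ _) (hcc u hu' _ _)
    rw [e1]
    refine (neg_le_abs _).trans ((Finset.abs_sum_le_sum_abs _ _).trans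
      ((Finset.sum_le_sum e2).trans ?_))
    rw [Finset.sum_const, nsmul_eq_mul]
    refine mul_le_mul_of_nonneg_right ?_ (by positivity)
    rw [jumpCount, jumpsRel_ne, Nat.cast_le, ← ncard_eq_toFinset_card _ hft]
    exact ncard_le_ncard (inter_subset_inter_right _ (Ioc_subset_Ioc_right ht)) hfin
  have h2 : -∫ u in Ioc 0 t, D u ⬝ᵥ vec X u ω ∂leb ≤ cd * T := by
    have h3 : ‖∫ u in Ioc 0 t, D u ⬝ᵥ vec X u ω ∂leb‖ ≤ cd * leb.real (Ioc 0 t) :=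
      norm_setIntegral_le_of_norm_le_const (by rw [leb_Ioc]; exact ENNReal.ofReal_lt_top)
        fun u hu => by rw [dotProduct_vec]; exact hcd u (hu.2.trans ht) _
    have h4 : leb.real (Ioc 0 t) = t := by
      rw [measureReal_def, leb_Ioc, ENNReal.toReal_ofReal (by simp)]; simp
    rw [h4] at h3
    exact (neg_le_abs _).trans (h3.trans (mul_le_mul_of_nonneg_left (by exact_mod_cast ht) hcd0))
  change Real.exp _ ≤ Real.exp (cd * T) * Real.exp (2 * cc) ^ _
  rw [← Real.exp_nat_mul, ← Real.exp_add, Real.exp_le_exp]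
  linarith

lemma sdfL_le (hX : IsMarkovChain P A X) (hD : ∀ i, Measurable fun t => D t i)
    (hD' : ∃ c : ℝ, ∀ t ≤ T, ∀ i, |D t i| ≤ c) {ω : Ω} {b : ℝ}
    (hb : ∀ t ≤ T, sdf X C D t ω ≤ b) {u : ℝ≥0} (hu : u ∈ Ioc 0 T) :
    0 ≤ sdfL X C D u ω ∧ sdfL X C D u ω ≤ b := by
  have : (𝓝[<] u).NeBot := nnreal_nhdsLT_neBot hu.1
  have hl := tendsto_sdfL (C := C) (hX.rcll ω) hD hD' hu
  refine ⟨ge_of_tendsto hl (Eventually.of_forall fun t => (sdf_pos t).le), le_of_tendsto hl ?_⟩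
  filter_upwards [self_mem_nhdsWithin] with t ht using hb t (le_of_lt (lt_of_lt_of_le ht hu.2))

/-- The left limit of the discount function is predictable. -/
lemma stronglyMeasurable_sdfL (hX : IsMarkovChain P A X) (hC : ∀ i j, Measurable fun t => C t i j)
    (hD : ∀ i, Measurable fun t => D t i) (hD' : ∃ c : ℝ, ∀ t ≤ T, ∀ i, |D t i| ≤ c) :
    StronglyMeasurable[(chainFiltration P X).predictable]
      ((Ioc 0 T ×ˢ univ).indicator (Function.uncurry (sdfL X C D))) :=
  stronglyMeasurable_leftLim (fun t _ => measurable_sdf hX hC hD t)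
    fun ω _ hu => tendsto_sdfL (hX.rcll ω) hD hD' hu

/-- Along a path, the discount function is integrable with respect to any measure without atoms
that is finite on `(0, T]`. -/
lemma integrableOn_sdf (hX : IsMarkovChain P A X) (hC : ∀ i j, Measurable fun t => C t i j)
    (hD : ∀ i, Measurable fun t => D t i) (hC' : ∃ c : ℝ, ∀ t ≤ T, ∀ i j, |C t i j| ≤ c)
    (hD' : ∃ c : ℝ, ∀ t ≤ T, ∀ i, |D t i| ≤ c) (ω : Ω) {κ : Measure ℝ≥0} [NullSingletonClass κ]
    [IsFiniteMeasure (κ.restrict (Ioc 0 T))] :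
    IntegrableOn (fun u => sdf X C D u ω) (Ioc 0 T) κ := by
  obtain ⟨a, c, hac⟩ := sdf_le hX hC' hD'
  have hm : Measurable fun u => (Ioc 0 T ×ˢ univ).indicator (Function.uncurry (sdfL X C D)) (u, ω) :=
    ((stronglyMeasurable_sdfL hX hC hD hD').mono (predictable_le _)).measurable.comp
      measurable_prodMk_right
  have hb : ∀ u ∈ Ioc 0 T, _ := fun u hu => sdfL_le hX hD hD' (hac ω) hu
  have h : IntegrableOn (fun u => (Ioc 0 T ×ˢ univ).indicator (Function.uncurry (sdfL X C D)) (u, ω))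
      (Ioc 0 T) κ := by
    refine Integrable.mono' (integrable_const (c * (a : ℝ) ^ jumpCount X (fun i j => i ≠ j) 0 T ω))
      hm.aestronglyMeasurable ?_
    filter_upwards [ae_restrict_mem measurableSet_Ioc] with u hu
    rw [indicator_of_mem (by exact ⟨hu, trivial⟩)]
    exact (Real.norm_of_nonneg (hb u hu).1).trans_le (hb u hu).2
  refine h.congr ?_
  have hnull := ((hX.rcll ω).finite_jumps_Ioc (zero_le (a := T))).measure_zero κ
  filter_upwards [ae_restrict_mem measurableSet_Ioc,
    ae_restrict_of_ae (measure_eq_zero_iff_ae_notMem.1 hnull)] with u hu hj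
  rw [indicator_of_mem (by exact ⟨hu, trivial⟩)]
  exact sdfL_eq_sdf (hX.rcll ω) hD hD' hu fun h => hj ⟨h, hu⟩

end DiscountMeas

/-! ### Integrability of the coefficients of the discounted equation -/

section Coeff

open ProbabilityTheory

variable {Ω : Type*} [MeasurableSpace Ω] {P : Measure Ω} {N : ℕ}
  {A C : ℝ≥0 → Matrix (Fin N) (Fin N) ℝ} {X : ℝ≥0 → Ω → Fin N} {D : ℝ≥0 → Fin N → ℝ} {T : ℝ≥0}
  {G V : ℝ≥0 → Ω → ℝ} {Z : ℝ≥0 → Ω → Fin N → ℝ} {K : ℝ≥0 → Ω → ℝ}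

/-- A right-continuous process is jointly measurable in `ω` and the time. -/
lemma measurable_uncurry {E : Type*} [TopologicalSpace E]
    [TopologicalSpace.PseudoMetrizableSpace E] [MeasurableSpace E] [BorelSpace E]
    {Y : ℝ≥0 → Ω → E} (hY : ∀ ω t, ContinuousWithinAt (fun v => Y v ω) (Ici t) t)
    (hm : ∀ u, Measurable (Y u)) : Measurable fun p : Ω × ℝ≥0 => Y p.2 p.1 := by
  refine measurable_of_tendsto_metrizable (f := fun (n : ℕ) (p : Ω × ℝ≥0) => Y (min p.2 n) p.1)
    (fun n => measurable_uncurry_min (fun ω u _ => IsRCLL.min_continuous (hY ω) n u)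
      fun u _ => hm u) (tendsto_pi_nhds.2 fun p => ?_)
  obtain ⟨m, hm⟩ := exists_nat_ge p.2
  refine tendsto_const_nhds.congr' ?_
  filter_upwards [eventually_ge_atTop m] with n hn
  rw [min_eq_left (hm.trans (by exact_mod_cast hn))]

lemma measurable_uncurry_V (h : IsReflected P A X T G V Z K) :
    Measurable fun p : Ω × ℝ≥0 => V p.2 p.1 :=
  measurable_uncurry (fun ω => (h.V_rcll ω).1)
    fun u => (h.V_adapted u).measurable.mono ((chainFiltration P X).le u) le_rfl

lemma measurable_Z (h : IsReflected P A X T G V Z K) (j : Fin N) :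
    Measurable fun p : ℝ≥0 × Ω => Z p.1 p.2 j :=
  (measurable_pi_apply j).comp (StronglyMeasurable.mono h.Z_predictable (predictable_le _)).measurable

lemma measurable_Z_path (h : IsReflected P A X T G V Z K) (ω : Ω) (j : Fin N) :
    Measurable fun u => Z u ω j :=
  (measurable_Z h j).comp measurable_prodMk_right

lemma tendsto_discV_left (hX : IsMarkovChain P A X) (hD : ∀ i, Measurable fun t => D t i)
    (hD' : ∃ c : ℝ, ∀ t ≤ T, ∀ i, |D t i| ≤ c) (h : IsReflected P A X T G V Z K) (ω : Ω)
    {u : ℝ≥0} (hu : u ∈ Ioc 0 T) :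
    Tendsto (fun t => discV X C D V t ω) (𝓝[<] u)
      (𝓝 (sdfL X C D u ω * Function.leftLim (fun v => V v ω) u)) :=
  (tendsto_sdfL (hX.rcll ω) hD hD' hu).mul (h.V_rcll ω).tendsto_leftLim

lemma leftLim_discV (hX : IsMarkovChain P A X) (hD : ∀ i, Measurable fun t => D t i)
    (hD' : ∃ c : ℝ, ∀ t ≤ T, ∀ i, |D t i| ≤ c) (h : IsReflected P A X T G V Z K) (ω : Ω)
    {u : ℝ≥0} (hu : u ∈ Ioc 0 T) :
    Function.leftLim (fun v => discV X C D V v ω) u =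
      sdfL X C D u ω * Function.leftLim (fun v => V v ω) u := by
  have : (𝓝[<] u).NeBot := nnreal_nhdsLT_neBot hu.1
  exact leftLim_eq_of_tendsto (tendsto_discV_left hX hD hD' h ω hu)

lemma measurable_discV (hX : IsMarkovChain P A X) (hC : ∀ i j, Measurable fun t => C t i j)
    (hD : ∀ i, Measurable fun t => D t i) (h : IsReflected P A X T G V Z K) (t : ℝ≥0) :
    Measurable[chainFiltration P X t] (discV X C D V t) :=
  (measurable_sdf hX hC hD t).mul (h.V_adapted t).measurable

/-- The difference of the components `j` and `i` of the integrand `I(u, Z̃_u, Ṽ_{u-})` for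
`X_{u-} = i`: the jump of `Ṽ` when the chain moves from `i` to `j`. The left limits of `Ṽ`
and `π` are replaced by `0` outside `(0, T]`, which makes it predictable. -/
noncomputable def jumpIntgd (X : ℝ≥0 → Ω → Fin N) (C : ℝ≥0 → Matrix (Fin N) (Fin N) ℝ)
    (D : ℝ≥0 → Fin N → ℝ) (T : ℝ≥0) (V : ℝ≥0 → Ω → ℝ) (Z : ℝ≥0 → Ω → Fin N → ℝ) (i j : Fin N)
    (p : ℝ≥0 × Ω) : ℝ :=
  (Ioc 0 T ×ˢ univ).indicator (Function.uncurry fun u ω =>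
      Function.leftLim (fun v => discV X C D V v ω) u) p * sig C p.1 i j
    + (1 + sig C p.1 i j) * ((Ioc 0 T ×ˢ univ).indicator (Function.uncurry (sdfL X C D)) p
      * (Z p.1 p.2 j - Z p.1 p.2 i))

lemma jumpIntgd_of_mem {u : ℝ≥0} (hu : u ∈ Ioc 0 T) (i j : Fin N) (ω : Ω) :
    jumpIntgd X C D T V Z i j (u, ω) =
      Function.leftLim (fun v => discV X C D V v ω) u * sig C u i j
        + (1 + sig C u i j) * (sdfL X C D u ω * (Z u ω j - Z u ω i)) := by
  have hmem : (u, ω) ∈ Ioc 0 T ×ˢ (univ : Set Ω) := ⟨hu, trivial⟩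
  simp only [jumpIntgd, indicator_of_mem hmem]
  rfl

lemma intgd_sub {u : ℝ≥0} (hu : u ∈ Ioc 0 T) {i : Fin N} {ω : Ω}
    (hi : Function.leftLim (fun u => X u ω) u = i) (j : Fin N) :
    intgd X C D V Z u ω j - intgd X C D V Z u ω i = jumpIntgd X C D T V Z i j (u, ω) := by
  rw [jumpIntgd_of_mem hu, intgd, discIntegrand_sub C X u ω _ _ hi]
  simp only [discZ, Pi.smul_apply, smul_eq_mul]
  ring

lemma stronglyMeasurable_jumpIntgd (hX : IsMarkovChain P A X)
    (hC : ∀ i j, Measurable fun t => C t i j) (hD : ∀ i, Measurable fun t => D t i)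
    (hD' : ∃ c : ℝ, ∀ t ≤ T, ∀ i, |D t i| ≤ c) (h : IsReflected P A X T G V Z K) (i j : Fin N) :
    StronglyMeasurable[(chainFiltration P X).predictable] (jumpIntgd X C D T V Z i j) := by
  have h1 : StronglyMeasurable[(chainFiltration P X).predictable]
      ((Ioc 0 T ×ˢ univ).indicator (Function.uncurry fun u ω =>
        Function.leftLim (fun v => discV X C D V v ω) u)) :=
    stronglyMeasurable_leftLim (fun t _ => measurable_discV hX hC hD h t) fun ω u hu => by
      rw [leftLim_discV hX hD hD' h ω hu]
      exact tendsto_discV_left hX hD hD' h ω hu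
  have h2 := stronglyMeasurable_sdfL hX hC hD hD'
  have h3 : Measurable[(chainFiltration P X).predictable] fun p : ℝ≥0 × Ω => sig C p.1 i j :=
    (sig_measurable hC i j).comp (measurable_fst_predictable _)
  have h4 : ∀ k, Measurable[(chainFiltration P X).predictable] fun p : ℝ≥0 × Ω => Z p.1 p.2 k :=
    fun k => (measurable_pi_apply k).comp (StronglyMeasurable.measurable h.Z_predictable)
  exact Measurable.stronglyMeasurable
    ((h1.measurable.mul h3).add ((h3.const_add 1).mul (h2.measurable.mul ((h4 j).sub (h4 i)))))

lemma seminormSq_nonneg (hA : IsRateMatrix A) (u : ℝ≥0) (ω : Ω) (z : Fin N → ℝ) :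
    0 ≤ seminormSq A X u ω z := by
  rw [seminormSq_eq X hA]
  refine Finset.sum_nonneg fun j _ => ?_
  rcases eq_or_ne j (X u ω) with hj | hj
  · simp [hj]
  · exact mul_nonneg (hA.nonneg u _ j hj) (sq_nonneg _)

lemma rate_mul_sq_le (hA : IsRateMatrix A) (u : ℝ≥0) (ω : Ω) (z : Fin N → ℝ) (i j : Fin N) :
    (if i ≠ j ∧ X u ω = i then A u j i else 0) * (z j - z i) ^ 2 ≤ seminormSq A X u ω z := by
  split_ifs with h
  · rw [seminormSq_eq X hA, h.2]
    refine Finset.single_le_sum (f := fun j => A u j i * (z j - z i) ^ 2) (fun k _ => ?_)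
      (Finset.mem_univ j)
    rcases eq_or_ne k i with hk | hk
    · simp [hk]
    · exact mul_nonneg (hA.nonneg u _ k hk) (sq_nonneg _)
  · rw [zero_mul]
    exact seminormSq_nonneg hA u ω z

/-- The process `b² + V² + ‖Z‖²_X`, which dominates the coefficients of the discounted equation when
`b` is a bound for the discount function. -/
noncomputable def energy (A : ℝ≥0 → Matrix (Fin N) (Fin N) ℝ) (X : ℝ≥0 → Ω → Fin N)
    (V : ℝ≥0 → Ω → ℝ) (Z : ℝ≥0 → Ω → Fin N → ℝ) (b : ℝ) (u : ℝ≥0) (ω : Ω) : ℝ :=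
  b ^ 2 + V u ω ^ 2 + seminormSq A X u ω (Z u ω)

/-- The jumps of `Ṽ`, weighted with the rates, are dominated by the energy. The assumption on the
left limit of `V` holds at all but countably many times. -/
lemma abs_jumpIntgd_le (hX : IsMarkovChain P A X) (hD : ∀ i, Measurable fun t => D t i)
    (hC' : ∃ c : ℝ, ∀ t ≤ T, ∀ i j, |C t i j| ≤ c)
    (hD' : ∃ c : ℝ, ∀ t ≤ T, ∀ i, |D t i| ≤ c) (h : IsReflected P A X T G V Z K) :
    ∃ c : ℝ, 0 ≤ c ∧ ∀ i j ω b, (∀ t ≤ T, sdf X C D t ω ≤ b) → ∀ u ∈ Ioc 0 T,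
      Function.leftLim (fun v => V v ω) u = V u ω →
      (if i ≠ j ∧ X u ω = i then A u j i else 0) * |jumpIntgd X C D T V Z i j (u, ω)| ≤
        c * energy A X V Z b u ω := by
  obtain ⟨m', hm'⟩ := hX.rate.bounded
  obtain ⟨m, hm0, hm⟩ : ∃ m : ℝ, 0 ≤ m ∧ ∀ t i j, |A t i j| ≤ m :=
    ⟨max m' 0, le_max_right _ _, fun t i j => (hm' t i j).trans (le_max_left _ _)⟩
  obtain ⟨cs, hcs0, hcs⟩ := sig_bound hC'
  refine ⟨(1 + cs) * (2 * m + 1), by positivity, fun i j ω b hb u hu hV => ?_⟩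
  obtain ⟨hp0, hpb⟩ := sdfL_le hX hD hD' hb hu
  have hq := rate_mul_sq_le (X := X) hX.rate u ω (Z u ω) i j
  have hs := seminormSq_nonneg (X := X) hX.rate u ω (Z u ω)
  rw [jumpIntgd_of_mem hu, leftLim_discV hX hD hD' h ω hu, hV, energy]
  set p := sdfL X C D u ω
  set v := V u ω
  set δ := Z u ω j - Z u ω i
  set S := seminormSq A X u ω (Z u ω)
  set d := if i ≠ j ∧ X u ω = i then A u j i else 0 with hd
  have hd0 : 0 ≤ d := by
    rw [hd]; split_ifs with h
    · exact hX.rate.nonneg u i j h.1.symm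
    · exact le_rfl
  have hdm : d ≤ m := by
    rw [hd]; split_ifs with h
    · exact (le_abs_self _).trans (hm u j i)
    · exact hm0
  have hσ := hcs u hu.2 i j
  have e1 : |p * v * sig C u i j + (1 + sig C u i j) * (p * δ)| ≤
      cs * (p * |v|) + (1 + cs) * (p * |δ|) := by
    refine (abs_add_le _ _).trans (add_le_add ?_ ?_)
    · rw [abs_mul, abs_mul, abs_of_nonneg hp0, mul_comm]
      exact mul_le_mul_of_nonneg_right hσ (by positivity)
    · rw [abs_mul, abs_mul p, abs_of_nonneg hp0]
      refine mul_le_mul_of_nonneg_right ((abs_add_le _ _).trans ?_) (by positivity)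
      rw [abs_one]; linarith
  have hpb2 : p ^ 2 ≤ b ^ 2 := pow_le_pow_left₀ hp0 hpb 2
  have e2 : p * |v| ≤ b ^ 2 + v ^ 2 := by
    nlinarith [sq_nonneg (p - |v|), sq_abs v, sq_nonneg p, sq_nonneg v]
  have e3 : p * |δ| ≤ b ^ 2 + δ ^ 2 := by
    nlinarith [sq_nonneg (p - |δ|), sq_abs δ, sq_nonneg p, sq_nonneg δ]
  have e4 : d * (p * |v|) ≤ m * (b ^ 2 + v ^ 2) :=
    (mul_le_mul_of_nonneg_left e2 hd0).trans (mul_le_mul_of_nonneg_right hdm (by positivity))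
  have e5 : d * (p * |δ|) ≤ m * b ^ 2 + S := by
    have := mul_le_mul_of_nonneg_left e3 hd0
    have h2 : d * b ^ 2 ≤ m * b ^ 2 := mul_le_mul_of_nonneg_right hdm (sq_nonneg b)
    linarith
  calc d * |p * v * sig C u i j + (1 + sig C u i j) * (p * δ)|
      ≤ d * (cs * (p * |v|) + (1 + cs) * (p * |δ|)) := mul_le_mul_of_nonneg_left e1 hd0
    _ = cs * (d * (p * |v|)) + (1 + cs) * (d * (p * |δ|)) := by ring
    _ ≤ cs * (m * (b ^ 2 + v ^ 2)) + (1 + cs) * (m * b ^ 2 + S) := by gcongr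
    _ ≤ (1 + cs) * (2 * m + 1) * (b ^ 2 + v ^ 2 + S) := by
      have h1 : 0 ≤ m * v ^ 2 := by positivity
      have h2 : 0 ≤ cs * b ^ 2 := by positivity
      have h3 : 0 ≤ cs * v ^ 2 := by positivity
      have h4 : 0 ≤ m * S := by positivity
      have h5 : 0 ≤ cs * (m * S) := by positivity
      have h6 : 0 ≤ m * b ^ 2 := by positivity
      have h7 : 0 ≤ cs * (m * b ^ 2) := by positivity
      nlinarith [sq_nonneg b, sq_nonneg v]

lemma abs_discDriver_le (hX : IsMarkovChain P A X) (hD : ∀ i, Measurable fun t => D t i)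
    (hC' : ∃ c : ℝ, ∀ t ≤ T, ∀ i j, |C t i j| ≤ c)
    (hD' : ∃ c : ℝ, ∀ t ≤ T, ∀ i, |D t i| ≤ c) (s : ℝ) :
    ∃ c : ℝ, 0 ≤ c ∧ ∀ ω b, (∀ t ≤ T, sdf X C D t ω ≤ b) → ∀ u ∈ Ioc 0 T,
      |discDriver s A X C D u ω (discZ X C D Z u ω)| ≤ c * energy A X V Z b u ω := by
  obtain ⟨m', hm'⟩ := hX.rate.bounded
  obtain ⟨m, hm0, hm⟩ : ∃ m : ℝ, 0 ≤ m ∧ ∀ t i j, |A t i j| ≤ m :=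
    ⟨max m' 0, le_max_right _ _, fun t i j => (hm' t i j).trans (le_max_left _ _)⟩
  obtain ⟨cs, hcs0, hcs⟩ := sig_bound hC'
  refine ⟨|s + 1| * (cs * (N * (m + 1))), by positivity, fun ω b hb u hu => ?_⟩
  obtain ⟨hp0, hpb⟩ := sdfL_le hX hD hD' hb hu
  have hs := seminormSq_nonneg (X := X) hX.rate u ω (Z u ω)
  have hpb2 : sdfL X C D u ω ^ 2 ≤ b ^ 2 := pow_le_pow_left₀ hp0 hpb 2
  rw [discDriver_eq, abs_mul, abs_neg, mul_assoc |s + 1|]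
  refine mul_le_mul_of_nonneg_left ?_ (abs_nonneg _)
  rw [compSig, energy]
  have hterm : ∀ j ∈ Finset.univ, |A u j (X u ω) * sig C u (X u ω) j *
      (discZ X C D Z u ω j - discZ X C D Z u ω (X u ω))| ≤
      cs * ((m + 1) * (b ^ 2 + V u ω ^ 2 + seminormSq A X u ω (Z u ω))) := by
    intro j _
    have hq := rate_mul_sq_le (X := X) hX.rate u ω (Z u ω) (X u ω) j
    simp only [discZ, Pi.smul_apply, smul_eq_mul, ← mul_sub]
    rcases eq_or_ne j (X u ω) with hj | hj
    · rw [hj, sub_self, mul_zero, mul_zero, abs_zero]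
      positivity
    rw [if_pos ⟨hj.symm, rfl⟩] at hq
    set p := sdfL X C D u ω
    set δ := Z u ω j - Z u ω (X u ω)
    have hA0 : 0 ≤ A u j (X u ω) := hX.rate.nonneg u _ j hj
    have hAm : A u j (X u ω) ≤ m := (le_abs_self _).trans (hm u j _)
    have e3 : p * |δ| ≤ b ^ 2 + δ ^ 2 := by
      nlinarith [sq_nonneg (p - |δ|), sq_abs δ, sq_nonneg p, sq_nonneg δ]
    rw [abs_mul, abs_mul, abs_mul, abs_of_nonneg hA0, abs_of_nonneg hp0, mul_comm (A _ _ _), mul_assoc]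
    refine mul_le_mul (hcs u hu.2 _ _) ?_ (by positivity) hcs0
    have h1 := mul_le_mul_of_nonneg_left e3 hA0
    have h2 : A u j (X u ω) * b ^ 2 ≤ m * b ^ 2 := mul_le_mul_of_nonneg_right hAm (sq_nonneg b)
    have h3 : 0 ≤ m * V u ω ^ 2 := by positivity
    have h4 : 0 ≤ m * seminormSq A X u ω (Z u ω) := by positivity
    nlinarith [sq_nonneg b, sq_nonneg (V u ω)]
  refine (Finset.abs_sum_le_sum_abs _ _).trans ((Finset.sum_le_sum hterm).trans (le_of_eq ?_))
  rw [Finset.sum_const, Finset.card_univ, Fintype.card_fin, nsmul_eq_mul]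
  ring

variable [IsProbabilityMeasure P]

/-- A square-integrable bound for the discount function on `[0, T]`. -/
lemma exists_sdf_bound (hX : IsMarkovChain P A X) (hC' : ∃ c : ℝ, ∀ t ≤ T, ∀ i j, |C t i j| ≤ c)
    (hD' : ∃ c : ℝ, ∀ t ≤ T, ∀ i, |D t i| ≤ c) :
    ∃ b : Ω → ℝ, Measurable b ∧ (∀ ω, 0 ≤ b ω) ∧ MemLp b 2 P ∧
      ∀ ω, ∀ t ≤ T, sdf X C D t ω ≤ b ω := by
  obtain ⟨a, c, hac⟩ := sdf_le hX hC' hD'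
  have hm : Measurable fun ω => c * (a : ℝ) ^ jumpCount X (fun i j => i ≠ j) 0 T ω :=
    (((measurable_jumpCount hX (fun i j => i ≠ j) (fun a h => h rfl) (zero_le (a := T))).mono
      ((chainFiltration P X).le T) le_rfl).const_pow (a : ℝ)).const_mul _
  refine ⟨fun ω => c * (a : ℝ) ^ jumpCount X (fun i j => i ≠ j) 0 T ω, hm,
    fun ω => by positivity, ?_, hac⟩
  rw [memLp_two_iff_integrable_sq hm.aestronglyMeasurable]
  refine ((integrable_pow_jumpCount hX (a ^ 2) T).const_mul ((c : ℝ) ^ 2)).congr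
    (Eventually.of_forall fun ω => ?_)
  simp only [NNReal.coe_pow]
  ring

lemma lintegral_energy (hX : IsMarkovChain P A X) (h : IsReflected P A X T G V Z K) {b : Ω → ℝ}
    (hbm : Measurable b) (hb : MemLp b 2 P) {c : ℝ} (hc : 0 ≤ c) :
    ∫⁻ ω, ∫⁻ u in Ioc 0 T, ENNReal.ofReal (c * energy A X V Z (b ω) u ω) ∂leb ∂P < ∞ := by
  have hVm := measurable_uncurry_V h
  have e1 : ∀ u ω, ENNReal.ofReal (c * energy A X V Z (b ω) u ω) = ENNReal.ofReal c *
      ((ENNReal.ofReal (b ω ^ 2) + ENNReal.ofReal (V u ω ^ 2)) +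
        ENNReal.ofReal (seminormSq A X u ω (Z u ω))) := by
    intro u ω
    rw [energy, ENNReal.ofReal_mul hc, ENNReal.ofReal_add (by positivity)
      (seminormSq_nonneg hX.rate u ω _), ENNReal.ofReal_add (by positivity) (by positivity)]
  have hV2 : Measurable fun p : Ω × ℝ≥0 => ENNReal.ofReal (V p.2 p.1 ^ 2) :=
    (hVm.pow_const 2).ennreal_ofReal
  have hb2 : Measurable fun ω => ENNReal.ofReal (b ω ^ 2) := (hbm.pow_const 2).ennreal_ofReal
  have e2 : ∀ ω, ∫⁻ u in Ioc 0 T, ENNReal.ofReal (c * energy A X V Z (b ω) u ω) ∂leb =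
      ENNReal.ofReal c * ((ENNReal.ofReal (b ω ^ 2) * ENNReal.ofReal T +
        ∫⁻ u in Ioc 0 T, ENNReal.ofReal (V u ω ^ 2) ∂leb) +
        ∫⁻ u in Ioc 0 T, ENNReal.ofReal (seminormSq A X u ω (Z u ω)) ∂leb) := by
    intro ω
    have hVω : Measurable fun u => ENNReal.ofReal (V u ω ^ 2) := hV2.comp measurable_prodMk_left
    simp only [e1]
    rw [lintegral_const_mul' _ _ ENNReal.ofReal_ne_top,
      lintegral_add_left (hVω.const_add _), lintegral_add_left measurable_const, lintegral_const,
      Measure.restrict_apply_univ, leb_Ioc, NNReal.coe_zero, sub_zero]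
  simp only [e2]
  have hV3 : Measurable fun ω => ∫⁻ u in Ioc 0 T, ENNReal.ofReal (V u ω ^ 2) ∂leb :=
    hV2.lintegral_prod_right'
  have hb4 : Measurable fun ω => ENNReal.ofReal (b ω ^ 2) * ENNReal.ofReal T +
      ∫⁻ u in Ioc 0 T, ENNReal.ofReal (V u ω ^ 2) ∂leb := (hb2.mul_const _).add hV3
  rw [lintegral_const_mul' _ _ ENNReal.ofReal_ne_top, lintegral_add_left hb4,
    lintegral_add_left (hb2.mul_const _), lintegral_mul_const _ hb2]
  have hb3 : ∫⁻ ω, ENNReal.ofReal (b ω ^ 2) ∂P < ∞ := by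
    have := ((memLp_two_iff_integrable_sq hbm.aestronglyMeasurable).1 hb).2
    rwa [hasFiniteIntegral_iff_ofReal (Eventually.of_forall fun ω => sq_nonneg _)] at this
  exact ENNReal.mul_lt_top ENNReal.ofReal_lt_top (ENNReal.add_lt_top.2 ⟨ENNReal.add_lt_top.2
    ⟨ENNReal.mul_lt_top hb3 ENNReal.ofReal_lt_top, h.V_sq⟩, h.Z_sq⟩)

theorem integrable_jumpIntgd (hX : IsMarkovChain P A X)
    (hC : ∀ i j, Measurable fun t => C t i j) (hD : ∀ i, Measurable fun t => D t i)
    (hC' : ∃ c : ℝ, ∀ t ≤ T, ∀ i j, |C t i j| ≤ c)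
    (hD' : ∃ c : ℝ, ∀ t ≤ T, ∀ i, |D t i| ≤ c) (h : IsReflected P A X T G V Z K) (i j : Fin N) :
    Integrable (fun p => jumpIntgd X C D T V Z i j p.swap) (P ⊗ₘ compKer hX i j T) := by
  have hm : Measurable fun p : Ω × ℝ≥0 => jumpIntgd X C D T V Z i j p.swap :=
    ((stronglyMeasurable_jumpIntgd hX hC hD hD' h i j).mono (predictable_le _)).measurable.comp
      measurable_swap
  obtain ⟨b, hbm, -, hb2, hb⟩ := exists_sdf_bound hX hC' hD'
  obtain ⟨c, hc0, hc⟩ := abs_jumpIntgd_le (Z := Z) hX hD hC' hD' h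
  refine ⟨hm.aestronglyMeasurable, ?_⟩
  rw [HasFiniteIntegral, Measure.lintegral_compProd hm.enorm]
  refine (lintegral_mono fun ω => ?_).trans_lt (lintegral_energy hX h hbm hb2 hc0)
  have hdm : Measurable fun u => if i ≠ j ∧ X u ω = i then ENNReal.ofReal (A u j i) else 0 := by
    refine Measurable.ite ?_ (hX.rate.measurable j i).ennreal_ofReal measurable_const
    exact (MeasurableSet.const _).inter ((hX.rcll ω).measurable_fin (measurableSet_singleton i))
  change ∫⁻ u, _ ∂(compMeas A X i j T ω) ≤ _
  have hmω : Measurable fun u => ‖jumpIntgd X C D T V Z i j (ω, u).swap‖ₑ :=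
    hm.enorm.comp measurable_prodMk_left
  rw [compMeas, lintegral_withDensity_eq_lintegral_mul _ hdm hmω]
  refine lintegral_mono_ae ?_
  filter_upwards [ae_restrict_mem measurableSet_Ioc,
    ae_restrict_of_ae (h.V_rcll ω).ae_leftLim_eq] with u hu hV
  have := hc i j ω (b ω) (hb ω) u hu hV
  rw [Pi.mul_apply]
  simp only [Prod.swap_prod_mk, ← ofReal_norm, Real.norm_eq_abs]
  split_ifs at this ⊢ with hij
  · rw [← ENNReal.ofReal_mul (hX.rate.nonneg u i j hij.1.symm)]
    exact ENNReal.ofReal_le_ofReal this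
  · rw [zero_mul]; exact zero_le

/-- The driver of the discounted equation is integrable over `Ω × (0, T]`. -/
theorem integrable_discDriver (hX : IsMarkovChain P A X)
    (hC : ∀ i j, Measurable fun t => C t i j) (hD : ∀ i, Measurable fun t => D t i)
    (hC' : ∃ c : ℝ, ∀ t ≤ T, ∀ i j, |C t i j| ≤ c)
    (hD' : ∃ c : ℝ, ∀ t ≤ T, ∀ i, |D t i| ≤ c) (h : IsReflected P A X T G V Z K) (s : ℝ) :
    Integrable (fun p : Ω × ℝ≥0 => discDriver s A X C D p.2 p.1 (discZ X C D Z p.2 p.1))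
      (P.prod (leb.restrict (Ioc 0 T))) := by
  obtain ⟨b, hbm, -, hb2, hb⟩ := exists_sdf_bound hX hC' hD'
  obtain ⟨c, hc0, hc⟩ := abs_discDriver_le (V := V) (Z := Z) hX hD hC' hD' s
  have hπ : Measurable fun p : Ω × ℝ≥0 =>
      (Ioc 0 T ×ˢ univ).indicator (Function.uncurry (sdfL X C D)) p.swap :=
    ((stronglyMeasurable_sdfL hX hC hD hD').mono (predictable_le _)).measurable.comp measurable_swap
  have hXm : Measurable fun p : Ω × ℝ≥0 => X p.2 p.1 :=
    measurable_uncurry (fun ω => (hX.rcll ω).1) hX.measurable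
  have hZm : ∀ k, Measurable fun p : Ω × ℝ≥0 => Z p.2 p.1 k := fun k =>
    (measurable_Z h k).comp measurable_swap
  have hm : Measurable fun p : Ω × ℝ≥0 => -(s + 1) * ∑ j, A p.2 j (X p.2 p.1) *
      sig C p.2 (X p.2 p.1) j *
      ((Ioc 0 T ×ˢ univ).indicator (Function.uncurry (sdfL X C D)) p.swap *
        (Z p.2 p.1 j - Z p.2 p.1 (X p.2 p.1))) := by
    refine (measurable_select (f := fun i (p : Ω × ℝ≥0) => ∑ j, A p.2 j i * sig C p.2 i j *
      ((Ioc 0 T ×ˢ univ).indicator (Function.uncurry (sdfL X C D)) p.swap *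
        (Z p.2 p.1 j - Z p.2 p.1 i))) hXm fun i => ?_).const_mul _
    exact Finset.measurable_sum _ fun j _ => (((hX.rate.measurable j i).comp measurable_snd).mul
      ((sig_measurable hC i j).comp measurable_snd)).mul (hπ.mul ((hZm j).sub (hZm i)))
  have hmem : ∀ᵐ p ∂(P.prod (leb.restrict (Ioc 0 T))), p.2 ∈ Ioc 0 T :=
    Measure.quasiMeasurePreserving_snd.ae (ae_restrict_mem measurableSet_Ioc)
  have heq : (fun p : Ω × ℝ≥0 => discDriver s A X C D p.2 p.1 (discZ X C D Z p.2 p.1))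
      =ᵐ[P.prod (leb.restrict (Ioc 0 T))] fun p : Ω × ℝ≥0 => -(s + 1) *
      ∑ j, A p.2 j (X p.2 p.1) * sig C p.2 (X p.2 p.1) j *
      ((Ioc 0 T ×ˢ univ).indicator (Function.uncurry (sdfL X C D)) p.swap *
        (Z p.2 p.1 j - Z p.2 p.1 (X p.2 p.1))) := by
    filter_upwards [hmem] with p hp
    rw [discDriver_eq, compSig, indicator_of_mem (by exact ⟨hp, trivial⟩)]
    simp only [discZ, Pi.smul_apply, smul_eq_mul, ← mul_sub]
    rfl
  refine Integrable.congr ⟨hm.aestronglyMeasurable, ?_⟩ heq.symm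
  rw [HasFiniteIntegral, lintegral_prod _ hm.enorm.aemeasurable]
  refine lt_of_le_of_lt (lintegral_mono fun ω => ?_) (lintegral_energy hX h hbm hb2 hc0)
  refine setLIntegral_mono' measurableSet_Ioc fun u hu => ?_
  have h1 := hc ω (b ω) (hb ω) u hu
  rw [← Real.norm_eq_abs] at h1
  refine le_trans (le_of_eq ?_) (ENNReal.ofReal_le_ofReal h1)
  rw [ofReal_norm]
  congr 1
  rw [discDriver_eq, compSig, indicator_of_mem (by exact ⟨hu, trivial⟩)]
  simp only [discZ, Pi.smul_apply, smul_eq_mul, ← mul_sub]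
  rfl

end Coeff

/-! ### The martingale part between stopping times -/

section Stopped

open ProbabilityTheory

variable {Ω : Type*} [MeasurableSpace Ω] {P : Measure Ω} {N : ℕ}
  {A C : ℝ≥0 → Matrix (Fin N) (Fin N) ℝ} {X : ℝ≥0 → Ω → Fin N} {D : ℝ≥0 → Fin N → ℝ} {T : ℝ≥0}
  {G V : ℝ≥0 → Ω → ℝ} {Z : ℝ≥0 → Ω → Fin N → ℝ} {K : ℝ≥0 → Ω → ℝ}

/-- The stochastic interval `(t, τ]`, restricted to an event `B` known at time `t`, is
predictable. -/
lemma measurableSet_stochInterval {F : Filtration ℝ≥0 ‹MeasurableSpace Ω›} {t T : ℝ≥0}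
    {τ : Ω → ℝ≥0} (hτ : τ ∈ stoppingTimes F t T) {B : Set Ω} (hB : MeasurableSet[F t] B) :
    MeasurableSet[F.predictable] {p : ℝ≥0 × Ω | p.2 ∈ B ∧ t < p.1 ∧ p.1 ≤ τ p.2} := by
  have h1 : {p : ℝ≥0 × Ω | p.2 ∈ B ∧ t < p.1 ∧ p.1 ≤ τ p.2} =
      (Ioi t ×ˢ B) \ ⋃ q : ℚ, Ioi (Real.toNNReal q) ×ˢ {ω | τ ω ≤ Real.toNNReal q} := by
    ext ⟨u, ω⟩
    simp only [mem_ofPred_eq, Set.mem_sdiff, mem_prod, mem_Ioi, mem_iUnion, not_exists, not_and, not_le]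
    constructor
    · rintro ⟨h1, h2, h3⟩
      exact ⟨⟨h2, h1⟩, fun q hq => hq.trans_le h3⟩
    · rintro ⟨⟨h2, h1⟩, h3⟩
      refine ⟨h1, h2, le_of_not_gt fun h => ?_⟩
      obtain ⟨q, hq1, hq2⟩ := exists_rat_btwn (show (τ ω : ℝ) < u by exact_mod_cast h)
      have e : ((Real.toNNReal q : ℝ≥0) : ℝ) = q := Real.coe_toNNReal _ ((τ ω).2.trans hq1.le)
      refine absurd (h3 q ?_) (not_lt.2 ?_)
      · rw [← NNReal.coe_lt_coe, e]; exact hq2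
      · rw [← NNReal.coe_le_coe, e]; exact hq1.le
  rw [h1]
  refine (measurableSet_predictable_Ioi_prod hB).diff (MeasurableSet.iUnion fun q =>
    measurableSet_predictable_Ioi_prod ?_)
  have := hτ.1 (Real.toNNReal q)
  simpa only [WithTop.coe_le_coe] using this

/-- The integral of the integrand restricted to `(t, r]` is the increment of the integral between
`t` and `r`. -/
lemma intM_indicator {φ : ℝ≥0 → Ω → Fin N → ℝ} {ω : Ω} (hx : IsRCLL fun u => X u ω)
    (hφ : IntegrableOn (fun u => φ u ω ⬝ᵥ (A u *ᵥ vec X u ω)) (Ioc 0 T) leb) {Q : Set (ℝ≥0 × Ω)}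
    {t r : ℝ≥0} (htr : t ≤ r) (hr : r ≤ T) (hQ : ∀ u, (u, ω) ∈ Q ↔ u ∈ Ioc t r) :
    intM A X (fun u ω => Q.indicator (fun p => φ p.1 p.2) (u, ω)) T ω =
      intM A X φ r ω - intM A X φ t ω := by
  have hsub : Ioc t r ⊆ Ioc 0 T := Ioc_subset_Ioc zero_le hr
  rw [intM_sub hx htr (hφ.mono_set (Ioc_subset_Ioc_right hr)), intM, intX, jumpSum,
    finsum_mem_def, finsum_mem_def]
  congr 1
  · refine finsum_congr fun u => ?_
    by_cases hu : u ∈ Ioc t r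
    · rw [indicator_of_mem (hsub hu), indicator_of_mem hu, indicator_of_mem ((hQ u).2 hu)]
    · rw [indicator_of_notMem hu, indicator_apply,
        indicator_of_notMem (fun h => hu ((hQ u).1 h)), zero_dotProduct, ite_self]
  · have : ∀ u, Q.indicator (fun p : ℝ≥0 × Ω => φ p.1 p.2) (u, ω) ⬝ᵥ (A u *ᵥ vec X u ω) =
        (Ioc t r).indicator (fun u => φ u ω ⬝ᵥ (A u *ᵥ vec X u ω)) u := by
      intro u
      by_cases hu : u ∈ Ioc t r
      · rw [indicator_of_mem hu, indicator_of_mem ((hQ u).2 hu)]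
      · rw [indicator_of_notMem hu, indicator_of_notMem (fun h => hu ((hQ u).1 h)), zero_dotProduct]
    simp only [this]
    rw [setIntegral_indicator measurableSet_Ioc, inter_eq_right.2 hsub]

lemma intM_indicator_empty {φ : ℝ≥0 → Ω → Fin N → ℝ} {ω : Ω} {Q : Set (ℝ≥0 × Ω)}
    (hQ : ∀ u, (u, ω) ∉ Q) :
    intM A X (fun u ω => Q.indicator (fun p => φ p.1 p.2) (u, ω)) T ω = 0 := by
  have : ∀ u, Q.indicator (fun p : ℝ≥0 × Ω => φ p.1 p.2) (u, ω) = 0 := fun u =>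
    indicator_of_notMem (hQ u) _
  simp [intM, intX, this]

variable [IsProbabilityMeasure P]

lemma ae_integrableOn_intgd (hX : IsMarkovChain P A X)
    (hC : ∀ i j, Measurable fun t => C t i j) (hD : ∀ i, Measurable fun t => D t i)
    (hC' : ∃ c : ℝ, ∀ t ≤ T, ∀ i j, |C t i j| ≤ c)
    (hD' : ∃ c : ℝ, ∀ t ≤ T, ∀ i, |D t i| ≤ c) (h : IsReflected P A X T G V Z K) :
    ∀ᵐ ω ∂P, IntegrableOn (fun u => intgd X C D V Z u ω ⬝ᵥ (A u *ᵥ vec X u ω)) (Ioc 0 T) leb := by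
  filter_upwards [ae_integrableOn_comp hX
    (fun ω u hu i j hi => intgd_sub (D := D) (C := C) (V := V) (Z := Z) hu hi j)
    fun i j => integrable_jumpIntgd hX hC hD hC' hD' h i j] with ω hω using hω.2

/-- The martingale part of the discounted equation between `t` and a stopping time, on an event
known at time `t`. -/
lemma integral_stopped_indicator (hX : IsMarkovChain P A X)
    (hC : ∀ i j, Measurable fun t => C t i j) (hD : ∀ i, Measurable fun t => D t i)
    (hC' : ∃ c : ℝ, ∀ t ≤ T, ∀ i j, |C t i j| ≤ c)
    (hD' : ∃ c : ℝ, ∀ t ≤ T, ∀ i, |D t i| ≤ c) (h : IsReflected P A X T G V Z K) {t : ℝ≥0}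
    {τ : Ω → ℝ≥0} (hτ : τ ∈ stoppingTimes (chainFiltration P X) t T) {B : Set Ω}
    (hB : MeasurableSet[chainFiltration P X t] B) :
    Integrable (B.indicator fun ω =>
        intM A X (intgd X C D V Z) (τ ω) ω - intM A X (intgd X C D V Z) t ω) P ∧
      ∫ ω, B.indicator (fun ω =>
        intM A X (intgd X C D V Z) (τ ω) ω - intM A X (intgd X C D V Z) t ω) ω ∂P = 0 := by
  set Q : Set (ℝ≥0 × Ω) := {p | p.2 ∈ B ∧ t < p.1 ∧ p.1 ≤ τ p.2} with hQ
  have hQm := measurableSet_stochInterval hτ hB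
  have hQm' : MeasurableSet Q := predictable_le _ _ hQm
  obtain ⟨i1, i2⟩ := integral_intM hX (T := T)
    (φ := fun u ω => Q.indicator (fun p => intgd X C D V Z p.1 p.2) (u, ω))
    (ψ := fun i j => Q.indicator (jumpIntgd X C D T V Z i j))
    (fun i j => (stronglyMeasurable_jumpIntgd hX hC hD hD' h i j).indicator hQm)
    (fun ω u hu i j hi => by
      by_cases hm : (u, ω) ∈ Q
      · simp only [indicator_of_mem hm]
        exact intgd_sub hu hi j
      · simp only [indicator_of_notMem hm, Pi.zero_apply, sub_zero])
    (fun i j => (integrable_jumpIntgd hX hC hD hC' hD' h i j).indicator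
      (measurable_swap hQm'))
  have heq : intM A X (fun u ω => Q.indicator (fun p => intgd X C D V Z p.1 p.2) (u, ω)) T
      =ᵐ[P] B.indicator fun ω =>
        intM A X (intgd X C D V Z) (τ ω) ω - intM A X (intgd X C D V Z) t ω := by
    filter_upwards [ae_integrableOn_intgd hX hC hD hC' hD' h] with ω hω
    by_cases hωB : ω ∈ B
    · rw [indicator_of_mem hωB, intM_indicator (hX.rcll ω) hω (hτ.2 ω).1 (hτ.2 ω).2]
      intro u
      simp only [hQ, mem_ofPred_eq, hωB, true_and, mem_Ioc]
    · rw [indicator_of_notMem hωB, intM_indicator_empty fun u hu => hωB hu.1]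
  exact ⟨i1.congr heq, by rw [← integral_congr_ae heq, i2]⟩

theorem integrable_stopped (hX : IsMarkovChain P A X)
    (hC : ∀ i j, Measurable fun t => C t i j) (hD : ∀ i, Measurable fun t => D t i)
    (hC' : ∃ c : ℝ, ∀ t ≤ T, ∀ i j, |C t i j| ≤ c)
    (hD' : ∃ c : ℝ, ∀ t ≤ T, ∀ i, |D t i| ≤ c) (h : IsReflected P A X T G V Z K) {t : ℝ≥0}
    {τ : Ω → ℝ≥0} (hτ : τ ∈ stoppingTimes (chainFiltration P X) t T) :
    Integrable (fun ω =>
      intM A X (intgd X C D V Z) (τ ω) ω - intM A X (intgd X C D V Z) t ω) P := by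
  simpa using (integral_stopped_indicator hX hC hD hC' hD' h hτ MeasurableSet.univ).1

/-- Optional sampling for the martingale part of the discounted equation: for `B` known at time `t`,
the set `B × (t, τ]` is predictable, and the integral of the integrand restricted to it has mean
zero. -/
theorem condExp_stopped (hX : IsMarkovChain P A X)
    (hC : ∀ i j, Measurable fun t => C t i j) (hD : ∀ i, Measurable fun t => D t i)
    (hC' : ∃ c : ℝ, ∀ t ≤ T, ∀ i j, |C t i j| ≤ c)
    (hD' : ∃ c : ℝ, ∀ t ≤ T, ∀ i, |D t i| ≤ c) (h : IsReflected P A X T G V Z K) {t : ℝ≥0}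
    {τ : Ω → ℝ≥0} (hτ : τ ∈ stoppingTimes (chainFiltration P X) t T) :
    P[fun ω => intM A X (intgd X C D V Z) (τ ω) ω - intM A X (intgd X C D V Z) t ω
      | chainFiltration P X t] =ᵐ[P] 0 := by
  have hle := (chainFiltration P X).le t
  refine (ae_eq_condExp_of_forall_setIntegral_eq hle
    (integrable_stopped hX hC hD hC' hD' h hτ) (fun _ _ _ => (integrable_zero _ _ _).integrableOn)
    (fun B hB _ => ?_) stronglyMeasurable_zero.aestronglyMeasurable).symm
  have h0 := (integral_stopped_indicator hX hC hD hC' hD' h hτ hB).2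
  rw [integral_indicator (hle _ hB)] at h0
  rw [h0]
  simp

end Stopped

/-! ### The discounted equation between two times -/

section Decomp

variable {Ω : Type*} [MeasurableSpace Ω] {P : Measure Ω} {N : ℕ}
  {A C : ℝ≥0 → Matrix (Fin N) (Fin N) ℝ} {X : ℝ≥0 → Ω → Fin N} {D : ℝ≥0 → Fin N → ℝ} {T : ℝ≥0}
  {G V : ℝ≥0 → Ω → ℝ} {Z : ℝ≥0 → Ω → Fin N → ℝ} {K : ℝ≥0 → Ω → ℝ} [IsProbabilityMeasure P]

/-- Along almost every path, the discounted equation holds between any two times. -/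
theorem ae_discounted (hX : IsMarkovChain P A X)
    (hC : ∀ i j, Measurable fun t => C t i j) (hD : ∀ i, Measurable fun t => D t i)
    (hC' : ∃ c : ℝ, ∀ t ≤ T, ∀ i j, |C t i j| ≤ c)
    (hD' : ∃ c : ℝ, ∀ t ≤ T, ∀ i, |D t i| ≤ c) {s : ℝ}
    (h : IsDiscountedSolution P s A X C D T G V Z K) :
    ∀ᵐ ω ∂P, V T ω = G T ω ∧ ∀ t r, t ≤ r → r ≤ T → discV X C D V t ω = discV X C D V r ω
      + (∫ u in Ioc t r, discDriver s A X C D u ω (discZ X C D Z u ω) ∂leb)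
      + (∫ u in Ioc t r, sdf X C D u ω ∂(stieltjes fun u => K u ω))
      - (intM A X (intgd X C D V Z) r ω - intM A X (intgd X C D V Z) t ω) := by
  have hH := integrable_discDriver hX hC hD hC' hD' h.toIsReflected s
  filter_upwards [h.equation, hH.prod_right_ae] with ω hω hHω
  have hH' : IntegrableOn (fun u => discDriver s A X C D u ω (discZ X C D Z u ω)) (Ioc 0 T) leb :=
    hHω
  have : NullSingletonClass (stieltjes fun u => K u ω) :=
    stieltjes_nullSingleton (h.K_monotone ω) (h.K_continuous ω)
  have : IsFiniteMeasure ((stieltjes fun u => K u ω).restrict (Ioc 0 T)) :=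
    stieltjes_finite (h.K_monotone ω) (h.K_continuous ω) 0 T
  have hπ := integrableOn_sdf hX hC hD hC' hD' ω (κ := stieltjes fun u => K u ω)
  have hT : discV X C D V T ω = sdf X C D T ω * G T ω := by simpa using hω T le_rfl
  refine ⟨mul_left_cancel₀ (sdf_pos T).ne' hT, fun t r htr hr => ?_⟩
  have e1 := hω t (htr.trans hr)
  have e2 := hω r hr
  have e3 : discK X C D K r ω = discK X C D K t ω +
      ∫ u in Ioc t r, sdf X C D u ω ∂(stieltjes fun u => K u ω) :=
    setIntegral_Ioc_add zero_le htr (hπ.mono_set (Ioc_subset_Ioc_right hr))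
  have e4 := setIntegral_Ioc_add htr hr (hH'.mono_set (Ioc_subset_Ioc_left zero_le))
  have e5 : ∀ v, intM A X (intgd X C D V Z) v ω = intM A X (fun u ω => discIntegrand X C u ω
      (discZ X C D Z u ω) (Function.leftLim (fun v => discV X C D V v ω) u)) v ω := fun _ => rfl
  rw [e5, e5]
  linear_combination e1 - e2 + e4 + e3

/-- A random variable known at time `0` is almost surely bounded, because `X 0` takes only finitely
many values. -/
lemma exists_bound_zero {Y : Ω → ℝ}
    (hY : Measurable[chainFiltration P X 0] Y) : ∃ c : ℝ, ∀ᵐ ω ∂P, |Y ω| ≤ c := by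
  have h1 : ∀ n : ℕ, ∃ S : Set (Fin N), {ω | (n : ℝ) < |Y ω|} =ᵐ[P] X 0 ⁻¹' S := by
    intro n
    have hm : MeasurableSet[chainFiltration P X 0] {ω | (n : ℝ) < |Y ω|} := by
      have h2 : Measurable[chainFiltration P X 0] fun ω => |Y ω| := measurable_abs.comp hY
      exact h2 measurableSet_Ioi
    obtain ⟨-, B, hB, hBe⟩ := hm
    have h2 : (⨆ u : Iic (0 : ℝ≥0), MeasurableSpace.comap (X u) ⊤) ≤
        MeasurableSpace.comap (X 0) ⊤ := iSup_le fun u => by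
      have : (u : ℝ≥0) = 0 := le_antisymm u.2 zero_le
      rw [this]
    obtain ⟨S, -, rfl⟩ := h2 _ hB
    exact ⟨S, hBe⟩
  choose S hS using h1
  have hlim : Tendsto (fun n : ℕ => P.real {ω | (n : ℝ) < |Y ω|}) atTop (𝓝 0) := by
    have hmeas : ∀ n : ℕ, NullMeasurableSet {ω | (n : ℝ) < |Y ω|} P := fun n =>
      (((chainFiltration P X).le 0 _ ((measurable_abs.comp hY) measurableSet_Ioi :
        MeasurableSet[chainFiltration P X 0] ((fun ω => |Y ω|) ⁻¹' Ioi (n : ℝ))))).nullMeasurableSet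
    have hanti : Antitone fun n : ℕ => {ω | (n : ℝ) < |Y ω|} := fun n m hnm ω hω =>
      lt_of_le_of_lt (by exact_mod_cast hnm) (show (m : ℝ) < |Y ω| from hω)
    have h3 := tendsto_measure_iInter_atTop hmeas hanti ⟨0, measure_ne_top P _⟩
    have h4 : ⋂ n : ℕ, {ω | (n : ℝ) < |Y ω|} = ∅ := by
      rw [eq_empty_iff_forall_notMem]
      intro ω hω
      obtain ⟨n, hn⟩ := exists_nat_ge |Y ω|
      exact absurd (mem_iInter.1 hω n) (not_lt.2 hn)
    rw [h4, measure_empty] at h3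
    exact (ENNReal.tendsto_toReal ENNReal.zero_ne_top).comp h3
  -- the probabilities of the events `X 0 ∈ S` take finitely many values
  have hfin : (range fun S : Set (Fin N) => P.real (X 0 ⁻¹' S)).Finite := finite_range _
  have hev : ∀ᶠ n : ℕ in atTop, P.real {ω | (n : ℝ) < |Y ω|} ∉
      (range fun S : Set (Fin N) => P.real (X 0 ⁻¹' S)) \ {0} := by
    have hclosed : IsClosed ((range fun S : Set (Fin N) => P.real (X 0 ⁻¹' S)) \ {0}) :=
      hfin.sdiff.isClosed
    exact hlim.eventually (hclosed.isOpen_compl.mem_nhds (by simp))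
  obtain ⟨n, hn⟩ := hev.exists
  have h5 : P.real {ω | (n : ℝ) < |Y ω|} = 0 := by
    by_contra hne
    exact hn ⟨⟨S n, (measureReal_congr (hS n)).symm⟩, hne⟩
  refine ⟨n, ?_⟩
  rw [measureReal_eq_zero_iff] at h5
  filter_upwards [measure_eq_zero_iff_ae_notMem.1 h5] with ω hω
  exact not_lt.1 hω

/-- Constant times are stopping times. -/
lemma const_mem_stoppingTimes (F : Filtration ℝ≥0 ‹MeasurableSpace Ω›) {t r T : ℝ≥0} (htr : t ≤ r)
    (hr : r ≤ T) : (fun _ => r) ∈ stoppingTimes F t T :=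
  ⟨isStoppingTime_const F r, fun _ => ⟨htr, hr⟩⟩

/-- The discounted value is integrable: by the equation between the times `0` and `t`, it differs
from its bounded initial value by integrable terms. -/
theorem integrable_discV (hX : IsMarkovChain P A X)
    (hC : ∀ i j, Measurable fun t => C t i j) (hD : ∀ i, Measurable fun t => D t i)
    (hC' : ∃ c : ℝ, ∀ t ≤ T, ∀ i j, |C t i j| ≤ c)
    (hD' : ∃ c : ℝ, ∀ t ≤ T, ∀ i, |D t i| ≤ c) {s : ℝ}
    (h : IsDiscountedSolution P s A X C D T G V Z K) {t : ℝ≥0} (ht : t ≤ T) :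
    Integrable (discV X C D V t) P := by
  have hm : Measurable (discV X C D V t) :=
    (measurable_discV hX hC hD h.toIsReflected t).mono ((chainFiltration P X).le t) le_rfl
  obtain ⟨c, hc⟩ := exists_bound_zero (measurable_discV hX hC hD h.toIsReflected 0)
  obtain ⟨b, hbm, hb0, hb2, hb⟩ := exists_sdf_bound hX hC' hD'
  have hH := integrable_discDriver hX hC hD hC' hD' h.toIsReflected s
  have hL := integrable_stopped hX hC hD hC' hD' h.toIsReflected
    (const_mem_stoppingTimes (chainFiltration P X) (zero_le (a := t)) ht)
  have hbK : Integrable (fun ω => b ω * K T ω) P := hb2.integrable_mul h.K_sq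
  refine Integrable.mono' ((((integrable_const c).add hH.norm.integral_prod_left).add hbK).add
    hL.norm) hm.aestronglyMeasurable ?_
  filter_upwards [hc, ae_discounted hX hC hD hC' hD' h, hH.prod_right_ae] with ω hω hdec hHω
  have e := hdec.2 0 t zero_le ht
  have : NullSingletonClass (stieltjes fun u => K u ω) :=
    stieltjes_nullSingleton (h.K_monotone ω) (h.K_continuous ω)
  have hfin : IsFiniteMeasure ((stieltjes fun u => K u ω).restrict (Ioc 0 t)) :=
    stieltjes_finite (h.K_monotone ω) (h.K_continuous ω) 0 t
  have e1 : ‖∫ u in Ioc 0 t, discDriver s A X C D u ω (discZ X C D Z u ω) ∂leb‖ ≤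
      ∫ u in Ioc 0 T, ‖discDriver s A X C D u ω (discZ X C D Z u ω)‖ ∂leb :=
    (norm_integral_le_integral_norm _).trans (setIntegral_mono_set hHω.norm
      (Eventually.of_forall fun _ => norm_nonneg _) (Ioc_subset_Ioc_right ht).eventuallyLE)
  have e2 : ‖∫ u in Ioc 0 t, sdf X C D u ω ∂(stieltjes fun u => K u ω)‖ ≤ b ω * K T ω := by
    have hreal : (stieltjes fun u => K u ω).real (Ioc 0 t) = K t ω := by
      rw [measureReal_def, stieltjes_Ioc (h.K_monotone ω) (h.K_continuous ω) 0 t,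
        ENNReal.toReal_ofReal (sub_nonneg.2 (h.K_monotone ω zero_le))]
      simp only [h.K_zero, sub_zero]
    refine (norm_setIntegral_le_of_norm_le_const (C := b ω) ?_ fun u hu => ?_).trans ?_
    · rw [← Measure.restrict_apply_univ]; exact measure_lt_top _ _
    · rw [Real.norm_of_nonneg (sdf_pos u).le]
      exact hb ω u (hu.2.trans ht)
    · rw [hreal]
      exact mul_le_mul_of_nonneg_left (h.K_monotone ω ht) (hb0 ω)
  have e3 : discV X C D V t ω = discV X C D V 0 ω
      - (∫ u in Ioc 0 t, discDriver s A X C D u ω (discZ X C D Z u ω) ∂leb)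
      - (∫ u in Ioc 0 t, sdf X C D u ω ∂(stieltjes fun u => K u ω))
      + (intM A X (intgd X C D V Z) t ω - intM A X (intgd X C D V Z) 0 ω) := by
    linear_combination -e
  rw [e3]
  refine (norm_add_le _ _).trans (add_le_add ((norm_sub_le _ _).trans (add_le_add
    ((norm_sub_le _ _).trans (add_le_add hω e1)) e2)) le_rfl)

end Decomp

/-! ### Extended conditional expectations -/

section CondExp

variable {Ω : Type*} {m m0 : MeasurableSpace Ω} {P : Measure Ω}

lemma condExpE_mono {ξ η : Ω → ℝ} (h : ξ ≤ᵐ[P] η) :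
    condExpE m P ξ ≤ᵐ[P] condExpE m P η := by
  filter_upwards [condLExp_mono (mΩ := m) (P := P) (h.mono fun ω hω => ENNReal.ofReal_le_ofReal hω),
    condLExp_mono (mΩ := m) (P := P)
      (h.mono fun ω hω => ENNReal.ofReal_le_ofReal (neg_le_neg hω))] with ω h1 h2
  exact EReal.sub_le_sub (EReal.coe_ennreal_le_coe_ennreal_iff.2 h1)
    (EReal.coe_ennreal_le_coe_ennreal_iff.2 h2)

/-- For an integrable random variable the extended conditional expectation is the usual one. -/
lemma condExpE_of_integrable {ξ : Ω → ℝ} (h : Integrable ξ P) :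
    condExpE m P ξ =ᵐ[P] fun ω => ((P[ξ | m]) ω : EReal) := by
  have key : ∀ η : Ω → ℝ, Integrable η P → ∀ᵐ ω ∂P,
      (condLExp m P (fun ω => ENNReal.ofReal (η ω)) ω : EReal) =
        ((P[fun ω => max (η ω) 0 | m]) ω : EReal) := by
    intro η hη
    have hfin : ∫⁻ ω, ENNReal.ofReal (η ω) ∂P ≠ ∞ :=
      ((lintegral_mono fun ω => Real.ofReal_le_enorm (η ω)).trans_lt hη.2).ne
    filter_upwards [toReal_condLExp m hη.1.aemeasurable.ennreal_ofReal hfin,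
      condLExp_ne_top (mΩ := m) hfin] with ω h1 h2
    have h3 : (fun ω => (ENNReal.ofReal (η ω)).toReal) = fun ω => max (η ω) 0 := by
      ext ω; rw [ENNReal.toReal_ofReal']
    rw [h3] at h1
    rw [← h1, EReal.coe_ennreal_toReal h2]
  have hsub : P[ξ | m] =ᵐ[P] P[fun ω => max (ξ ω) 0 | m] - P[fun ω => max (-ξ ω) 0 | m] := by
    have h1 := condExp_sub h.pos_part h.neg_part m
    refine EventuallyEq.trans (EventuallyEq.of_eq ?_) h1
    congr 1
    ext ω
    simp only [Pi.sub_apply]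
    rcases le_total (ξ ω) 0 with h0 | h0
    · rw [max_eq_right h0, max_eq_left (neg_nonneg.2 h0)]; ring
    · rw [max_eq_left h0, max_eq_right (neg_nonpos.2 h0)]; ring
  filter_upwards [key ξ h, key (fun ω => -ξ ω) h.neg, hsub] with ω h1 h2 h3
  rw [condExpE, h1, h2, h3, Pi.sub_apply, EReal.coe_sub]

end CondExp

/-! ### The first hitting time -/

section Hit

variable {Ω : Type*} {G V : ℝ≥0 → Ω → ℝ} {t T : ℝ≥0} {ω : Ω}

/-- An infimum of points of a set closed from the right belongs to the set. -/
lemma sInf_mem_of_right {S : Set ℝ≥0} (hne : S.Nonempty)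
    (hS : ∀ u, (∃ᶠ v in 𝓝[>] u, v ∈ S) → u ∈ S) : sInf S ∈ S := by
  by_contra hn
  refine hn (hS _ ?_)
  rw [frequently_iff]
  intro U hU
  obtain ⟨b, hb, hbU⟩ := mem_nhdsGT_iff_exists_Ioo_subset.1 hU
  obtain ⟨v, hv, hvb⟩ := exists_lt_of_csInf_lt hne hb
  have hle : sInf S ≤ v := csInf_le (OrderBot.bddBelow S) hv
  have hlt : sInf S < v := lt_of_le_of_ne hle fun e => hn (e ▸ hv)
  exact ⟨v, hbU ⟨hlt, hvb⟩, hv⟩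

/-- Since `V` and `G` are right-continuous, the infimum that defines the hitting time is attained. -/
lemma firstHit_mem (htT : t ≤ T) (hV : ∀ u, ContinuousWithinAt (fun v => V v ω) (Ici u) u)
    (hG : ∀ u, ContinuousWithinAt (fun v => G v ω) (Ici u) u) :
    t ≤ firstHit G V t T ω ∧ firstHit G V t T ω ≤ T ∧
      (V (firstHit G V t T ω) ω = G (firstHit G V t T ω) ω ∨ firstHit G V t T ω = T) := by
  refine sInf_mem_of_right (S := {u | t ≤ u ∧ u ≤ T ∧ (V u ω = G u ω ∨ u = T)})
    ⟨T, htT, le_rfl, Or.inr rfl⟩ fun u hu => ?_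
  have h1 : t ≤ u := by
    by_contra hlt
    obtain ⟨v, hv, hvt⟩ := (hu.and_eventually (Ioo_mem_nhdsGT (not_le.1 hlt))).exists
    exact absurd hv.1 (not_le.2 hvt.2)
  have h2 : u ≤ T := by
    obtain ⟨v, hv, hvt⟩ := (hu.and_eventually self_mem_nhdsWithin).exists
    exact (le_of_lt hvt).trans hv.2.1
  refine ⟨h1, h2, ?_⟩
  rcases h2.eq_or_lt with rfl | hlt
  · exact Or.inr rfl
  left
  have hf : ∃ᶠ v in 𝓝[>] u, V v ω - G v ω ∈ ({0} : Set ℝ) :=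
    (hu.and_eventually (Ioo_mem_nhdsGT hlt)).mono fun v ⟨hv, hvT⟩ => by
      rw [mem_singleton_iff, sub_eq_zero]
      exact hv.2.2.resolve_right hvT.2.ne
  have hc : Tendsto (fun v => V v ω - G v ω) (𝓝[>] u) (𝓝 (V u ω - G u ω)) :=
    ((hV u).sub (hG u)).tendsto.mono_left (nhdsWithin_mono _ Ioi_subset_Ici_self)
  exact sub_eq_zero.1 (isClosed_singleton.mem_of_frequently_of_tendsto hf hc)

lemma firstHit_le {u : ℝ≥0} (h1 : t ≤ u) (h2 : u ≤ T) (h3 : V u ω = G u ω ∨ u = T) :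
    firstHit G V t T ω ≤ u :=
  csInf_le (OrderBot.bddBelow _) ⟨h1, h2, h3⟩

/-- The increasing process is flat until `V` hits the obstacle. -/
lemma stieltjes_firstHit (htT : t ≤ T) (hV : ∀ u, ContinuousWithinAt (fun v => V v ω) (Ici u) u)
    (hG : ∀ u, ContinuousWithinAt (fun v => G v ω) (Ici u) u)
    (hobs : ∀ u ≤ T, G u ω ≤ V u ω) {k : ℝ≥0 → ℝ} (hk : Monotone k) (hc : Continuous k)
    (hmin : ∫⁻ u in Ioc 0 T, ENNReal.ofReal (V u ω - G u ω) ∂(stieltjes k) = 0) :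
    stieltjes k (Ioc t (firstHit G V t T ω)) = 0 := by
  have := stieltjes_nullSingleton hk hc
  obtain ⟨-, hle, -⟩ := firstHit_mem htT hV hG
  rw [← measure_congr Ioo_ae_eq_Ioc]
  have hm : Measurable fun u => ENNReal.ofReal (V u ω - G u ω) :=
    (measurable_of_rightContinuous fun u => (hV u).sub (hG u)).ennreal_ofReal
  rw [lintegral_eq_zero_iff hm, EventuallyEq, ae_restrict_iff' measurableSet_Ioc] at hmin
  refine measure_mono_null (fun u hu => ?_) hmin
  have huT : u ≤ T := hu.2.le.trans hle
  have hne : V u ω ≠ G u ω := fun e => absurd (firstHit_le hu.1.le huT (Or.inl e)) (not_le.2 hu.2)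
  simp only [mem_compl_iff, mem_ofPred_eq, Pi.zero_apply, ENNReal.ofReal_eq_zero, not_forall,
    sub_nonpos, not_le]
  exact ⟨⟨(zero_le (a := t)).trans_lt hu.1, huT⟩, lt_of_le_of_ne (hobs u huT) hne.symm⟩

end Hit

/-! ### Rewards of stopping times -/

section Optimal

variable {Ω : Type*} [MeasurableSpace Ω] {P : Measure Ω} {N : ℕ}
  {A C : ℝ≥0 → Matrix (Fin N) (Fin N) ℝ} {X : ℝ≥0 → Ω → Fin N} {D : ℝ≥0 → Fin N → ℝ} {T : ℝ≥0}
  {G V : ℝ≥0 → Ω → ℝ} {Z : ℝ≥0 → Ω → Fin N → ℝ} {K : ℝ≥0 → Ω → ℝ} [IsProbabilityMeasure P]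

/-- The value `Ṽ_t` plus a martingale increment up to `τ` is integrable and has conditional
expectation `Ṽ_t`. It dominates the reward of `τ`. -/
lemma condExp_value_add (hX : IsMarkovChain P A X)
    (hC : ∀ i j, Measurable fun t => C t i j) (hD : ∀ i, Measurable fun t => D t i)
    (hC' : ∃ c : ℝ, ∀ t ≤ T, ∀ i j, |C t i j| ≤ c)
    (hD' : ∃ c : ℝ, ∀ t ≤ T, ∀ i, |D t i| ≤ c) {s : ℝ}
    (h : IsDiscountedSolution P s A X C D T G V Z K) {t : ℝ≥0} (ht : t ≤ T)
    {τ : Ω → ℝ≥0} (hτ : τ ∈ stoppingTimes (chainFiltration P X) t T) :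
    Integrable (fun ω => discV X C D V t ω +
        (intM A X (intgd X C D V Z) (τ ω) ω - intM A X (intgd X C D V Z) t ω)) P ∧
      P[fun ω => discV X C D V t ω +
        (intM A X (intgd X C D V Z) (τ ω) ω - intM A X (intgd X C D V Z) t ω)
        | chainFiltration P X t] =ᵐ[P] discV X C D V t := by
  have hV := integrable_discV hX hC hD hC' hD' h ht
  have hL := integrable_stopped hX hC hD hC' hD' h.toIsReflected hτ
  refine ⟨hV.add hL, ?_⟩
  have hself : P[discV X C D V t | chainFiltration P X t] = discV X C D V t :=
    condExp_of_stronglyMeasurable ((chainFiltration P X).le t)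
      (measurable_discV hX hC hD h.toIsReflected t).stronglyMeasurable hV
  filter_upwards [condExp_add hV hL (chainFiltration P X t),
    condExp_stopped hX hC hD hC' hD' h.toIsReflected hτ] with ω h1 h2
  refine h1.trans ?_
  rw [Pi.add_apply, h2, hself]
  simp

/-- Along almost every path, the reward of stopping at any time `r ∈ [t, T]` is at most the value
plus the martingale increment, with equality at the first hitting time of the obstacle. -/
lemma ae_reward_le (hX : IsMarkovChain P A X)
    (hC : ∀ i j, Measurable fun t => C t i j) (hD : ∀ i, Measurable fun t => D t i)
    (hC' : ∃ c : ℝ, ∀ t ≤ T, ∀ i j, |C t i j| ≤ c)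
    (hD' : ∃ c : ℝ, ∀ t ≤ T, ∀ i, |D t i| ≤ c)
    (hG : ∀ ω t, ContinuousWithinAt (fun u => G u ω) (Ici t) t) {s : ℝ}
    (h : IsDiscountedSolution P s A X C D T G V Z K) {t : ℝ≥0} (ht : t ≤ T) (τ : Ω → ℝ≥0)
    (hτ : ∀ ω, t ≤ τ ω ∧ τ ω ≤ T) :
    ∀ᵐ ω ∂P, reward s A X C D T G Z t τ ω ≤ discV X C D V t ω +
        (intM A X (intgd X C D V Z) (τ ω) ω - intM A X (intgd X C D V Z) t ω) ∧
      (τ ω = firstHit G V t T ω → reward s A X C D T G Z t τ ω = discV X C D V t ω +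
        (intM A X (intgd X C D V Z) (τ ω) ω - intM A X (intgd X C D V Z) t ω)) := by
  filter_upwards [ae_discounted hX hC hD hC' hD' h, h.obstacle, h.minimal]
    with ω hω hobs hmin
  have e := hω.2 t (τ ω) (hτ ω).1 (hτ ω).2
  have hκ : 0 ≤ ∫ u in Ioc t (τ ω), sdf X C D u ω ∂(stieltjes fun u => K u ω) :=
    integral_nonneg fun u => (sdf_pos u).le
  have hrew : reward s A X C D T G Z t τ ω =
      (∫ u in Ioc t (τ ω), discDriver s A X C D u ω (discZ X C D Z u ω) ∂leb)
        + sdf X C D (τ ω) ω * G (τ ω) ω := by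
    rw [reward]
    rcases (hτ ω).2.eq_or_lt with hT | hT
    · rw [if_neg hT.not_lt, if_pos hT, hT, add_zero]
    · rw [if_pos hT, if_neg hT.ne, add_zero]
  have hle : sdf X C D (τ ω) ω * G (τ ω) ω ≤ discV X C D V (τ ω) ω :=
    mul_le_mul_of_nonneg_left (hobs _ (hτ ω).2) (sdf_pos _).le
  refine ⟨by rw [hrew]; linarith, fun hhit => ?_⟩
  have hVr := (h.V_rcll ω).1
  have hz : ∫ u in Ioc t (τ ω), sdf X C D u ω ∂(stieltjes fun u => K u ω) = 0 := by
    rw [hhit]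
    exact setIntegral_measure_zero _ (stieltjes_firstHit ht hVr (hG ω) hobs (h.K_monotone ω)
      (h.K_continuous ω) hmin)
  have hGV : G (τ ω) ω = V (τ ω) ω := by
    rcases (firstHit_mem ht hVr (hG ω)).2.2 with h1 | h1
    · rw [hhit, h1]
    · rw [hhit, h1, hω.1]
  rw [hrew, hGV]
  rw [discV, discV] at e
  rw [discV]
  linarith

/-- The value of a solution of the discounted equation is the essential supremum of the expected
rewards, and it is attained by every stopping time that is almost surely the first hitting time of
the obstacle. -/
theorem isEssSup_reward (hX : IsMarkovChain P A X)
    (hC : ∀ i j, Measurable fun t => C t i j) (hD : ∀ i, Measurable fun t => D t i)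
    (hC' : ∃ c : ℝ, ∀ t ≤ T, ∀ i j, |C t i j| ≤ c)
    (hD' : ∃ c : ℝ, ∀ t ≤ T, ∀ i, |D t i| ≤ c)
    (hG : ∀ ω t, ContinuousWithinAt (fun u => G u ω) (Ici t) t) {s : ℝ}
    (h : IsDiscountedSolution P s A X C D T G V Z K) {t : ℝ≥0} (ht : t ≤ T) {τ : Ω → ℝ≥0}
    (hτ : τ ∈ stoppingTimes (chainFiltration P X) t T) (hhit : τ =ᵐ[P] firstHit G V t T) :
    IsEssSup P ((fun τ => condExpE (chainFiltration P X t) P (reward s A X C D T G Z t τ)) ''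
        stoppingTimes (chainFiltration P X) t T) (fun ω => (discV X C D V t ω : EReal)) ∧
      Integrable (reward s A X C D T G Z t τ) P ∧
      discV X C D V t =ᵐ[P] P[reward s A X C D T G Z t τ | chainFiltration P X t] := by
  have hup : ∀ τ ∈ stoppingTimes (chainFiltration P X) t T,
      condExpE (chainFiltration P X t) P (reward s A X C D T G Z t τ) ≤ᵐ[P]
        fun ω => (discV X C D V t ω : EReal) := by
    intro τ hτ
    obtain ⟨h1, h2⟩ := condExp_value_add hX hC hD hC' hD' h ht hτ
    filter_upwards [condExpE_mono (m := chainFiltration P X t)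
      ((ae_reward_le hX hC hD hC' hD' hG h ht τ hτ.2).mono fun ω hω => hω.1),
      condExpE_of_integrable (m := chainFiltration P X t) h1, h2] with ω h3 h4 h5
    rw [h4, h5] at h3
    exact h3
  obtain ⟨h1, h2⟩ := condExp_value_add hX hC hD hC' hD' h ht hτ
  have heq : reward s A X C D T G Z t τ =ᵐ[P] fun ω => discV X C D V t ω +
      (intM A X (intgd X C D V Z) (τ ω) ω - intM A X (intgd X C D V Z) t ω) := by
    filter_upwards [ae_reward_le hX hC hD hC' hD' hG h ht τ hτ.2, hhit] with ω h3 h4 using h3.2 h4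
  have hint : Integrable (reward s A X C D T G Z t τ) P := h1.congr heq.symm
  have hce : discV X C D V t =ᵐ[P] P[reward s A X C D T G Z t τ | chainFiltration P X t] :=
    ((condExp_congr_ae heq).trans h2).symm
  refine ⟨⟨?_, ?_, ?_⟩, hint, hce⟩
  · exact ((measurable_discV hX hC hD h.toIsReflected t).mono ((chainFiltration P X).le t)
      le_rfl).coe_real_ereal.aemeasurable
  · rintro _ ⟨τ, hτ, rfl⟩
    exact hup τ hτ
  · intro Y' _ hY'
    filter_upwards [hY' _ ⟨τ, hτ, rfl⟩,
      condExpE_of_integrable (m := chainFiltration P X t) hint, hce] with ω h3 h4 h5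
    rw [h4, ← h5] at h3
    exact h3

end Optimal

/-! ### The first hitting time is a stopping time -/

section RightContinuous

variable {Ω : Type*} {N : ℕ} {X : ℝ≥0 → Ω → Fin N}

/-- On the event that `X` is constant on `[u, v]`, every event known at time `v` agrees with one
known at time `u`. -/
lemma exists_trace_eq (u v : ℝ≥0) {B : Set Ω}
    (hB : MeasurableSet[⨆ w : Iic v, MeasurableSpace.comap (X w) ⊤] B) :
    ∃ B', MeasurableSet[⨆ w : Iic u, MeasurableSpace.comap (X w) ⊤] B' ∧
      ∀ ω, (∀ w ∈ Icc u v, X w ω = X u ω) → (ω ∈ B ↔ ω ∈ B') := by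
  let m : MeasurableSpace Ω :=
    { MeasurableSet' := fun B =>
        ∃ B', MeasurableSet[⨆ w : Iic u, MeasurableSpace.comap (X w) ⊤] B' ∧
          ∀ ω, (∀ w ∈ Icc u v, X w ω = X u ω) → (ω ∈ B ↔ ω ∈ B')
      measurableSet_empty := ⟨∅, @MeasurableSet.empty _ (⨆ w : Iic u, MeasurableSpace.comap (X w) ⊤),
        fun _ _ => Iff.rfl⟩
      measurableSet_compl := by
        rintro B ⟨B', h1, h2⟩
        exact ⟨B'ᶜ, h1.compl, fun ω hω => not_congr (h2 ω hω)⟩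
      measurableSet_iUnion := by
        intro f hf
        choose g h1 h2 using hf
        refine ⟨⋃ i, g i, MeasurableSet.iUnion h1, fun ω hω => ?_⟩
        simp only [mem_iUnion]
        exact exists_congr fun i => h2 i ω hω }
  have hle : (⨆ w : Iic v, MeasurableSpace.comap (X w) ⊤) ≤ m := by
    refine iSup_le fun w => ?_
    rintro _ ⟨S, -, rfl⟩
    have key : ∀ r ≤ u, MeasurableSet[⨆ w : Iic u, MeasurableSpace.comap (X w) ⊤] (X r ⁻¹' S) :=
      fun r hr => le_iSup (fun w : Iic u => MeasurableSpace.comap (X w) ⊤) ⟨r, hr⟩ _ ⟨S, trivial, rfl⟩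
    rcases le_total (w : ℝ≥0) u with hw | hw
    · exact ⟨_, key w hw, fun _ _ => Iff.rfl⟩
    · refine ⟨_, key u le_rfl, fun ω hω => ?_⟩
      rw [mem_preimage, mem_preimage, hω w ⟨hw, w.2⟩]
  exact hle _ hB

/-- The augmented filtration of a right-continuous process with finitely many states is
right-continuous: immediately after time `u` the process has not moved yet. -/
lemma chainFiltration_isRightContinuous {m0 : MeasurableSpace Ω} (P : Measure Ω)
    (hx : ∀ ω, IsRCLL fun t => X t ω) : (chainFiltration P X).IsRightContinuous := by
  refine ⟨fun u => ?_⟩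
  rw [Filtration.rightCont_eq]
  intro B hB
  have hB' : ∀ v > u, MeasurableSet[chainFiltration P X v] B := fun v hv =>
    (iInf₂_le v hv : (⨅ j > u, chainFiltration P X j) ≤ _) _ hB
  have hpos : ∀ n : ℕ, u < u + 1 / (n + 1 : ℝ≥0) := fun n => lt_add_of_pos_right u (by positivity)
  have h1 : ∀ n : ℕ, ∃ C, MeasurableSet[⨆ w : Iic (u + 1 / (n + 1 : ℝ≥0)),
      MeasurableSpace.comap (X w) ⊤] C ∧ B =ᵐ[P] C := fun n => (hB' _ (hpos n)).2
  choose C hC hBC using h1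
  choose B' hB'm hB'e using fun n => exists_trace_eq (X := X) u _ (hC n)
  refine ⟨(hB' _ (hpos 0)).1, ⋃ m, ⋂ n ≥ m, B' n,
    MeasurableSet.iUnion fun m => MeasurableSet.iInter fun n => MeasurableSet.iInter fun _ => hB'm n,
    ?_⟩
  have hall : ∀ᵐ ω ∂P, ∀ n, (ω ∈ B ↔ ω ∈ C n) :=
    ae_all_iff.2 fun n => (hBC n).mem_iff
  filter_upwards [hall] with ω hω
  obtain ⟨m, hm⟩ : ∃ m : ℕ, ∀ w ∈ Icc u (u + 1 / (m + 1 : ℝ≥0)), X w ω = X u ω := by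
    have hev : ∀ᶠ w in 𝓝[≥] u, X w ω = X u ω :=
      ((hx ω).1 u).tendsto.eventually (p := fun i => i = X u ω) (by
        rw [nhds_discrete]; exact eventually_pure.2 rfl)
    obtain ⟨b, hb, hbs⟩ := mem_nhdsGE_iff_exists_Ico_subset.1 hev
    obtain ⟨m, hm⟩ := exists_nat_one_div_lt (show (0 : ℝ≥0) < b - u from tsub_pos_of_lt hb)
    refine ⟨m, fun w hw => hbs ⟨hw.1, hw.2.trans_lt ?_⟩⟩
    rw [add_comm]
    exact lt_tsub_iff_right.1 hm
  have hBn : ∀ n ≥ m, (ω ∈ B ↔ ω ∈ B' n) := fun n hn =>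
    (hω n).trans (hB'e n ω fun w hw => hm w ⟨hw.1, hw.2.trans (by gcongr)⟩)
  refine propext (Iff.intro (fun h => ?_) fun h => ?_)
  · exact mem_iUnion.2 ⟨m, mem_iInter₂.2 fun n hn => (hBn n hn).1 h⟩
  · obtain ⟨k, hk⟩ := mem_iUnion.1 h
    exact (hBn (max k m) (le_max_right _ _)).2 (mem_iInter₂.1 hk _ (le_max_left _ _))

end RightContinuous

section Debut

variable {Ω : Type*} {m0 : MeasurableSpace Ω} {F : Filtration ℝ≥0 m0} {Y : ℝ≥0 → Ω → ℝ}
  {t T : ℝ≥0}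

/-- The first time after `σ` at which `Y` gets below `ε`, and `T` if there is none before `T`. -/
noncomputable def entryBelow (Y : ℝ≥0 → Ω → ℝ) (T : ℝ≥0) (ε : ℝ) (σ : Ω → ℝ≥0) (ω : Ω) : ℝ≥0 :=
  sInf {u | σ ω ≤ u ∧ u ≤ T ∧ (Y u ω < ε ∨ u = T)}

lemma le_entryBelow {ε : ℝ} {σ : Ω → ℝ≥0} {ω : Ω} (h : σ ω ≤ T) : σ ω ≤ entryBelow Y T ε σ ω :=
  le_csInf ⟨T, h, le_rfl, Or.inr rfl⟩ fun _ hu => hu.1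

lemma entryBelow_le {ε : ℝ} {σ : Ω → ℝ≥0} {ω : Ω} {u : ℝ≥0} (h1 : σ ω ≤ u) (h2 : u ≤ T)
    (h3 : Y u ω < ε ∨ u = T) : entryBelow Y T ε σ ω ≤ u :=
  csInf_le (OrderBot.bddBelow _) ⟨h1, h2, h3⟩

lemma entryBelow_mem [F.IsRightContinuous] (hY : ∀ u, Measurable[F u] (Y u))
    (hYc : ∀ ω u, ContinuousWithinAt (fun v => Y v ω) (Ici u) u) {σ : Ω → ℝ≥0}
    (hσ : σ ∈ stoppingTimes F t T) (ε : ℝ) : entryBelow Y T ε σ ∈ stoppingTimes F t T := by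
  refine ⟨?_, fun ω => ⟨(hσ.2 ω).1.trans (le_entryBelow (hσ.2 ω).2),
    entryBelow_le (hσ.2 ω).2 le_rfl (Or.inr rfl)⟩⟩
  refine isStoppingTime_of_measurableSet_lt_of_isRightContinuous fun i => ?_
  simp only [WithTop.coe_lt_coe]
  rcases lt_or_ge T i with hi | hi
  · have : {ω | entryBelow Y T ε σ ω < i} = univ := eq_univ_of_forall fun ω =>
      (entryBelow_le (hσ.2 ω).2 le_rfl (Or.inr rfl)).trans_lt hi
    rw [this]
    exact MeasurableSet.univ
  have h1 : {ω | entryBelow Y T ε σ ω < i} = ⋃ q : ℚ, ⋃ _ : Real.toNNReal q < i,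
      {ω | σ ω ≤ Real.toNNReal q} ∩ {ω | Y (Real.toNNReal q) ω < ε} := by
    ext ω
    simp only [mem_ofPred_eq, mem_iUnion, mem_inter_iff, exists_prop]
    constructor
    · intro h
      obtain ⟨u, ⟨hu1, hu2, hu3⟩, hui⟩ := exists_lt_of_csInf_lt
        (s := {u | σ ω ≤ u ∧ u ≤ T ∧ (Y u ω < ε ∨ u = T)}) ⟨T, (hσ.2 ω).2, le_rfl, Or.inr rfl⟩ h
      have hYu : Y u ω < ε := hu3.resolve_right (hui.trans_le hi).ne
      have hev : ∀ᶠ v in 𝓝[>] u, Y v ω < ε ∧ v < i :=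
        (((hYc ω u).tendsto.mono_left (nhdsWithin_mono _ Ioi_subset_Ici_self)).eventually
          (gt_mem_nhds hYu)).and (mem_nhdsWithin_of_mem_nhds (Iio_mem_nhds hui))
      obtain ⟨b, hb, hbs⟩ := mem_nhdsGT_iff_exists_Ioo_subset.1 hev
      obtain ⟨q, hq1, hq2⟩ := exists_rat_btwn (show (u : ℝ) < b by exact_mod_cast hb)
      have e : ((Real.toNNReal q : ℝ≥0) : ℝ) = q := Real.coe_toNNReal _ (u.2.trans hq1.le)
      have hu : u < Real.toNNReal q := by rw [← NNReal.coe_lt_coe, e]; exact hq1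
      have hqb : Real.toNNReal q < b := by rw [← NNReal.coe_lt_coe, e]; exact hq2
      obtain ⟨h1, h2⟩ := hbs ⟨hu, hqb⟩
      exact ⟨q, h2, hu1.trans hu.le, h1⟩
    · rintro ⟨q, hq, h1, h2⟩
      exact (entryBelow_le h1 (hq.le.trans hi) (Or.inl h2)).trans_lt hq
  rw [h1]
  refine MeasurableSet.iUnion fun q => MeasurableSet.iUnion fun hq => F.mono hq.le _ ?_
  have h2 := hσ.1 (Real.toNNReal q)
  simp only [WithTop.coe_le_coe] at h2
  exact h2.inter (hY _ measurableSet_Iio)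

lemma measurable_of_mem_stoppingTimes {σ : Ω → ℝ≥0} (hσ : σ ∈ stoppingTimes F t T) :
    Measurable σ := by
  refine measurable_of_Iic fun u => F.le u _ ?_
  have h2 := hσ.1 u
  simp only [WithTop.coe_le_coe] at h2
  exact h2

lemma iSup_mem_stoppingTimes {σ : ℕ → Ω → ℝ≥0} (hσ : ∀ n, σ n ∈ stoppingTimes F t T) :
    (fun ω => ⨆ n, σ n ω) ∈ stoppingTimes F t T := by
  have hb : ∀ ω, BddAbove (range fun n => σ n ω) := fun ω =>
    ⟨T, by rintro _ ⟨n, rfl⟩; exact ((hσ n).2 ω).2⟩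
  refine ⟨fun u => ?_, fun ω => ⟨((hσ 0).2 ω).1.trans (le_ciSup (hb ω) 0),
    ciSup_le fun n => ((hσ n).2 ω).2⟩⟩
  have h1 : {ω | ((⨆ n, σ n ω : ℝ≥0) : WithTop ℝ≥0) ≤ u} = ⋂ n, {ω | (σ n ω : WithTop ℝ≥0) ≤ u} := by
    ext ω
    simp only [mem_ofPred_eq, WithTop.coe_le_coe, mem_iInter]
    exact ciSup_le_iff (hb ω)
  rw [h1]
  exact MeasurableSet.iInter fun n => (hσ n).1 u

variable {P : Measure Ω} [IsProbabilityMeasure P]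

/-- Among the stopping times that are almost surely at most `ρ` there is one of maximal mean. -/
lemma exists_maximal_stoppingTime {ρ : Ω → ℝ≥0} (htT : t ≤ T) (hρ : ∀ ω, t ≤ ρ ω) :
    ∃ σ ∈ stoppingTimes F t T, σ ≤ᵐ[P] ρ ∧
      ∀ σ' ∈ stoppingTimes F t T, σ' ≤ᵐ[P] ρ → (∀ ω, σ ω ≤ σ' ω) → σ =ᵐ[P] σ' := by
  set S : Set ℝ≥0∞ := (fun σ : Ω → ℝ≥0 => ∫⁻ ω, σ ω ∂P) ''
    {σ | σ ∈ stoppingTimes F t T ∧ σ ≤ᵐ[P] ρ} with hS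
  have hne : S.Nonempty := ⟨_, fun _ => t, ⟨const_mem_stoppingTimes F le_rfl htT,
    Eventually.of_forall hρ⟩, rfl⟩
  obtain ⟨u, -, hu, huS⟩ := exists_seq_tendsto_sSup hne (OrderTop.bddAbove S)
  choose σ hσ hσu using huS
  have hb : ∀ ω, BddAbove (range fun n => σ n ω) := fun ω =>
    ⟨T, by rintro _ ⟨n, rfl⟩; exact ((hσ n).1.2 ω).2⟩
  have hmem := iSup_mem_stoppingTimes fun n => (hσ n).1
  refine ⟨_, hmem, ?_, fun σ' h1 h2 h3 => ?_⟩
  · filter_upwards [ae_all_iff.2 fun n => (hσ n).2] with ω hω using ciSup_le hω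
  have hfin : ∫⁻ ω, ((⨆ n, σ n ω : ℝ≥0) : ℝ≥0∞) ∂P ≠ ∞ := by
    refine ((lintegral_mono (g := fun _ => (T : ℝ≥0∞)) fun ω => ?_).trans_lt ?_).ne
    · exact ENNReal.coe_le_coe.2 (hmem.2 ω).2
    · simp
  have hle : ∫⁻ ω, (σ' ω : ℝ≥0∞) ∂P ≤ ∫⁻ ω, ((⨆ n, σ n ω : ℝ≥0) : ℝ≥0∞) ∂P := by
    have hS' : ∫⁻ ω, (σ' ω : ℝ≥0∞) ∂P ∈ S := ⟨σ', ⟨h1, h2⟩, rfl⟩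
    refine (le_sSup hS').trans (le_of_tendsto' hu fun n => ?_)
    rw [← hσu n]
    exact lintegral_mono fun ω => ENNReal.coe_le_coe.2 (le_ciSup (hb ω) n)
  have := ae_eq_of_ae_le_of_lintegral_le
    (Eventually.of_forall fun ω => ENNReal.coe_le_coe.2 (h3 ω)) hfin
    (measurable_of_mem_stoppingTimes h1).coe_nnreal_ennreal.aemeasurable hle
  filter_upwards [this] with ω hω using ENNReal.coe_injective hω

variable {G V : ℝ≥0 → Ω → ℝ}

/-- The first hitting time of the obstacle agrees almost surely with a stopping time. Let `σ` be a
maximal stopping time below it. The first time after `σ` at which `V - G < ε` is another one, hence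
equals `σ`, so that `V = G` at time `σ` by right-continuity. -/
theorem exists_stoppingTime_firstHit [F.IsRightContinuous] (htT : t ≤ T)
    (hVm : ∀ u, Measurable[F u] (V u)) (hGm : ∀ u, Measurable[F u] (G u))
    (hV : ∀ ω u, ContinuousWithinAt (fun v => V v ω) (Ici u) u)
    (hG : ∀ ω u, ContinuousWithinAt (fun v => G v ω) (Ici u) u)
    (hobs : ∀ᵐ ω ∂P, ∀ u ≤ T, G u ω ≤ V u ω) :
    ∃ τ ∈ stoppingTimes F t T, τ =ᵐ[P] firstHit G V t T := by
  obtain ⟨σ, hσ, hσle, hmax⟩ := exists_maximal_stoppingTime (F := F) (P := P) htT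
    fun ω => (firstHit_mem htT (hV ω) (hG ω)).1
  refine ⟨σ, hσ, ?_⟩
  have hYm : ∀ u, Measurable[F u] (fun ω => V u ω - G u ω) := fun u => (hVm u).sub (hGm u)
  have hYc : ∀ ω u, ContinuousWithinAt (fun v => V v ω - G v ω) (Ici u) u := fun ω u =>
    (hV ω u).sub (hG ω u)
  have hpos : ∀ n : ℕ, (0 : ℝ) < 1 / (n + 1) := fun n => by positivity
  have heq : ∀ n : ℕ, σ =ᵐ[P] entryBelow (fun u ω => V u ω - G u ω) T (1 / (n + 1)) σ := by
    intro n
    refine hmax _ (entryBelow_mem hYm hYc hσ _) ?_ fun ω => le_entryBelow (hσ.2 ω).2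
    filter_upwards [hσle] with ω hω
    obtain ⟨h1, h2, h3⟩ := firstHit_mem htT (hV ω) (hG ω)
    refine entryBelow_le hω h2 (h3.imp_left fun h => ?_)
    rw [h, sub_self]
    exact hpos n
  filter_upwards [hσle, hobs, ae_all_iff.2 heq] with ω hω hobsω hn
  refine le_antisymm hω ?_
  obtain ⟨h1, h2⟩ := hσ.2 ω
  rcases h2.eq_or_lt with hT | hT
  · exact firstHit_le h1 h2 (Or.inr hT)
  refine firstHit_le h1 h2 (Or.inl (le_antisymm ?_ (hobsω _ h2)))
  have hle : ∀ n : ℕ, V (σ ω) ω - G (σ ω) ω ≤ 1 / (n + 1) := by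
    intro n
    by_contra hlt
    have hev : ∀ᶠ v in 𝓝[≥] σ ω, (1 / (n + 1) : ℝ) < V v ω - G v ω ∧ v < T :=
      ((hYc ω (σ ω)).tendsto.eventually (lt_mem_nhds (not_le.1 hlt))).and
        (mem_nhdsWithin_of_mem_nhds (Iio_mem_nhds hT))
    obtain ⟨b, hb, hbs⟩ := mem_nhdsGE_iff_exists_Ico_subset.1 hev
    have hbe : b ≤ entryBelow (fun u ω => V u ω - G u ω) T (1 / (n + 1)) σ ω := by
      refine le_csInf ⟨T, h2, le_rfl, Or.inr rfl⟩ fun v hv => ?_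
      by_contra hvb
      obtain ⟨h3, h4⟩ := hbs ⟨hv.1, not_le.1 hvb⟩
      exact hv.2.2.elim (fun h => lt_asymm h h3) h4.ne
    rw [← hn n] at hbe
    exact absurd hb (not_lt.2 hbe)
  have := ge_of_tendsto' (tendsto_one_div_add_atTop_nhds_zero_nat (𝕜 := ℝ)) hle
  linarith

/-- Over a complete probability space, a time that is almost surely equal to a stopping time of the
augmented filtration is one itself. -/
lemma mem_stoppingTimes_of_ae_eq {N : ℕ} {X : ℝ≥0 → Ω → Fin N} [P.IsComplete] {τ ρ : Ω → ℝ≥0}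
    (hτ : τ ∈ stoppingTimes (chainFiltration P X) t T) (h : τ =ᵐ[P] ρ)
    (hρ : ∀ ω, t ≤ ρ ω ∧ ρ ω ≤ T) : ρ ∈ stoppingTimes (chainFiltration P X) t T := by
  refine ⟨fun u => ?_, hρ⟩
  obtain ⟨h1, B, hB, h2⟩ := hτ.1 u
  have h3 : {ω | (ρ ω : WithTop ℝ≥0) ≤ u} =ᵐ[P] {ω | (τ ω : WithTop ℝ≥0) ≤ u} := by
    filter_upwards [h] with ω hω
    change ((ρ ω : WithTop ℝ≥0) ≤ u) = ((τ ω : WithTop ℝ≥0) ≤ u)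
    rw [hω]
  exact ⟨(h1.nullMeasurableSet.congr h3.symm).measurable_of_complete, B, hB, h3.trans h2⟩

end Debut

/-! ### From the undiscounted to the discounted equation -/

section PartOne

variable {Ω : Type*} [MeasurableSpace Ω] {P : Measure Ω} {N : ℕ}
  {A C : ℝ≥0 → Matrix (Fin N) (Fin N) ℝ} {X : ℝ≥0 → Ω → Fin N} {D : ℝ≥0 → Fin N → ℝ} {T : ℝ≥0}
  {G V : ℝ≥0 → Ω → ℝ} {Z : ℝ≥0 → Ω → Fin N → ℝ} {K : ℝ≥0 → Ω → ℝ}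

lemma ae_integrableOn_seminormSq [IsProbabilityMeasure P] (hX : IsMarkovChain P A X)
    (h : IsReflected P A X T G V Z K) :
    ∀ᵐ ω ∂P, IntegrableOn (fun u => seminormSq A X u ω (Z u ω)) (Ioc 0 T) leb := by
  have hst : Measurable fun p : Ω × ℝ≥0 => X p.2 p.1 :=
    measurable_uncurry (fun ω => (hX.rcll ω).1) hX.measurable
  have hm : Measurable fun p : Ω × ℝ≥0 => seminormSq A X p.2 p.1 (Z p.2 p.1) := by
    simp only [seminormSq_eq X hX.rate]
    refine measurable_select
      (f := fun i (p : Ω × ℝ≥0) => ∑ j, A p.2 j i * (Z p.2 p.1 j - Z p.2 p.1 i) ^ 2) hst fun i => ?_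
    have hZ : ∀ j, Measurable fun p : Ω × ℝ≥0 => Z p.2 p.1 j := fun j =>
      (measurable_Z h j).comp measurable_swap
    exact Finset.measurable_sum _ fun j _ => ((hX.rate.measurable j i).comp measurable_snd).mul
      (((hZ j).sub (hZ i)).pow_const 2)
  filter_upwards [ae_lt_top hm.ennreal_ofReal.lintegral_prod_right' h.Z_sq.ne] with ω hω
  refine ⟨(hm.comp measurable_prodMk_left).aestronglyMeasurable, ?_⟩
  rw [hasFiniteIntegral_iff_ofReal (Eventually.of_forall fun u => seminormSq_nonneg hX.rate u ω _)]
  exact hω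

/-- Almost surely `‖Z‖²_X` is integrable over `(0, T]`, so that the pathwise product rule applies. -/
theorem isDiscountedSolution_neg_one [IsProbabilityMeasure P] (hX : IsMarkovChain P A X)
    (hC : ∀ i j, Measurable fun t => C t i j) (hD : ∀ i, Measurable fun t => D t i)
    (hC' : ∃ c : ℝ, ∀ t ≤ T, ∀ i j, |C t i j| ≤ c)
    (hD' : ∃ c : ℝ, ∀ t ≤ T, ∀ i, |D t i| ≤ c) (h : IsRBSDESolution P A X C D T G V Z K) :
    IsDiscountedSolution P (-1) A X C D T G V Z K := by
  refine ⟨h.toIsReflected, ?_⟩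
  filter_upwards [ae_integrableOn_seminormSq hX h.toIsReflected, h.equation] with ω hZ hω t ht
  exact discounted_equation hX.rate (hX.rcll ω) hC hD hC' hD' (h.V_rcll ω)
    (measurable_Z_path h.toIsReflected ω) hZ (h.K_continuous ω) (h.K_monotone ω) hω ht

end PartOne

end MarkovRBSDE

theorem mainTheorem3 {Ω : Type*} [MeasurableSpace Ω] (P : Measure Ω) [IsProbabilityMeasure P]
    {N : ℕ} (A : ℝ≥0 → Matrix (Fin N) (Fin N) ℝ) (X : ℝ≥0 → Ω → Fin N)
    (hX : IsMarkovChain P A X) (T : ℝ≥0)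
    (C : ℝ≥0 → Matrix (Fin N) (Fin N) ℝ) (D : ℝ≥0 → Fin N → ℝ)
    (hC : ∀ i j, Measurable fun t => C t i j) (hD : ∀ i, Measurable fun t => D t i)
    (hC' : ∃ c : ℝ, ∀ t ≤ T, ∀ i j, |C t i j| ≤ c) (hD' : ∃ c : ℝ, ∀ t ≤ T, ∀ i, |D t i| ≤ c)
    (G : ℝ≥0 → Ω → ℝ) (hG : StronglyAdapted (chainFiltration P X) G)
    (hG' : ∀ ω t, ContinuousWithinAt (fun u => G u ω) (Ici t) t)
    (V : ℝ≥0 → Ω → ℝ) (Z : ℝ≥0 → Ω → Fin N → ℝ) (K : ℝ≥0 → Ω → ℝ) :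
    (IsRBSDESolution P A X C D T G V Z K → IsDiscountedSolution P (-1) A X C D T G V Z K) ∧
    ∀ s : ℝ, s = 1 ∨ s = -1 → IsDiscountedSolution P s A X C D T G V Z K →
      ∀ t ≤ T,
        IsEssSup P
          ((fun τ => condExpE (chainFiltration P X t) P (reward s A X C D T G Z t τ)) ''
            stoppingTimes (chainFiltration P X) t T)
          (fun ω => (discV X C D V t ω : EReal)) ∧
        (∃ τ ∈ stoppingTimes (chainFiltration P X) t T,
          τ =ᵐ[P] firstHit G V t T ∧
          Integrable (reward s A X C D T G Z t τ) P ∧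
          discV X C D V t
            =ᵐ[P] P[reward s A X C D T G Z t τ | chainFiltration P X t]) ∧
        (P.IsComplete → firstHit G V t T ∈ stoppingTimes (chainFiltration P X) t T) := by
  refine ⟨isDiscountedSolution_neg_one hX hC hD hC' hD', fun s _ h t ht => ?_⟩
  have := chainFiltration_isRightContinuous P hX.rcll
  obtain ⟨τ, hτ, hhit⟩ := exists_stoppingTime_firstHit (F := chainFiltration P X) ht
    (fun u => (h.V_adapted u).measurable) (fun u => (hG u).measurable)
    (fun ω => (h.V_rcll ω).1) hG' h.obstacle
  obtain ⟨h1, h2, h3⟩ := isEssSup_reward hX hC hD hC' hD' hG' h ht hτ hhit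
  refine ⟨h1, ⟨τ, hτ, hhit, h2, h3⟩, fun hP => mem_stoppingTimes_of_ae_eq hτ hhit fun ω => ?_⟩
  obtain ⟨h4, h5, -⟩ := firstHit_mem ht (h.V_rcll ω).1 (hG' ω)
  exact ⟨h4, h5⟩
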